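/- Let $k$ be a field of characteristic $0$ and $\lambda\in k$ (with $\lambda^0=1$). **Trees.** Trees are planar, and every vertex has at least one input. For a tree $T$ let $\omega(T)$ be its number of vertices, $\alpha(T)$ its number of leaves, and let $\mathfrak T$ be the set of trees with $\omega(T)\ge 1$. The vertices $v_1<\dots<v_m$ of $T$ are ordered by the planar order (root first, then the branches from left to right). For a graded collection $C=\{C(n)\}_{n\ge1}$ put $C^{\otimes T}=C(\alpha(v_1))\otimes\dots\otimes C(\alpha(v_m))$, where $\alpha(v)$ is the number of inputs of $v$. A subtree $T'\subset T$ is a connected set of vertices, with at least one vertex; $T/T'$ is obtained from $T$ by replacing $T'$ by one vertex $v'$ of arity $\alpha(T')$. If $v'$ is the $i$-th vertex of $T/T'$ and $j=\omega(T')$, $\sigma(T,T')$ is the permutation of $\{1,\dots,\omega(T)\}$ that lists, in this order, $v_1,\dots,v_{i-1}$, then the vertices of $T'$, then the remaining vertices, each group in planar order. For a permutation $\sigma$, $r_\sigma(x_1\otimes\dots\otimes x_m)=\varepsilon(\sigma;x_1,\dots,x_m)\,x_{\sigma(1)}\otimes\dots\otimes x_{\sigma(m)}$ with the Koszul sign $\varepsilon$.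 **Homotopy cooperads.** A homotopy cooperad is a graded collection $C$ with linear maps $\Delta_T:C(\alpha(T))\to C^{\otimes T}$ of degree $\omega(T)-2$, $T\in\mathfrak T$ (extended by $0$ to the other $C(n)$), such that for each $c$ only finitely many $\Delta_T(c)$ are nonzero, and for every $T\in\mathfrak T$ $$\sum_{T'\subset T}\operatorname{sgn}(\sigma(T,T')^{-1})(-1)^{i-1+jl}\;r_{\sigma(T,T')^{-1}}\circ(\mathrm{id}^{\otimes i-1}\otimes\Delta_{T'}\otimes\mathrm{id}^{\otimes l})\circ\Delta_{T/T'}=0,\qquad l=\omega(T)-i-j+1 .$$ A strict morphism is a degree-preserving morphism of graded collections commuting with all $\Delta_T$. Let $I$ be the homotopy cooperad with $I(1)=k$ in degree $0$, $I(n)=0$ for $n\neq1$, whose only nonzero operation is $k\cong k\otimes k$ for the tree with two vertices and one leaf. A strict counit is a strict morphism $\varepsilon:C\to I$ such that, for all $n$ and $1\le i\le n$, $(\mathrm{id}\otimes\varepsilon)\Delta_T=\mathrm{id}_{C(n)}$ for the tree $T$ with root of arity $n$ and one further vertex, of arity $1$, on leaf $i$ of the root, and $(\varepsilon\otimes\mathrm{id})\Delta_T=\mathrm{id}_{C(n)}$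 for the tree $T$ with root of arity $1$ and one further vertex, of arity $n$. A coaugmentation is a strict morphism $\eta:I\to C$ with $\varepsilon\eta=\mathrm{id}_I$. A coaugmented homotopy cooperad is a homotopy cooperad with a strict counit and a coaugmentation. **The collection.** Let $\mathscr S(RB^{¡})(n)=k u_n\oplus k v_n$, $n\ge1$, with $|u_n|=0$, $|v_n|=1$, and define $\Delta_T$ on $u_n,v_n$, $n=\alpha(T)$, as follows (tensor factors in the planar order of the vertices of $T$). 1. If $T$ has two vertices, a root of arity $n-j+1$ and a vertex of arity $j$ on one of its leaves ($1\le j\le n$), then $\Delta_T(u_n)=u_{n-j+1}\otimes u_j$; moreover $\Delta_T(v_n)=\lambda^{j-1}v_{n-j+1}\otimes u_j$ if $j<n$, and $\Delta_T(v_n)=\lambda^{n-1}v_1\otimes u_n+u_1\otimes v_n$ if $j=n$. 2. If $T$ consists of a root of arity $m\ge2$ and, on its leaf $t$, a vertex of arity $r_t\ge1$ for each $1\le t\le m$ (all the leaves of $T$ being inputs of the latter vertices), then $\Delta_T(v_n)=(-1)^{m(m-1)/2}\,u_m\otimes v_{r_1}\otimes\dots\otimes v_{r_m}$. 3. If $T$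 consists of a root of arity $r_1\ge 1$, a vertex of arity $p$ on one leaf of the root, and $q-1$ vertices of arities $r_2,\dots,r_q\ge 1$ on the leaves $k_1<\dots<k_{q-1}$ of that second vertex, where $2\le q\le p$, then $\Delta_T(v_n)=(-1)^{q(q-1)/2}\lambda^{p-q}\,v_{r_1}\otimes u_p\otimes v_{r_2}\otimes\dots\otimes v_{r_q}$. 4. All other components of all $\Delta_T$ vanish. **Proposition.** The graded collection $\mathscr S(RB^{¡})$ with the operations $\{\Delta_T\}_{T\in\mathfrak T}$ is a coaugmented homotopy cooperad, with strict counit the natural projection $\mathscr S(RB^{¡})\twoheadrightarrow k u_1\cong I$ and coaugmentation the natural embedding $I\cong k u_1\hookrightarrow\mathscr S(RB^{¡})$. -/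

import Mathlib

open scoped TensorProduct

/-- Planar reduced trees: `leaf` is the tree without vertices, and `node n c` has a root vertex
with `n ≥ 1` ordered inputs, on the `i`-th of which the tree `c i` is grafted. -/
inductive PTree : Type
  | leaf : PTree
  | node (n : ℕ+) (c : Fin n → PTree) : PTree

namespace PTree

/-- The arities of the vertices, listed in the planar order: the root comes first, followed by the
vertices of the branches from left to right. -/
def arities : PTree → List ℕ+
  | leaf => []
  | node n c => n :: (List.ofFn fun i => arities (c i)).flatten

/-- The weight `ω(T)`: the number of vertices. The vertices of `T` are indexed by
`Fin T.weight`, in the planar order. -/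
def weight (T : PTree) : ℕ := T.arities.length

theorem weight_eq_length (T : PTree) : T.weight = T.arities.length := rfl

/-- The arity of a vertex. -/
def arity (T : PTree) (i : Fin T.weight) : ℕ+ := T.arities.get (i.cast T.weight_eq_length)

/-- The arity `α(T)` of a tree: its number of leaves. -/
def leaves : PTree → ℕ
  | leaf => 1
  | node _ c => ∑ i, leaves (c i)

/-- The tree with one vertex, of arity `n`. -/
def corolla (n : ℕ+) : PTree := node n fun _ => leaf

/-- The tree with two vertices: a root of arity `a`, and a vertex of arity `b` connected to the
leaf `i` of the root. -/
def twoVertex (a : ℕ+) (i : Fin a) (b : ℕ+) : PTree :=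
  node a (Function.update (fun _ => leaf) i (corolla b))

/-- The tree whose root has the given list of branches (for a nonempty list). -/
def ofBranches : List PTree → PTree
  | [] => leaf
  | t :: l => node l.length.succPNat fun i => (t :: l).get (i.cast (Nat.succPNat_coe l.length))

theorem weight_leaf : leaf.weight = 0 := rfl

theorem weight_node (n : ℕ+) (c : Fin n → PTree) :
    (node n c).weight = 1 + ∑ i, (c i).weight := by
  simp [weight, arities, List.length_flatten, List.map_ofFn, List.sum_ofFn, add_comm]

theorem weight_corolla (n : ℕ+) : (corolla n).weight = 1 := by
  simp [corolla, weight_node, weight_leaf]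

theorem weight_twoVertex (a : ℕ+) (i : Fin a) (b : ℕ+) : (twoVertex a i b).weight = 2 := by
  rw [twoVertex, weight_node, Finset.sum_eq_single i]
  · simp [weight_corolla]
  · intro j _ hj
    simp [Function.update_of_ne hj, weight_leaf]
  · simp

theorem weight_ofBranches {l : List PTree} (hl : l ≠ []) :
    (ofBranches l).weight = 1 + (l.map weight).sum := by
  cases l with
  | nil => exact absurd rfl hl
  | cons t l =>
    have h : ∑ i : Fin (l.length + 1), ((t :: l).get i).weight = ((t :: l).map weight).sum := by
      rw [← List.sum_ofFn]
      congr 1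
      exact (List.map_ofFn (f := (t :: l).get) (g := weight)).symm.trans
        (congrArg (List.map weight) (List.ofFn_get (t :: l)))
    rw [ofBranches, weight_node, ← h]
    congr 1

/-- Subtrees of `T` with at least one vertex that contain the root vertex: for each input of the
root vertex one chooses whether to stop there (`none`) or to go on with a subtree of the branch
that contains the root vertex of that branch. -/
def RootSub : PTree → Type
  | leaf => Empty
  | node n c => ∀ i : Fin n, Option (RootSub (c i))

/-- Subtrees (connected, with at least one vertex) of `T`: either the subtree contains the root
vertex, or it is a subtree of one of the branches of the root vertex. -/
def Sub : PTree → Type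
  | leaf => Empty
  | node n c => RootSub (node n c) ⊕ (Σ i : Fin n, Sub (c i))

noncomputable instance instFintypeRootSub : (T : PTree) → Fintype (RootSub T)
  | leaf => inferInstanceAs (Fintype Empty)
  | node n c =>
    have := fun i => instFintypeRootSub (c i)
    inferInstanceAs (Fintype (∀ i : Fin n, Option (RootSub (c i))))

noncomputable instance instFintypeSub : (T : PTree) → Fintype (Sub T)
  | leaf => inferInstanceAs (Fintype Empty)
  | node n c =>
    have := fun i => instFintypeSub (c i)
    inferInstanceAs (Fintype (RootSub (node n c) ⊕ (Σ i : Fin n, Sub (c i))))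

/-- The subtree itself, as a tree. -/
def RootSub.tree : (T : PTree) → RootSub T → PTree
  | leaf, r => Empty.elim r
  | node n c, r => node n fun i => match r i with
    | none => leaf
    | some s => RootSub.tree (c i) s

/-- The list of the branches of `T` that are grafted on the leaves of the subtree. -/
def RootSub.branches : (T : PTree) → RootSub T → List PTree
  | leaf, r => Empty.elim r
  | node n c, r => (List.ofFn fun i : Fin n => match r i with
    | none => [c i]
    | some s => RootSub.branches (c i) s).flatten

/-- For each vertex of `T`, in the planar order, whether it belongs to the subtree. -/
def RootSub.marks : (T : PTree) → RootSub T → List Bool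
  | leaf, r => Empty.elim r
  | node n c, r => true :: (List.ofFn fun i : Fin n => match r i with
    | none => List.replicate (c i).weight false
    | some s => RootSub.marks (c i) s).flatten

/-- The subtree `T'` itself, as a tree. -/
def Sub.tree : (T : PTree) → Sub T → PTree
  | leaf, s => Empty.elim s
  | node n c, Sum.inl r => RootSub.tree (node n c) r
  | node _ c, Sum.inr ⟨i, s⟩ => Sub.tree (c i) s

/-- The tree `T/T'`, in which the subtree `T'` is replaced by one vertex of arity `α(T')`. -/
def Sub.quotient : (T : PTree) → Sub T → PTree
  | leaf, s => Empty.elim s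
  | node n c, Sum.inl r => ofBranches (RootSub.branches (node n c) r)
  | node n c, Sum.inr ⟨i, s⟩ => node n (Function.update c i (Sub.quotient (c i) s))

/-- For each vertex of `T`, in the planar order, whether it belongs to the subtree `T'`. -/
def Sub.marks : (T : PTree) → Sub T → List Bool
  | leaf, s => Empty.elim s
  | node n c, Sum.inl r => RootSub.marks (node n c) r
  | node n c, Sum.inr ⟨i, s⟩ => false :: (List.ofFn fun j : Fin n =>
      if j = i then Sub.marks (c i) s else List.replicate (c j).weight false).flatten

/-- The number of vertices of `T` before the root vertex of `T'` in the planar order. These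
vertices are also the vertices of `T/T'` before the vertex `v'` that replaces `T'`, so that the
serial number of `v'` in `T/T'` is `i = pos + 1`. -/
def Sub.pos : (T : PTree) → Sub T → ℕ
  | leaf, s => Empty.elim s
  | node _ _, Sum.inl _ => 0
  | node n c, Sum.inr ⟨i, s⟩ =>
      1 + (∑ j : Fin n with j < i, (c j).weight) + Sub.pos (c i) s

/-- The permutation `σ(T,T')`. It lists first the vertices of `T` before the root of `T'`, then
the vertices of `T'`, then the other vertices, each of the three groups in the planar order
(`Tuple.sort` sorts by the key and keeps the order among equal keys). -/
def Sub.perm (T : PTree) (s : Sub T) : Equiv.Perm (Fin T.weight) :=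
  Tuple.sort fun v : Fin T.weight =>
    if v.val < Sub.pos T s then (0 : ℕ)
    else if (Sub.marks T s).getD v.val false = true then 1 else 2

theorem RootSub.weight_add (T : PTree) (r : RootSub T) :
    ((RootSub.branches T r).map weight).sum + (RootSub.tree T r).weight = T.weight := by
  induction T with
  | leaf => exact Empty.elim r
  | node n c ih =>
    rw [RootSub.branches, RootSub.tree, weight_node, weight_node, List.map_flatten,
      List.sum_flatten, List.map_ofFn, List.map_ofFn, List.sum_ofFn, add_left_comm,
      ← Finset.sum_add_distrib]
    congr 1
    refine Finset.sum_congr rfl fun i _ => ?_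
    rcases h : r i with _ | s
    · simp [h, weight_leaf]
    · simpa [h] using ih i s

theorem RootSub.branches_ne_nil (T : PTree) (r : RootSub T) : RootSub.branches T r ≠ [] := by
  induction T with
  | leaf => exact Empty.elim r
  | node n c ih =>
    intro h
    rw [RootSub.branches, List.flatten_eq_nil_iff] at h
    have h0 := h _ (List.mem_ofFn.2 ⟨⟨0, n.pos⟩, rfl⟩)
    generalize (⟨0, n.pos⟩ : Fin n) = i at h0
    rcases h1 : r i with _ | s
    · rw [h1] at h0
      exact List.cons_ne_nil _ _ h0
    · rw [h1] at h0
      exact ih _ s h0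

theorem Sub.weight_quotient (T : PTree) (s : Sub T) :
    (Sub.quotient T s).weight + (Sub.tree T s).weight = T.weight + 1 := by
  induction T with
  | leaf => exact Empty.elim s
  | node n c ih =>
    rcases s with r | ⟨i, s⟩
    · have h := RootSub.weight_add _ r
      simp only [Sub.quotient, Sub.tree]
      rw [weight_ofBranches (RootSub.branches_ne_nil _ r)]
      omega
    · simp only [Sub.quotient, Sub.tree]
      have h := ih i s
      rw [weight_node, weight_node, ← Finset.add_sum_erase _ _ (Finset.mem_univ i),
        ← Finset.add_sum_erase _ (fun j => (c j).weight) (Finset.mem_univ i),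
        Function.update_self, Finset.sum_congr rfl (g := fun j => (c j).weight)]
      · omega
      · intro j hj
        rw [Function.update_of_ne (Finset.ne_of_mem_erase hj)]

theorem Sub.pos_add_le (T : PTree) (s : Sub T) :
    Sub.pos T s + (Sub.tree T s).weight ≤ T.weight := by
  induction T with
  | leaf => exact Empty.elim s
  | node n c ih =>
    rcases s with r | ⟨i, s⟩
    · have h := RootSub.weight_add _ r
      simp only [Sub.pos, Sub.tree]
      omega
    · simp only [Sub.pos, Sub.tree]
      have h := ih i s
      have h2 : (∑ j : Fin n with j < i, (c j).weight) ≤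
          ∑ j ∈ Finset.univ.erase i, (c j).weight :=
        Finset.sum_le_sum_of_subset fun j hj => by
          simp only [Finset.mem_filter, Finset.mem_univ, true_and] at hj
          exact Finset.mem_erase.2 ⟨hj.ne, Finset.mem_univ _⟩
      rw [weight_node, ← Finset.add_sum_erase _ (fun j => (c j).weight) (Finset.mem_univ i)]
      omega

/-- The number `k = ω(T) - i - j + 1` of vertices of `T/T'` after `v'`. -/
def Sub.after (T : PTree) (s : Sub T) : ℕ := T.weight - (Sub.pos T s + (Sub.tree T s).weight)

theorem Sub.weight_eq (T : PTree) (s : Sub T) :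
    Sub.pos T s + (Sub.tree T s).weight + Sub.after T s = T.weight := by
  have := Sub.pos_add_le T s
  unfold Sub.after
  omega

theorem Sub.weight_quotient_eq (T : PTree) (s : Sub T) :
    (Sub.quotient T s).weight = Sub.pos T s + 1 + Sub.after T s := by
  have := Sub.weight_eq T s
  have := Sub.weight_quotient T s
  omega

end PTree

/-- A graded collection `{C(n)}`, `n ≥ 1`, of graded spaces over `k`, given by its total space
`C = ⨁ₙ C(n)` and the submodules `comp n d` of the elements of arity `n` and degree `d`. -/
structure GradedCollection (k C : Type*) [Field k] [AddCommGroup C] [Module k C] where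
  comp : ℕ+ → ℤ → Submodule k C
  isInternal : DirectSum.IsInternal fun p : ℕ+ × ℤ => comp p.1 p.2

namespace GradedCollection

noncomputable section

variable {k C D : Type*} [Field k] [AddCommGroup C] [Module k C] [AddCommGroup D] [Module k D]

/-- The space `C(n)` of all elements of arity `n`. -/
def arityPart (𝒞 : GradedCollection k C) (n : ℕ+) : Submodule k C := ⨆ d, 𝒞.comp n d

theorem bijective (𝒞 : GradedCollection k C) :
    Function.Bijective (DirectSum.coeLinearMap fun q : ℕ+ × ℤ => 𝒞.comp q.1 q.2) :=
  𝒞.isInternal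

/-- The projection of `C` onto its part of even (`p = 0`) or odd (`p = 1`) degree. -/
def parityProj (𝒞 : GradedCollection k C) (p : ZMod 2) : C →ₗ[k] C :=
  (DirectSum.toModule k (ℕ+ × ℤ) C fun q =>
    if ((q.2 : ℤ) : ZMod 2) = p then (𝒞.comp q.1 q.2).subtype else 0) ∘ₗ
  (LinearEquiv.ofBijective
    (DirectSum.coeLinearMap fun q : ℕ+ × ℤ => 𝒞.comp q.1 q.2) 𝒞.bijective).symm.toLinearMap

theorem parityProj_apply (𝒞 : GradedCollection k C) (p : ZMod 2) {n : ℕ+} {d : ℤ} {x : C}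
    (hx : x ∈ 𝒞.comp n d) : 𝒞.parityProj p x = if ((d : ℤ) : ZMod 2) = p then x else 0 := by
  have h : (LinearEquiv.ofBijective
      (DirectSum.coeLinearMap fun q : ℕ+ × ℤ => 𝒞.comp q.1 q.2) 𝒞.bijective).symm x =
      DirectSum.lof k (ℕ+ × ℤ) (fun q => 𝒞.comp q.1 q.2) (n, d) ⟨x, hx⟩ := by
    rw [LinearEquiv.symm_apply_eq, LinearEquiv.ofBijective_apply, DirectSum.coeLinearMap_lof]
  rw [parityProj, LinearMap.comp_apply, LinearEquiv.coe_coe, h, DirectSum.toModule_lof]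
  split_ifs <;> rfl

/-- The linear map `x ↦ (-1)^|x| x`. -/
def involution (𝒞 : GradedCollection k C) : C →ₗ[k] C := 𝒞.parityProj 0 - 𝒞.parityProj 1

/-- The part of degree `e` of `C^{⊗T} = C(α(v₁)) ⊗ ⋯ ⊗ C(α(vₙ))`, inside the tensor power of the
total space, where `v₁ < ⋯ < vₙ` are the vertices of `T`. -/
def treeTensor (𝒞 : GradedCollection k C) (T : PTree) (e : ℤ) :
    Submodule k (⨂[k]^T.weight C) :=
  Submodule.span k {y | ∃ (d : Fin T.weight → ℤ) (x : Fin T.weight → C),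
    (∀ i, x i ∈ 𝒞.comp (T.arity i) (d i)) ∧ ∑ i, d i = e ∧ y = PiTensorProduct.tprod k x}

/-- The Koszul sign `ε(σ; x₁, …, xₙ)` of homogeneous elements `xᵢ` of parity `p i`. -/
def koszulSign {n : ℕ} (σ : Equiv.Perm (Fin n)) (p : Fin n → ZMod 2) : ℤ :=
  ∏ s : Fin n, ∏ t : Fin n with s < t ∧ σ t < σ s, (-1) ^ ((p (σ s)).val * (p (σ t)).val)

/-- The action `r_σ(x₁ ⊗ ⋯ ⊗ xₙ) = ε(σ; x₁, …, xₙ) x_{σ(1)} ⊗ ⋯ ⊗ x_{σ(n)}`. -/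
def permAction (𝒞 : GradedCollection k C) {n : ℕ} (σ : Equiv.Perm (Fin n)) :
    ⨂[k]^n C →ₗ[k] ⨂[k]^n C :=
  ∑ p : Fin n → ZMod 2, (koszulSign σ p : k) •
    ((PiTensorProduct.reindex k (fun _ : Fin n => C) σ.symm).toLinearMap ∘ₗ
      PiTensorProduct.map fun i => 𝒞.parityProj (p i))

/-- The map `id^{⊗a} ⊗ f ⊗ id^{⊗b}` for a map `f : C → C^{⊗j}` whose degree is congruent to `j`
modulo two; by the Koszul rule, moving `f` past `x₁ ⊗ ⋯ ⊗ x_a` gives the sign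
`(-1)^{j(|x₁| + ⋯ + |x_a|)}`. -/
def insertMap (𝒞 : GradedCollection k C) (a j b : ℕ) (f : C →ₗ[k] ⨂[k]^j C) :
    ⨂[k]^(a + 1 + b) C →ₗ[k] ⨂[k]^(a + j + b) C :=
  TensorPower.mulEquiv.toLinearMap ∘ₗ
    TensorProduct.map
      (TensorPower.mulEquiv.toLinearMap ∘ₗ
        TensorProduct.map
          (PiTensorProduct.map fun _ : Fin a => (𝒞.involution ^ j : Module.End k C))
          (f ∘ₗ (PiTensorProduct.subsingletonEquiv (0 : Fin 1)).toLinearMap) ∘ₗ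
        TensorPower.mulEquiv.symm.toLinearMap)
      LinearMap.id ∘ₗ
    TensorPower.mulEquiv.symm.toLinearMap

/-- The composition `(id^{⊗(i-1)} ⊗ Δ_{T'} ⊗ id^{⊗k}) ∘ Δ_{T/T'}` for a subtree `T'` of `T`. -/
def subComp (𝒞 : GradedCollection k C) (Δ : (T : PTree) → C →ₗ[k] ⨂[k]^T.weight C)
    (T : PTree) (s : T.Sub) : C →ₗ[k] ⨂[k]^T.weight C :=
  (TensorPower.cast k C (PTree.Sub.weight_eq T s)).toLinearMap ∘ₗ
    𝒞.insertMap (PTree.Sub.pos T s) (PTree.Sub.tree T s).weight (PTree.Sub.after T s)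
      (Δ (PTree.Sub.tree T s)) ∘ₗ
    (TensorPower.cast k C (PTree.Sub.weight_quotient_eq T s)).toLinearMap ∘ₗ
    Δ (PTree.Sub.quotient T s)

/-- Homotopy cooperad structures on a graded collection. The operation
`Δ_T : C(α(T)) → C^{⊗T}`, of degree `ω(T) - 2`, is extended by zero to the total space `C`. The
value of `Δ` at the tree without vertices plays no role. -/
structure IsHomotopyCooperad (𝒞 : GradedCollection k C)
    (Δ : (T : PTree) → C →ₗ[k] ⨂[k]^T.weight C) : Prop where
  eq_zero : ∀ T : PTree, T ≠ PTree.leaf → ∀ n : ℕ+, (n : ℕ) ≠ T.leaves →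
    ∀ c ∈ 𝒞.arityPart n, Δ T c = 0
  mem_treeTensor : ∀ T : PTree, T ≠ PTree.leaf → ∀ n : ℕ+, (n : ℕ) = T.leaves →
    ∀ d : ℤ, ∀ c ∈ 𝒞.comp n d, Δ T c ∈ 𝒞.treeTensor T (d + (T.weight - 2))
  finite : ∀ c : C, {T : PTree | T ≠ PTree.leaf ∧ Δ T c ≠ 0}.Finite
  relation : ∀ T : PTree, T ≠ PTree.leaf →
    ∑ s : T.Sub,
      ((((Equiv.Perm.sign (PTree.Sub.perm T s)⁻¹ : ℤˣ) : ℤ) : k) *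
        (-1) ^ (PTree.Sub.pos T s + (PTree.Sub.tree T s).weight * PTree.Sub.after T s)) •
      (𝒞.permAction (PTree.Sub.perm T s)⁻¹ ∘ₗ 𝒞.subComp Δ T s) = 0

/-- Strict morphisms: degree-preserving morphisms of graded collections that are compatible with
all the operations `Δ_T`. -/
structure IsStrictMorphism (𝒞 : GradedCollection k C) (ΔC : (T : PTree) → C →ₗ[k] ⨂[k]^T.weight C)
    (𝒟 : GradedCollection k D) (ΔD : (T : PTree) → D →ₗ[k] ⨂[k]^T.weight D)
    (f : C →ₗ[k] D) : Prop where
  map_comp : ∀ n d, ∀ c ∈ 𝒞.comp n d, f c ∈ 𝒟.comp n d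
  comm : ∀ T : PTree, T ≠ PTree.leaf →
    ΔD T ∘ₗ f = PiTensorProduct.map (fun _ : Fin T.weight => f) ∘ₗ ΔC T

/-- The collection `I` with `I(1) = k` in degree zero and `I(n) = 0` for `n ≠ 1`. -/
def unit (k : Type*) [Field k] : GradedCollection k k where
  comp n d := if (n, d) = ((1, 0) : ℕ+ × ℤ) then ⊤ else ⊥
  isInternal := by
    classical
    refine DirectSum.isInternal_submodule_of_iSupIndep_of_iSup_eq_top ?_ ?_
    · intro p
      by_cases hp : p = (1, 0)
      · refine Disjoint.mono_right (le_of_eq ?_) disjoint_bot_right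
        simp only [iSup_eq_bot]
        intro q hq
        exact if_neg fun h => hq (h.trans hp.symm)
      · exact Disjoint.mono_left (le_of_eq (if_neg hp)) disjoint_bot_left
    · exact top_le_iff.1 (le_iSup_of_le ((1, 0) : ℕ+ × ℤ) (by simp))

/-- The operations of `I`: for the tree with two vertices and one leaf, `Δ_T` is the
identification `k ≅ k ⊗ k`, and all the other operations vanish. -/
def unitΔ (k : Type*) [Field k] (T : PTree) : k →ₗ[k] ⨂[k]^T.weight k :=
  open scoped Classical in
  if T = PTree.twoVertex 1 ⟨0, PNat.pos 1⟩ 1 then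
    LinearMap.toSpanSingleton k _ (PiTensorProduct.tprod k fun _ => 1)
  else 0

/-- The map `id ⊗ ε : C ⊗ C → C ⊗ k ≅ C`. -/
def idTensor (ε : C →ₗ[k] k) : ⨂[k]^2 C →ₗ[k] C :=
  (TensorProduct.rid k C).toLinearMap ∘ₗ
    TensorProduct.map (PiTensorProduct.subsingletonEquiv (0 : Fin 1)).toLinearMap
      (ε ∘ₗ (PiTensorProduct.subsingletonEquiv (0 : Fin 1)).toLinearMap) ∘ₗ
    (TensorPower.mulEquiv (R := k) (M := C) (n := 1) (m := 1)).symm.toLinearMap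

/-- The map `ε ⊗ id : C ⊗ C → k ⊗ C ≅ C`. -/
def tensorId (ε : C →ₗ[k] k) : ⨂[k]^2 C →ₗ[k] C :=
  (TensorProduct.lid k C).toLinearMap ∘ₗ
    TensorProduct.map (ε ∘ₗ (PiTensorProduct.subsingletonEquiv (0 : Fin 1)).toLinearMap)
      (PiTensorProduct.subsingletonEquiv (0 : Fin 1)).toLinearMap ∘ₗ
    (TensorPower.mulEquiv (R := k) (M := C) (n := 1) (m := 1)).symm.toLinearMap

/-- `ε : C → I` is a strict counit. -/
structure IsStrictCounit (𝒞 : GradedCollection k C)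
    (Δ : (T : PTree) → C →ₗ[k] ⨂[k]^T.weight C) (ε : C →ₗ[k] k) : Prop where
  strict : IsStrictMorphism 𝒞 Δ (unit k) (unitΔ k) ε
  right_counit : ∀ (n : ℕ+) (i : Fin n), ∀ c ∈ 𝒞.arityPart n,
    idTensor ε (TensorPower.cast k C (PTree.weight_twoVertex n i 1)
      (Δ (PTree.twoVertex n i 1) c)) = c
  left_counit : ∀ n : ℕ+, ∀ c ∈ 𝒞.arityPart n,
    tensorId ε (TensorPower.cast k C (PTree.weight_twoVertex 1 ⟨0, PNat.pos 1⟩ n)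
      (Δ (PTree.twoVertex 1 ⟨0, PNat.pos 1⟩ n) c)) = c

/-- `(C, Δ)` is a coaugmented homotopy cooperad with strict counit `ε : C → I` and coaugmentation
`η : I → C`. -/
structure IsCoaugmentedHomotopyCooperad (𝒞 : GradedCollection k C)
    (Δ : (T : PTree) → C →ₗ[k] ⨂[k]^T.weight C) (ε : C →ₗ[k] k) (η : k →ₗ[k] C) : Prop where
  homotopyCooperad : IsHomotopyCooperad 𝒞 Δ
  counit : IsStrictCounit 𝒞 Δ ε
  coaugmentation : IsStrictMorphism (unit k) (unitΔ k) 𝒞 Δ η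
  counit_comp : ε ∘ₗ η = LinearMap.id

end

end GradedCollection

namespace SRB

/-- The generators `u_n` and `v_n`, `n ≥ 1`. -/
inductive Gen : Type
  | u (n : ℕ+) : Gen
  | v (n : ℕ+) : Gen

/-- The arity of a generator. -/
def Gen.arity : Gen → ℕ+
  | u n => n
  | v n => n

/-- The degree of a generator. -/
def Gen.degree : Gen → ℤ
  | u _ => 0
  | v _ => 1

noncomputable section

/-- The total space `⨁ₙ (k uₙ ⊕ k vₙ)`. -/
abbrev Space (k : Type*) [Field k] : Type _ := Gen →₀ k

variable (k : Type*) [Field k]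

/-- The element `u_n`. -/
def u (n : ℕ+) : Space k := Finsupp.single (Gen.u n) 1

/-- The element `v_n`. -/
def v (n : ℕ+) : Space k := Finsupp.single (Gen.v n) 1

/-- The graded collection with `C(n) = k uₙ ⊕ k vₙ`, `|uₙ| = 0`, `|vₙ| = 1`. -/
def collection : GradedCollection k (Space k) where
  comp n d := Finsupp.supported k k {g | g.arity = n ∧ g.degree = d}
  isInternal := by
    classical
    refine DirectSum.isInternal_submodule_of_iSupIndep_of_iSup_eq_top ?_ ?_
    · intro p
      refine Disjoint.mono_right (iSup₂_le fun q hq => ?_)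
        (Finsupp.disjoint_supported_supported (M := k) (R := k)
          (disjoint_compl_right (a := {g : Gen | g.arity = p.1 ∧ g.degree = p.2})))
      refine Finsupp.supported_mono ?_
      rintro g ⟨h1, h2⟩ ⟨h3, h4⟩
      exact hq (Prod.ext (h1.symm.trans h3) (h2.symm.trans h4))
    · rw [← Finsupp.supported_iUnion, ← Finsupp.supported_univ]
      congr 1
      exact Set.eq_univ_of_forall fun g => Set.mem_iUnion.2 ⟨(g.arity, g.degree), rfl, rfl⟩

/-- Type (I): trees of weight two. -/
def IsTypeI (T : PTree) : Prop :=
  ∃ (a : ℕ+) (i : Fin a) (j : ℕ+), T = PTree.twoVertex a i j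

/-- Type (II): the root has arity `m ≥ 2`, and each of its leaves carries a corolla. -/
def IsTypeII (T : PTree) : Prop :=
  ∃ (m : ℕ+) (r : Fin m → ℕ+), 2 ≤ m ∧ T = PTree.node m fun t => PTree.corolla (r t)

/-- Type (III): the root has arity `r₁`, its leaf `i` carries a vertex of arity `p`, and a
nonempty set `K` of `q - 1 < p` leaves of that vertex carries corollas; nothing else is
grafted. -/
def IsTypeIII (T : PTree) : Prop :=
  ∃ (r₁ : ℕ+) (i : Fin r₁) (p : ℕ+) (K : Finset (Fin p)) (r : Fin p → ℕ+),
    K.Nonempty ∧ K.card < p ∧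
    T = PTree.node r₁ (Function.update (fun _ => PTree.leaf) i
      (PTree.node p fun t => if t ∈ K then PTree.corolla (r t) else PTree.leaf))

/-- The arity of the second vertex of a tree (with at least two vertices). -/
def secondArity (T : PTree) : ℕ := (T.arities.getD 1 1 : ℕ+)

/-- The tensor in `C^{⊗T}` with the `l`-th vertex (numbered from zero) decorated by `u_r` if
`l = m`, and by `v_r` otherwise, where `r` is the arity of the vertex. -/
def uAt (T : PTree) (m : ℕ) : ⨂[k]^T.weight (Space k) :=
  PiTensorProduct.tprod k fun l : Fin T.weight =>
    if l.val = m then u k (T.arity l) else v k (T.arity l)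

/-- The tensor in `C^{⊗T}` with each vertex decorated by `u_r`, where `r` is its arity. -/
def allU (T : PTree) : ⨂[k]^T.weight (Space k) :=
  PiTensorProduct.tprod k fun l : Fin T.weight => u k (T.arity l)

variable {k}

/-- `Δ_T(u_n)`, for `n = α(T)`. -/
def ΔU (T : PTree) : ⨂[k]^T.weight (Space k) :=
  open scoped Classical in
  if IsTypeI T then allU k T else 0

/-- `Δ_T(v_n)`, for `n = α(T)`, where `j` is the arity of the second vertex in type (I), the
number `m` of vertices other than the root is the arity of the root in type (II), and in type
(III) `p` is the arity of the second vertex and `q = ω(T) - 1`. -/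
def ΔV (lam : k) (T : PTree) : ⨂[k]^T.weight (Space k) :=
  open scoped Classical in
  if IsTypeI T then
    let j := secondArity T
    if j = T.leaves then lam ^ (T.leaves - 1) • uAt k T 1 + uAt k T 0
    else lam ^ (j - 1) • uAt k T 1
  else if IsTypeII T then
    let m := T.weight - 1
    (-1 : k) ^ (m * (m - 1) / 2) • uAt k T 0
  else if IsTypeIII T then
    let p := secondArity T
    let q := T.weight - 1
    ((-1 : k) ^ (q * (q - 1) / 2) * lam ^ (p - q)) • uAt k T 1
  else 0

/-- The operations `Δ_T`. -/
def Δ (lam : k) (T : PTree) : Space k →ₗ[k] ⨂[k]^T.weight (Space k) :=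
  Finsupp.linearCombination k fun g : Gen =>
    if (g.arity : ℕ) = T.leaves then
      match g with
      | Gen.u _ => ΔU T
      | Gen.v _ => ΔV lam T
    else 0

variable (k)

/-- The natural projection onto `k u₁ ≅ I`. -/
def counit : Space k →ₗ[k] k := Finsupp.lapply (Gen.u 1)

/-- The natural embedding of `I ≅ k u₁`. -/
def coaugmentation : k →ₗ[k] Space k := Finsupp.lsingle (Gen.u 1)

end

end SRB

/-!
The relation for a tree `T` is an identity in `C^{⊗T}`. It is compared coordinate by coordinate on
the basis of `C^{⊗T}` consisting of the decorations of the vertices of `T` by `u` and `v`, that is,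
by `DecTree`s `E` of shape `T`; tensors of other arities do not occur (`lc_term_eq_zero`). The
coordinate at `E` of the term of a subtree `T'` is a sign times the sum, over the two decorations
of the vertex `v'` of `T/T'`, of the product of the coefficients of the decorated trees `T/T'` and
`T'` in the operations.

*Signs.* Multiply the coordinate at `E` by `(-1)^N`, where `N = nexp` counts, for each `v`, the
vertices after it. This is a desuspension: the permutation sign, the Koszul sign, the sign
`(-1)^{i-1+jl}` and the sign from moving `Δ_{T'}` past its left neighbours combine to the Koszul
sign for which the `u` are odd and the `v` are even (`total_sign`). Concretely, a subtree gets the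
sign `(-1)^s`, where `s = sgnExp` is the number of `u` before the subtree plus the number of
inversions between `u` that arise when the vertices of the subtree are pulled together. The signs
`(-1)^{m(m-1)/2}` and `(-1)^{q(q-1)/2}` in the operations are absorbed as well, and `lc_Δ`
identifies the coefficients with the following weights.

*Weights.* Write `D γ (c₁, …, cₙ) = ∑ᵢ γ(cᵢ) ∏_{j≠i} [cⱼ is a leaf]` (`der`). A tree with root `u`
and branches `c` has the weight `D [u-corolla] c` for `Δ(u)` (`wtU`) and `∏ᵢ [cᵢ is a v-corolla]`
for `Δ(v)`; a tree with root `v` has the weight `0` for `Δ(u)` and `-D g c` for `Δ(v)` (`wtV`).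
Here `g` (`gw`) lives on trees with root `u`, each input of which is free or carries a
`v`-corolla, and its value `λ^{f-1}` for `f ≥ 1` free inputs, and `0` for `f = 0`, is
`(∏ (vᵢ + λ ℓᵢ) - ∏ vᵢ) / λ` in the indicators `ℓᵢ` of free inputs and `vᵢ` of `v`-corollas
(`quo`). Together, the operations of types (I), (II) and (III) are thus described by two products
and one divided difference.

*The quadratic identity.* What remains is `sum_wtU` and `sum_wtV`. Apart from the sign `-1` that a
root `u` gives to the subtrees of its branches, the signs of most terms of nonzero weight are
trivial. The exceptions are pairs of distinguished branches of the root: each pair occurs twice,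
with opposite signs, and cancels (`sum_der_der`). If the root is a `u`, contracting an edge
between two `u` inserts the branches of the upper vertex into those of the root, and for a product
of indicators these terms cancel against the subtrees of the branches, which carry the sign `-1`
of the root. If the root is a `v`, the claim reduces to the identity `sum_gw_squot` for `g`, whose
core is the substitution rule `quo_insert` for the divided difference.

The remaining axioms are direct: a tree on which an operation does not vanish has height at most
three, and there are finitely many of these with a given number of leaves; every `Δ_T(v_n)` is a
sum of tensors containing a `v`, which the counit kills; and the components with two vertices are
explicit.
-/

namespace SRB

open PTree

/-! ### Decorated trees -/

/-- The generator of arity `n` named by a Boolean: `u_n` for `true` and `v_n` for `false`. -/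
def gen (b : Bool) (n : ℕ+) : Gen := if b then Gen.u n else Gen.v n

/-- Whether a generator is one of the `u_n`. -/
def Gen.isU : Gen → Bool
  | Gen.u _ => true
  | Gen.v _ => false

@[simp] theorem isU_gen (b : Bool) (n : ℕ+) : (gen b n).isU = b := by cases b <;> rfl

@[simp] theorem arity_gen (b : Bool) (n : ℕ+) : (gen b n).arity = n := by cases b <;> rfl

theorem gen_isU_arity (g : Gen) : gen g.isU g.arity = g := by cases g <;> rfl

/-- Planar trees each of whose vertices is decorated by `u` (`true`) or `v` (`false`); they index
the monomial basis of `C^{⊗T}`. -/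
inductive DecTree : Type
  | leaf : DecTree
  | node (b : Bool) (n : ℕ+) (c : Fin n → DecTree) : DecTree

namespace DecTree

/-- The underlying planar tree. -/
def shape : DecTree → PTree
  | leaf => PTree.leaf
  | node _ n c => PTree.node n fun i => shape (c i)

/-- The generators that decorate the vertices, in the planar order. -/
def gens : DecTree → List Gen
  | leaf => []
  | node b n c => gen b n :: (List.ofFn fun i => gens (c i)).flatten

/-- The decorated tree with a root decorated by `b` and the given list of branches. -/
def ofBranches (b : Bool) : List DecTree → DecTree
  | [] => leaf
  | t :: l => node b l.length.succPNat fun i => (t :: l).get (i.cast (Nat.succPNat_coe l.length))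

/-- A subtree containing the root, with the induced decoration. -/
def rtree : (E : DecTree) → RootSub E.shape → DecTree
  | leaf, r => Empty.elim r
  | node b n c, r => node b n fun i => match r i with
    | none => leaf
    | some s => rtree (c i) s

/-- The decorated branches grafted on the leaves of a subtree containing the root. -/
def rbranches : (E : DecTree) → RootSub E.shape → List DecTree
  | leaf, r => Empty.elim r
  | node _ n c, r => (List.ofFn fun i : Fin n => match r i with
    | none => [c i]
    | some s => rbranches (c i) s).flatten

/-- The decorations in the planar order, each marked by whether its vertex belongs to the given
subtree containing the root. -/
def rmarks : (E : DecTree) → RootSub E.shape → List (Bool × Gen)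
  | leaf, r => Empty.elim r
  | node b n c, r => (true, gen b n) :: (List.ofFn fun i : Fin n => match r i with
    | none => (gens (c i)).map (Prod.mk false)
    | some s => rmarks (c i) s).flatten

/-- A possibly empty subtree containing the root if it is nonempty: `none` gives `leaf`. -/
def otree (E : DecTree) : Option (RootSub E.shape) → DecTree
  | none => leaf
  | some s => rtree E s

/-- The branches above a possibly empty subtree: `none` leaves all of `E`. -/
def obranches (E : DecTree) : Option (RootSub E.shape) → List DecTree
  | none => [E]
  | some s => rbranches E s

/-- The marked decorations for a possibly empty subtree. -/
def omarks (E : DecTree) : Option (RootSub E.shape) → List (Bool × Gen)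
  | none => (gens E).map (Prod.mk false)
  | some s => rmarks E s

/-- A choice of a possibly empty subtree in every branch of the root is a subtree containing the
root. -/
def mkSub {b : Bool} {n : ℕ+} {c : Fin n → DecTree}
    (r : ∀ i : Fin n, Option (RootSub (c i).shape)) : RootSub (node b n c).shape := r

theorem rtree_node (b : Bool) (n : ℕ+) (c : Fin n → DecTree)
    (r : ∀ i : Fin n, Option (RootSub (c i).shape)) :
    rtree (node b n c) (mkSub r) = node b n fun i => otree (c i) (r i) := by
  rw [rtree]
  congr 1
  funext i
  rcases h : r i with _ | s <;> simp [mkSub, h, otree]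

theorem rbranches_node (b : Bool) (n : ℕ+) (c : Fin n → DecTree)
    (r : ∀ i : Fin n, Option (RootSub (c i).shape)) :
    rbranches (node b n c) (mkSub r) = (List.ofFn fun i => obranches (c i) (r i)).flatten := by
  rw [rbranches]
  congr 2
  funext i
  rcases h : r i with _ | s <;> simp [mkSub, h, obranches]

theorem rmarks_node (b : Bool) (n : ℕ+) (c : Fin n → DecTree)
    (r : ∀ i : Fin n, Option (RootSub (c i).shape)) :
    rmarks (node b n c) (mkSub r) =
      (true, gen b n) :: (List.ofFn fun i => omarks (c i) (r i)).flatten := by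
  rw [rmarks]
  congr 3
  funext i
  rcases h : r i with _ | s <;> simp [mkSub, h, omarks]

/-- The subtree `T'` with the induced decoration. -/
def stree : (E : DecTree) → Sub E.shape → DecTree
  | leaf, s => Empty.elim s
  | node b n c, Sum.inl r => rtree (node b n c) r
  | node _ _ c, Sum.inr ⟨i, s⟩ => stree (c i) s

/-- The quotient `T/T'`, with the vertex that replaces `T'` decorated by `b`. -/
def squot (b : Bool) : (E : DecTree) → Sub E.shape → DecTree
  | leaf, s => Empty.elim s
  | node b' n c, Sum.inl r => ofBranches b (rbranches (node b' n c) r)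
  | node b' n c, Sum.inr ⟨i, s⟩ => node b' n (Function.update c i (squot b (c i) s))

theorem ofBranches_eq (b : Bool) {l : List DecTree} {m : ℕ+} (h : l.length = m) :
    ofBranches b l = node b m fun i => l[i.val]'(by rw [h]; exact i.2) := by
  cases l with
  | nil => exact absurd h.symm m.pos.ne'
  | cons t l =>
    obtain rfl : m = l.length.succPNat := PNat.eq (by simpa using h.symm)
    rfl

theorem _root_.PTree.ofBranches_eq {l : List PTree} {m : ℕ+} (h : l.length = m) :
    PTree.ofBranches l = PTree.node m fun i => l[i.val]'(by rw [h]; exact i.2) := by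
  cases l with
  | nil => exact absurd h.symm m.pos.ne'
  | cons t l =>
    obtain rfl : m = l.length.succPNat := PNat.eq (by simpa using h.symm)
    rfl

theorem shape_ofBranches (b : Bool) (l : List DecTree) :
    (ofBranches b l).shape = PTree.ofBranches (l.map shape) := by
  cases l with
  | nil => rfl
  | cons t l =>
    rw [ofBranches_eq (m := l.length.succPNat) b (by simp),
      PTree.ofBranches_eq (m := l.length.succPNat) (by simp)]
    simp only [shape, List.getElem_map]

theorem shape_rtree (E : DecTree) (r : RootSub E.shape) :
    (rtree E r).shape = RootSub.tree E.shape r := by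
  induction E with
  | leaf => exact Empty.elim r
  | node b n c ih =>
    simp only [rtree, shape, RootSub.tree]
    congr 1
    funext i
    rcases h : r i with _ | s
    · rfl
    · exact ih i s

theorem map_shape_rbranches (E : DecTree) (r : RootSub E.shape) :
    (rbranches E r).map shape = RootSub.branches E.shape r := by
  induction E with
  | leaf => exact Empty.elim r
  | node b n c ih =>
    simp only [rbranches, shape, RootSub.branches, List.map_flatten, List.map_ofFn]
    congr 2
    funext i
    rcases h : r i with _ | s
    · simp [h]
    · simpa [h] using ih i s

theorem shape_stree (E : DecTree) (s : Sub E.shape) :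
    (stree E s).shape = Sub.tree E.shape s := by
  induction E with
  | leaf => exact Empty.elim s
  | node b n c ih =>
    rcases s with r | ⟨i, s⟩
    · exact shape_rtree (node b n c) r
    · exact ih i s

theorem shape_squot (b : Bool) (E : DecTree) (s : Sub E.shape) :
    (squot b E s).shape = Sub.quotient E.shape s := by
  induction E with
  | leaf => exact Empty.elim s
  | node b' n c ih =>
    rcases s with r | ⟨i, s⟩
    · exact (shape_ofBranches _ _).trans
        (congrArg PTree.ofBranches (map_shape_rbranches (node b' n c) r))
    · simp only [squot, shape, Sub.quotient]
      congr 1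
      funext j
      rcases eq_or_ne j i with rfl | hj
      · simpa using ih j s
      · simp [Function.update_of_ne hj]

theorem map_arity_gens (E : DecTree) : E.gens.map Gen.arity = E.shape.arities := by
  induction E with
  | leaf => rfl
  | node b n c ih =>
    simp only [gens, shape, arities, List.map_cons, arity_gen, List.map_flatten, List.map_ofFn]
    congr 3
    funext i
    exact ih i

theorem length_gens (E : DecTree) : E.gens.length = E.shape.weight := by
  rw [weight, ← map_arity_gens, List.length_map]

end DecTree

/-! ### Marked lists and inversions -/

/-- Concatenation of blocks, one of which is singled out. -/
theorem flatten_ofFn_split {α : Type*} {n : ℕ} (f : Fin n → List α) (i : Fin n) :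
    (List.ofFn f).flatten =
      ((List.ofFn f).take i).flatten ++ (f i ++ ((List.ofFn f).drop (i + 1)).flatten) := by
  conv_lhs => rw [← List.take_append_drop i (List.ofFn f), List.flatten_append]
  rw [List.drop_eq_getElem_cons (by simp), List.flatten_cons]
  simp

theorem take_ofFn_congr {α : Type*} {n : ℕ} {f g : Fin n → α} (i : ℕ)
    (h : ∀ j : Fin n, j.val < i → f j = g j) : (List.ofFn f).take i = (List.ofFn g).take i := by
  refine List.ext_getElem (by simp) fun m h1 h2 => ?_
  simp only [List.length_take, List.length_ofFn, lt_min_iff] at h1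
  simpa using h ⟨m, h1.2⟩ h1.1

theorem drop_ofFn_congr {α : Type*} {n : ℕ} {f g : Fin n → α} (i : ℕ)
    (h : ∀ j : Fin n, i ≤ j.val → f j = g j) : (List.ofFn f).drop i = (List.ofFn g).drop i := by
  refine List.ext_getElem (by simp) fun m h1 h2 => ?_
  simp only [List.length_drop, List.length_ofFn] at h1
  simpa using h ⟨i + m, by omega⟩ (by simp)

/-- The unmarked entries of a list. -/
def outs {α : Type*} (l : List (Bool × α)) : List α := (l.filter fun x => !x.1).map Prod.snd

/-- The marked entries of a list. -/
def ins {α : Type*} (l : List (Bool × α)) : List α := (l.filter fun x => x.1).map Prod.snd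

section marks
variable {α : Type*}

@[simp] theorem outs_nil : outs ([] : List (Bool × α)) = [] := rfl
@[simp] theorem ins_nil : ins ([] : List (Bool × α)) = [] := rfl
@[simp] theorem outs_cons_true (a : α) (l : List (Bool × α)) : outs ((true, a) :: l) = outs l := rfl
@[simp] theorem ins_cons_true (a : α) (l : List (Bool × α)) :
    ins ((true, a) :: l) = a :: ins l := rfl
@[simp] theorem outs_cons_false (a : α) (l : List (Bool × α)) :
    outs ((false, a) :: l) = a :: outs l := rfl
@[simp] theorem ins_cons_false (a : α) (l : List (Bool × α)) : ins ((false, a) :: l) = ins l := rfl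
@[simp] theorem outs_append (l l' : List (Bool × α)) : outs (l ++ l') = outs l ++ outs l' := by
  simp [outs]
@[simp] theorem ins_append (l l' : List (Bool × α)) : ins (l ++ l') = ins l ++ ins l' := by
  simp [ins]
@[simp] theorem outs_map_false (l : List α) : outs (l.map (Prod.mk false)) = l := by
  induction l <;> simp_all
@[simp] theorem ins_map_false (l : List α) : ins (l.map (Prod.mk false)) = [] := by
  induction l <;> simp_all
theorem outs_flatten (l : List (List (Bool × α))) :
    outs l.flatten = (l.map outs).flatten := by
  induction l <;> simp_all
theorem ins_flatten (l : List (List (Bool × α))) :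
    ins l.flatten = (l.map ins).flatten := by
  induction l <;> simp_all

end marks

/-- The number of entries `u` in a list of generators. -/
def cntU (l : List Gen) : ℕ := l.countP Gen.isU

@[simp] theorem cntU_nil : cntU [] = 0 := rfl
@[simp] theorem cntU_cons (g : Gen) (l : List Gen) :
    cntU (g :: l) = (if g.isU then 1 else 0) + cntU l := by
  rw [cntU, List.countP_cons, add_comm]; rfl
@[simp] theorem cntU_append (l l' : List Gen) : cntU (l ++ l') = cntU l + cntU l' := by
  simp [cntU]

/-- The number of inversions between entries `u` when the marked entries are moved to the front:
pairs of an unmarked `u` followed by a marked `u`. -/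
def inv : List (Bool × Gen) → ℕ
  | [] => 0
  | x :: l => (if !x.1 && x.2.isU then cntU (ins l) else 0) + inv l

@[simp] theorem inv_nil : inv [] = 0 := rfl
@[simp] theorem inv_cons_true (g : Gen) (l : List (Bool × Gen)) : inv ((true, g) :: l) = inv l := by
  simp [inv]
theorem inv_cons_false (g : Gen) (l : List (Bool × Gen)) :
    inv ((false, g) :: l) = (if g.isU then cntU (ins l) else 0) + inv l := by
  simp [inv]

theorem inv_append (l l' : List (Bool × Gen)) :
    inv (l ++ l') = inv l + inv l' + cntU (outs l) * cntU (ins l') := by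
  induction l with
  | nil => simp
  | cons x l ih =>
    rcases x with ⟨_ | _, g⟩
    · rw [List.cons_append, inv_cons_false, inv_cons_false, ih, ins_append, cntU_append,
        outs_cons_false, cntU_cons]
      split_ifs <;> ring
    · simpa using ih

theorem inv_eq_zero_of_outs {l : List (Bool × Gen)} (h : cntU (outs l) = 0) : inv l = 0 := by
  induction l with
  | nil => rfl
  | cons x l ih =>
    rcases x with ⟨_ | _, g⟩
    · rw [outs_cons_false, cntU_cons] at h
      rw [inv_cons_false, ih (by omega), if_neg]
      intro hg
      simp [hg] at h
    · simpa using ih (by simpa using h)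

theorem inv_eq_zero_of_ins {l : List (Bool × Gen)} (h : cntU (ins l) = 0) : inv l = 0 := by
  induction l with
  | nil => rfl
  | cons x l ih =>
    rcases x with ⟨_ | _, g⟩
    · rw [ins_cons_false] at h
      rw [inv_cons_false, ih h, h]
      simp
    · rw [ins_cons_true, cntU_cons] at h
      simpa using ih (by omega)

theorem cntU_flatten (l : List (List Gen)) : cntU l.flatten = (l.map cntU).sum := by
  induction l <;> simp_all

namespace DecTree

/-! ### Subtrees in the planar order -/

theorem ins_rmarks (E : DecTree) (r : RootSub E.shape) : ins (rmarks E r) = gens (rtree E r) := by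
  induction E with
  | leaf => exact Empty.elim r
  | node b n c ih =>
    simp only [rmarks, rtree, gens, ins_cons_true, ins_flatten, List.map_ofFn]
    congr 3
    funext i
    rcases h : r i with _ | s
    · simp [h, gens]
    · simpa [h] using ih i s

theorem outs_rmarks (E : DecTree) (r : RootSub E.shape) :
    outs (rmarks E r) = ((rbranches E r).map gens).flatten := by
  induction E with
  | leaf => exact Empty.elim r
  | node b n c ih =>
    simp only [rmarks, rbranches, outs_cons_true, outs_flatten, List.map_ofFn, List.map_flatten]
    rw [List.flatten_flatten, List.map_ofFn]
    congr 2
    funext i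
    rcases h : r i with _ | s
    · simp [h]
    · simpa [h] using ih i s

theorem map_fst_rmarks (E : DecTree) (r : RootSub E.shape) :
    (rmarks E r).map Prod.fst = RootSub.marks E.shape r := by
  induction E with
  | leaf => exact Empty.elim r
  | node b n c ih =>
    simp only [rmarks, shape, RootSub.marks, List.map_cons, List.map_flatten, List.map_ofFn]
    congr 3
    funext i
    rcases h : r i with _ | s
    · simp only [Function.comp, h, List.map_map, ← length_gens]
      exact List.map_const' 
    · simpa [h] using ih i s

theorem map_snd_rmarks (E : DecTree) (r : RootSub E.shape) :
    (rmarks E r).map Prod.snd = gens E := by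
  induction E with
  | leaf => exact Empty.elim r
  | node b n c ih =>
    simp only [rmarks, gens, List.map_cons, List.map_flatten, List.map_ofFn]
    congr 3
    funext i
    rcases h : r i with _ | s
    · simp [Function.comp, h]
    · simpa [h] using ih i s

theorem length_rbranches (E : DecTree) (r : RootSub E.shape) :
    (rbranches E r).length = (rtree E r).shape.leaves := by
  induction E with
  | leaf => exact Empty.elim r
  | node b n c ih =>
    simp only [rbranches, rtree, shape, leaves, List.length_flatten, List.map_ofFn, List.sum_ofFn]
    refine Finset.sum_congr rfl fun i _ => ?_
    rcases h : r i with _ | s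
    · simp [h, shape, leaves]
    · simpa [h] using ih i s

theorem gens_ofBranches (b : Bool) {l : List DecTree} {m : ℕ+} (h : l.length = m) :
    (ofBranches b l).gens = gen b m :: (l.map gens).flatten := by
  rw [ofBranches_eq b h, gens]
  congr 2
  exact List.ext_getElem (by simp [h]) fun i h1 h2 => by simp

/-- The sign exponent of a subtree when only the vertices decorated by `u` are odd: the number of
`u` before the subtree, plus the number of inversions between `u`s created by pulling the vertices
of the subtree together. -/
def sgnExp : (E : DecTree) → Sub E.shape → ℕ
  | leaf, s => Empty.elim s
  | node b n c, Sum.inl r => inv (rmarks (node b n c) r)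
  | node b _ c, Sum.inr ⟨i, s⟩ => (if b then 1 else 0) +
      cntU (((List.ofFn fun j => gens (c j)).take i).flatten) + sgnExp (c i) s

/-- The position of a subtree in the list of decorations: `pre` decorates the vertices before its
root, and `post` the remaining ones, marked by whether they belong to the subtree. -/
theorem exists_split (E : DecTree) (s : Sub E.shape) :
    ∃ (pre : List Gen) (post : List (Bool × Gen)),
      gens E = pre ++ post.map Prod.snd ∧
      Sub.marks E.shape s = List.replicate pre.length false ++ post.map Prod.fst ∧
      Sub.pos E.shape s = pre.length ∧
      gens (stree E s) = ins post ∧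
      (∀ (b : Bool) (m : ℕ+), (stree E s).shape.leaves = m →
        gens (squot b E s) = pre ++ gen b m :: outs post) ∧
      sgnExp E s = cntU pre + inv post := by
  induction E with
  | leaf => exact Empty.elim s
  | node b n c ih =>
    rcases s with r | ⟨i, s⟩
    · refine ⟨[], rmarks (node b n c) r, ?_, ?_, ?_, ?_, ?_, ?_⟩
      · exact (map_snd_rmarks (node b n c) r).symm
      · exact (map_fst_rmarks (node b n c) r).symm
      · rfl
      · exact (ins_rmarks (node b n c) r).symm
      · intro b' m hm
        exact (gens_ofBranches b' ((length_rbranches (node b n c) r).trans hm)).trans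
          (congrArg _ (outs_rmarks (node b n c) r).symm)
      · simp [sgnExp]
    · obtain ⟨pre, post, h1, h2, h3, h4, h5, h6⟩ := ih i s
      refine ⟨gen b n :: ((List.ofFn fun j => gens (c j)).take i).flatten ++ pre,
        post ++ (((List.ofFn fun j => gens (c j)).drop (i + 1)).flatten).map (Prod.mk false),
        ?_, ?_, ?_, ?_, ?_, ?_⟩
      · rw [gens, flatten_ofFn_split _ i, h1]
        generalize ((List.ofFn fun j => gens (c j)).drop (i + 1)).flatten = Y
        simp [Function.comp_def]
      · simp only [shape, Sub.marks]
        rw [flatten_ofFn_split _ i, if_pos rfl]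
        have e1 : ((List.ofFn fun j : Fin n => if j = i then Sub.marks (c i).shape s else
            List.replicate (c j).shape.weight false).take i).flatten =
            List.replicate ((List.ofFn fun j => gens (c j)).take i).flatten.length false := by
          rw [take_ofFn_congr (g := fun j => List.replicate (gens (c j)).length false)]
          · have : (List.ofFn fun j => List.replicate (gens (c j)).length false) =
              (List.ofFn fun j => gens (c j)).map fun l => List.replicate l.length false := by
              rw [List.map_ofFn]; rfl
            rw [this, ← List.map_take]
            generalize (List.ofFn fun j => gens (c j)).take i = L
            induction L with
            | nil => rfl
            | cons x L ihL => simp [ihL]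
          · intro j hj
            rw [if_neg (by rintro rfl; exact lt_irrefl _ hj), length_gens]
        have e2 : ((List.ofFn fun j : Fin n => if j = i then Sub.marks (c i).shape s else
            List.replicate (c j).shape.weight false).drop (i + 1)).flatten =
            List.replicate ((List.ofFn fun j => gens (c j)).drop (i + 1)).flatten.length false := by
          rw [drop_ofFn_congr (g := fun j => List.replicate (gens (c j)).length false)]
          · have : (List.ofFn fun j => List.replicate (gens (c j)).length false) =
              (List.ofFn fun j => gens (c j)).map fun l => List.replicate l.length false := by
              rw [List.map_ofFn]; rfl
            rw [this, ← List.map_drop]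
            generalize (List.ofFn fun j => gens (c j)).drop (i + 1) = L
            induction L with
            | nil => rfl
            | cons x L ihL => simp [ihL]
          · intro j hj
            rw [if_neg (by rintro rfl; omega), length_gens]
        rw [e1, e2, h2]
        generalize ((List.ofFn fun j => gens (c j)).drop (i + 1)).flatten = Y
        generalize ((List.ofFn fun j => gens (c j)).take i).flatten = X
        simp only [List.cons_append, List.length_cons, List.length_append, List.map_append,
          List.map_map]
        rw [List.replicate_succ, List.replicate_add]
        simp only [List.cons_append, List.append_assoc]
        congr 4
        exact (List.map_const' (l := Y)).symm
      · simp only [shape, Sub.pos, h3]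
        have : (∑ j : Fin n with j < i, (c j).shape.weight) =
            ((List.ofFn fun j => gens (c j)).take i).flatten.length := by
          have e : (List.ofFn fun j => gens (c j)).map List.length =
              List.ofFn fun j => (c j).shape.weight := by
            rw [List.map_ofFn]
            congr 1
            funext j
            exact length_gens (c j)
          rw [List.length_flatten, List.map_take, e, List.sum_take_ofFn]
          rfl
        rw [this]
        simp only [List.cons_append, List.length_cons, List.length_append]
        omega
      · simp only [stree, h4, ins_append, ins_map_false, List.append_nil]
      · intro b' m hm
        simp only [squot, gens]
        rw [flatten_ofFn_split _ i, Function.update_self, h5 b' m hm,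
          take_ofFn_congr (g := fun j => gens (c j)), drop_ofFn_congr (g := fun j => gens (c j))]
        · generalize ((List.ofFn fun j => gens (c j)).drop (i + 1)).flatten = Y
          simp
        · intro j hj
          rw [Function.update_of_ne (by rintro rfl; omega)]
        · intro j hj
          rw [Function.update_of_ne (by rintro rfl; omega)]
      · simp only [sgnExp, h6, List.cons_append, cntU_cons, cntU_append, isU_gen, inv_append,
          ins_map_false, cntU_nil, mul_zero]
        generalize ((List.ofFn fun j => gens (c j)).drop (i + 1)).flatten = Y
        rw [inv_eq_zero_of_ins (l := List.map (Prod.mk false) Y) (by simp)]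
        ring

end DecTree


/-! ### Sums over dependent products -/

section PiSums

variable {ι R : Type*} [Fintype ι] [DecidableEq ι] [CommRing R] {κ : ι → Type*}
  [∀ i, Fintype (κ i)]

theorem sum_pi_prod_ite (F : (∀ i, κ i) → R) (a : ∀ i, κ i) [∀ i (o : κ i), Decidable (o = a i)] :
    ∑ r : ∀ i, κ i, (∏ j, if r j = a j then (1 : R) else 0) * F r = F a := by
  rw [Finset.sum_eq_single a]
  · simp
  · intro r _ hr
    obtain ⟨j, hj⟩ := Function.ne_iff.1 hr
    rw [Finset.prod_eq_zero (Finset.mem_univ j) (if_neg hj), zero_mul]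
  · simp

theorem sum_pi_prod_erase_ite (F : (∀ i, κ i) → R) (a : ∀ i, κ i) (i : ι)
    [∀ i (o : κ i), Decidable (o = a i)] :
    ∑ r : ∀ i, κ i, (∏ j ∈ Finset.univ.erase i, if r j = a j then (1 : R) else 0) * F r =
      ∑ o : κ i, F (Function.update a i o) := by
  symm
  refine Finset.sum_bij_ne_zero (fun o _ _ => Function.update a i o) (fun _ _ _ => Finset.mem_univ _)
    (fun o _ _ o' _ _ h => by simpa using congrFun h i) (fun r _ hr => ?_) (fun o _ _ => ?_)
  · have h : Function.update a i (r i) = r := by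
      funext j
      rcases eq_or_ne j i with rfl | hj
      · simp
      · rw [Function.update_of_ne hj]
        by_contra hne
        exact hr (by
          rw [Finset.prod_eq_zero (Finset.mem_erase.2 ⟨hj, Finset.mem_univ j⟩)
            (if_neg fun e => hne e.symm), zero_mul])
    refine ⟨r i, Finset.mem_univ _, fun h0 => hr ?_, h⟩
    rw [h] at h0
    rw [h0, mul_zero]
  · rw [Finset.prod_eq_one, one_mul]
    intro j hj
    rw [Function.update_of_ne (Finset.ne_of_mem_erase hj), if_pos rfl]

end PiSums

theorem flatten_map_singleton {α : Type*} (l : List α) : (l.map fun x => [x]).flatten = l := by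
  induction l <;> simp_all

theorem flatten_ofFn_singleton {α : Type*} {n : ℕ} (c : Fin n → α) :
    (List.ofFn fun i => [c i]).flatten = List.ofFn c := by
  rw [← flatten_map_singleton (List.ofFn c), List.map_ofFn]
  rfl

@[to_additive]
theorem prod_drop_ofFn {M : Type*} [CommMonoid M] {n : ℕ} (f : Fin n → M) (m : ℕ) :
    ((List.ofFn f).drop m).prod = ∏ j : Fin n with m ≤ j.val, f j := by
  induction n generalizing m with
  | zero => simp
  | succ n ih =>
    cases m with
    | zero => simp [List.prod_ofFn, Fin.prod_univ_succ]
    | succ m =>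
      rw [List.ofFn_succ, List.drop_succ_cons, ih, Finset.prod_filter, Finset.prod_filter,
        Fin.prod_univ_succ]
      simp

theorem ofFn_update {α : Type*} {n : ℕ} (f : Fin n → α) (i : Fin n) (x : α) :
    List.ofFn (Function.update f i x) =
      (List.ofFn f).take i ++ x :: (List.ofFn f).drop (i + 1) := by
  have h := flatten_ofFn_split (fun j => [Function.update f i x j]) i
  have e : (List.ofFn fun j => [Function.update f i x j]) =
      (List.ofFn (Function.update f i x)).map fun y => [y] := by rw [List.map_ofFn]; rfl
  rw [e, ← List.map_take, ← List.map_drop, flatten_map_singleton, flatten_map_singleton,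
    flatten_map_singleton, Function.update_self, take_ofFn_congr (g := f),
    drop_ofFn_congr (g := f)] at h
  · exact h
  · intro j hj
    rw [Function.update_of_ne (by rintro rfl; omega)]
  · intro j hj
    rw [Function.update_of_ne (by rintro rfl; omega)]

/-! ### The weights of decorated trees -/

namespace DecTree

/-- The list of the branches of the root. -/
def children : DecTree → List DecTree
  | leaf => []
  | node _ _ c => List.ofFn c

/-- Whether the tree has a root, decorated by `b`. -/
def IsRoot (b : Bool) : DecTree → Prop
  | leaf => False
  | node b' _ _ => b' = b

instance (b : Bool) : DecidablePred (IsRoot b)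
  | leaf => isFalse id
  | node b' _ _ => inferInstanceAs (Decidable (b' = b))

section

variable {R : Type*} [CommRing R]

variable (R) in
/-- The indicator function of the tree without vertices. -/
def lf : DecTree → R
  | leaf => 1
  | node _ _ _ => 0

variable (R) in
/-- The indicator function of the corollas decorated by `b`. -/
def cor (b : Bool) : DecTree → R
  | leaf => 0
  | node b' _ c => if b' = b then ∏ i, lf R (c i) else 0

/-- The value at `(x₁, …, xₙ)` of the derivation-like extension of `γ`: the sum over `i` of
`γ(xᵢ)`, if all the other trees are leaves. -/
def der (γ : DecTree → R) : List DecTree → R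
  | [] => 0
  | x :: l => γ x * (l.map (lf R)).prod + lf R x * der γ l

/-- `(∏ (vᵢ + λ ℓᵢ) - ∏ vᵢ) / λ` for a list of pairs `(ℓᵢ, vᵢ)`, in a form that is free of
divisions. -/
def quo (lam : R) : List (R × R) → R
  | [] => 0
  | x :: l => x.1 * (l.map fun y => y.2 + lam * y.1).prod + x.2 * quo lam l

variable (R) in
/-- The pair of indicator functions of the leaf and of the corollas decorated by `v`. -/
def lv (E : DecTree) : R × R := (lf R E, cor R false E)

/-- The weight of a tree with a root `u_p`, each input of which carries nothing or a corolla
decorated by `v`: it is `lam ^ (f - 1)` if the number `f` of free inputs is positive, and zero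
otherwise. All other trees have weight zero. -/
def gw (lam : R) : DecTree → R
  | leaf => 0
  | node b _ c => if b then quo lam ((List.ofFn c).map (lv R)) else 0

/-- The coefficient of a decorated tree in `∑_T Δ_T(u_n)`, up to the sign of desuspension. -/
def wtU : DecTree → R
  | leaf => 0
  | node b _ c => if b then der (cor R true) (List.ofFn c) else 0

/-- The coefficient of a decorated tree in `∑_T Δ_T(v_n)`, up to the sign of desuspension. -/
def wtV (lam : R) : DecTree → R
  | leaf => 0
  | node b _ c => if b then ∏ i, cor R false (c i) else - der (gw lam) (List.ofFn c)

/-- The weight `wtU` or `wtV`. -/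
def wt (lam : R) (b : Bool) (E : DecTree) : R := if b then wtU E else wtV lam E

@[simp] theorem lf_leaf : lf R leaf = 1 := rfl
@[simp] theorem lf_node (b : Bool) (n : ℕ+) (c : Fin n → DecTree) : lf R (node b n c) = 0 := rfl
@[simp] theorem cor_leaf (b : Bool) : cor R b leaf = 0 := rfl
theorem cor_node (b b' : Bool) (n : ℕ+) (c : Fin n → DecTree) :
    cor R b (node b' n c) = if b' = b then ∏ i, lf R (c i) else 0 := rfl
@[simp] theorem gw_leaf (lam : R) : gw lam leaf = 0 := rfl
@[simp] theorem gw_node_false (lam : R) (n : ℕ+) (c : Fin n → DecTree) :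
    gw lam (node false n c) = 0 := rfl
theorem gw_node_true (lam : R) (n : ℕ+) (c : Fin n → DecTree) :
    gw lam (node true n c) = quo lam ((List.ofFn c).map (lv R)) := rfl
@[simp] theorem wtU_node_false (n : ℕ+) (c : Fin n → DecTree) :
    wtU (R := R) (node false n c) = 0 := rfl
theorem wtU_node_true (n : ℕ+) (c : Fin n → DecTree) :
    wtU (R := R) (node true n c) = der (cor R true) (List.ofFn c) := rfl
theorem wtV_node_true (lam : R) (n : ℕ+) (c : Fin n → DecTree) :
    wtV lam (node true n c) = ∏ i, cor R false (c i) := rfl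
theorem wtV_node_false (lam : R) (n : ℕ+) (c : Fin n → DecTree) :
    wtV lam (node false n c) = - der (gw lam) (List.ofFn c) := rfl

theorem eq_leaf_of_lf_ne_zero {E : DecTree} (h : lf R E ≠ 0) : E = leaf := by
  cases E with
  | leaf => rfl
  | node b n c => exact absurd rfl h

theorem eq_of_cor_ne_zero {b : Bool} {E : DecTree} (h : cor R b E ≠ 0) :
    ∃ n : ℕ+, E = node b n fun _ => leaf := by
  cases E with
  | leaf => exact absurd rfl h
  | node b' n c =>
    rw [cor_node] at h
    split_ifs at h with hb
    · subst hb
      refine ⟨n, ?_⟩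
      congr 1
      funext i
      exact eq_leaf_of_lf_ne_zero fun h0 => h (Finset.prod_eq_zero (Finset.mem_univ i) h0)
    · exact absurd rfl h

@[simp] theorem cor_corolla (b b' : Bool) (n : ℕ+) :
    cor R b (node b' n fun _ => leaf) = if b' = b then 1 else 0 := by
  simp [cor_node]

/-- The number of vertices of a tree decorated by `u`. -/
def numU (E : DecTree) : ℕ := cntU E.gens

@[simp] theorem numU_leaf : numU leaf = 0 := rfl

theorem numU_node (b : Bool) (n : ℕ+) (c : Fin n → DecTree) :
    numU (node b n c) = (if b then 1 else 0) + ∑ i, numU (c i) := by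
  simp only [numU, gens, cntU_cons, isU_gen, cntU_flatten, List.map_ofFn, List.sum_ofFn]
  rfl

theorem numU_eq_zero_of_lf {E : DecTree} (h : lf R E ≠ 0) : numU E = 0 := by
  rw [eq_leaf_of_lf_ne_zero h, numU_leaf]

theorem numU_eq_zero_of_cor {E : DecTree} (h : cor R false E ≠ 0) : numU E = 0 := by
  obtain ⟨n, rfl⟩ := eq_of_cor_ne_zero h
  simp [numU_node]

/-! ### Extending weights to lists of branches -/

theorem der_append (γ : DecTree → R) (l l' : List DecTree) :
    der γ (l ++ l') = der γ l * (l'.map (lf R)).prod + (l.map (lf R)).prod * der γ l' := by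
  induction l with
  | nil => simp [der]
  | cons x l ih =>
    simp only [List.cons_append, der, ih, List.map_append, List.prod_append, List.map_cons,
      List.prod_cons]
    ring

theorem der_singleton (γ : DecTree → R) (x : DecTree) : der γ [x] = γ x := by
  simp [der]

theorem prod_ofFn_erase {n : ℕ} (f : Fin n → R) (i : Fin n) :
    ∏ j ∈ Finset.univ.erase i, f j =
      ((List.ofFn f).take i).prod * ((List.ofFn f).drop (i + 1)).prod := by
  have h1 : Finset.univ.erase i =
      (Finset.univ.filter fun j : Fin n => j.val < i) ∪
        (Finset.univ.filter fun j : Fin n => i.val + 1 ≤ j.val) := by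
    ext j
    simp only [Finset.mem_erase, Finset.mem_univ, and_true, Finset.mem_union, Finset.mem_filter,
      true_and, ne_eq, Fin.ext_iff]
    omega
  rw [h1, Finset.prod_union, List.prod_take_ofFn, prod_drop_ofFn]
  rw [Finset.disjoint_filter]
  intro j _ h
  omega

theorem der_flatten_ofFn (γ : DecTree → R) {n : ℕ} (f : Fin n → List DecTree) :
    der γ (List.ofFn f).flatten =
      ∑ i, der γ (f i) * ∏ j ∈ Finset.univ.erase i, ((f j).map (lf R)).prod := by
  induction n with
  | zero => simp [der]
  | succ n ih =>
    rw [List.ofFn_succ, List.flatten_cons, der_append, ih, Fin.sum_univ_succ]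
    congr 1
    · congr 1
      rw [List.map_flatten, List.prod_flatten, List.map_map, List.map_ofFn, List.prod_ofFn,
        Fin.univ_succ, Finset.erase_cons, Finset.prod_map]
      rfl
    · rw [Finset.mul_sum]
      refine Finset.sum_congr rfl fun i _ => ?_
      have : (Finset.univ : Finset (Fin (n + 1))).erase i.succ =
          Finset.cons 0 ((Finset.univ.erase i).map ⟨Fin.succ, Fin.succ_injective n⟩)
            (by simp [Fin.succ_ne_zero]) := by
        ext j
        refine Fin.cases ?_ (fun j => ?_) j
        · simp [(Fin.succ_ne_zero i).symm]
        · simp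
      rw [this, Finset.prod_cons, Finset.prod_map]
      simp only [Function.Embedding.coeFn_mk]
      ring

theorem der_ofFn (γ : DecTree → R) {n : ℕ} (c : Fin n → DecTree) :
    der γ (List.ofFn c) = ∑ i, γ (c i) * ∏ j ∈ Finset.univ.erase i, lf R (c j) := by
  rw [← flatten_ofFn_singleton c, der_flatten_ofFn]
  simp [der_singleton]

/-- If a nonempty tree is inserted in one branch, it has to carry the distinguished factor. -/
theorem der_ofFn_update (γ : DecTree → R) {n : ℕ} (c : Fin n → DecTree) (i : Fin n) {q : DecTree}
    (hq : lf R q = 0) :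
    der γ (List.ofFn (Function.update c i q)) =
      γ q * ∏ j ∈ Finset.univ.erase i, lf R (c j) := by
  rw [der_ofFn, Finset.sum_eq_single i]
  · rw [Function.update_self]
    congr 1
    refine Finset.prod_congr rfl fun j hj => ?_
    rw [Function.update_of_ne (Finset.ne_of_mem_erase hj)]
  · intro m _ hm
    rw [Finset.prod_eq_zero (Finset.mem_erase.2 ⟨hm.symm, Finset.mem_univ i⟩), mul_zero]
    rw [Function.update_self, hq]
  · simp

theorem quo_mul (lam : R) (l : List (R × R)) :
    lam * quo lam l = (l.map fun y => y.2 + lam * y.1).prod - (l.map Prod.snd).prod := by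
  induction l with
  | nil => simp [quo]
  | cons x l ih =>
    simp only [quo, List.map_cons, List.prod_cons]
    linear_combination x.2 * ih

theorem quo_append (lam : R) (l l' : List (R × R)) :
    quo lam (l ++ l') = quo lam l * (l'.map fun y => y.2 + lam * y.1).prod +
      (l.map Prod.snd).prod * quo lam l' := by
  induction l with
  | nil => simp [quo]
  | cons x l ih =>
    simp only [List.cons_append, quo, ih, List.map_append, List.prod_append, List.map_cons,
      List.prod_cons]
    ring

/-- `quo` is affine in each entry. -/
theorem quo_append_cons (lam : R) (l l' : List (R × R)) (x : R × R) :
    quo lam (l ++ x :: l') =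
      x.1 * quo lam (l ++ (1, 0) :: l') + x.2 * quo lam (l ++ (0, 1) :: l') := by
  simp only [quo_append, quo, List.map_cons, List.prod_cons]
  ring

/-- Substitution of a list for one entry of `quo`. -/
theorem quo_insert (lam : R) (l m l' : List (R × R)) :
    quo lam (l ++ (m ++ l')) =
      quo lam (l ++ (1, 0) :: l') * quo lam m +
        quo lam (l ++ (0, 1) :: l') * (m.map Prod.snd).prod := by
  simp only [quo_append, quo, List.map_cons, List.prod_cons, List.map_append, List.prod_append]
  linear_combination
    -quo lam l * (l'.map fun y => y.2 + lam * y.1).prod * quo_mul lam m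

theorem ne_zero_of_quo_ne_zero {lam : R} {l : List (R × R)} (h : quo lam l ≠ 0) :
    ∀ x ∈ l, x.1 ≠ 0 ∨ x.2 ≠ 0 := by
  intro x hx
  by_contra! hx0
  obtain ⟨l1, l2, rfl⟩ := List.append_of_mem hx
  rw [quo_append_cons, hx0.1, hx0.2] at h
  simp at h

theorem numU_eq_zero_of_quo {lam : R} {l : List DecTree} (h : quo lam (l.map (lv R)) ≠ 0) :
    ∀ E ∈ l, numU E = 0 := by
  intro E hE
  rcases ne_zero_of_quo_ne_zero h _ (List.mem_map_of_mem hE) with h1 | h1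
  · exact numU_eq_zero_of_lf h1
  · exact numU_eq_zero_of_cor h1

end

/-! ### The full subtree and the smallest subtree -/

/-- The largest possibly empty subtree containing the root. -/
def full : (E : DecTree) → Option (RootSub E.shape)
  | leaf => none
  | node b n c => some (mkSub (b := b) (n := n) (c := c) fun i => full (c i))

theorem otree_full (E : DecTree) : otree E (full E) = E := by
  induction E with
  | leaf => rfl
  | node b n c ih =>
    simp only [full, otree]
    rw [rtree_node]
    congr 1
    funext i
    exact ih i

section

variable {R : Type*} [CommRing R]

open scoped Classical in
theorem prod_lf_obranches (E : DecTree) (o : Option (RootSub E.shape)) :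
    ((obranches E o).map (lf R)).prod = if o = full E then 1 else 0 := by
  induction E with
  | leaf =>
    rcases o with _ | s
    · simp [obranches, full]
    · exact Empty.elim s
  | node b n c ih =>
    rcases o with _ | r
    · simp [obranches, full]
    · obtain ⟨r, rfl⟩ : ∃ r' : ∀ i, Option (RootSub (c i).shape), mkSub r' = r := ⟨r, rfl⟩
      rw [show obranches (node b n c) (some (mkSub r)) = rbranches (node b n c) (mkSub r) from rfl,
        rbranches_node]
      rw [List.map_flatten, List.prod_flatten, List.map_map, List.map_ofFn, List.prod_ofFn]
      simp only [Function.comp, ih]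
      by_cases h : ∀ i, r i = full (c i)
      · obtain rfl : r = fun i => full (c i) := funext h
        rw [Finset.prod_eq_one fun i _ => if_pos rfl]
        exact (if_pos rfl).symm
      · refine Eq.trans ?_ (if_neg fun e => h (congrFun (Option.some.inj e))).symm
        obtain ⟨i, hi⟩ := not_forall.1 h
        exact Finset.prod_eq_zero (Finset.mem_univ i) (if_neg hi)

open scoped Classical in
theorem lf_otree (E : DecTree) (o : Option (RootSub E.shape)) :
    lf R (otree E o) = if o = none then 1 else 0 := by
  rcases o with _ | r
  · simp [otree]
  · cases E with
    | leaf => exact Empty.elim r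
    | node b n c => rfl

theorem sum_rootSub (b : Bool) (n : ℕ+) (c : Fin n → DecTree)
    (F : RootSub (node b n c).shape → R) :
    ∑ r : RootSub (node b n c).shape, F r =
      ∑ r : ∀ i : Fin n, Option (RootSub (c i).shape), F (mkSub r) := rfl

/-- The subtree consisting of the root alone. -/
theorem sum_cor_otree (b : Bool) (E : DecTree) (Φ : List DecTree → R) :
    ∑ o, cor R b (otree E o) * Φ (obranches E o) = if IsRoot b E then Φ (children E) else 0 := by
  classical
  rw [Fintype.sum_option]
  simp only [otree, cor_leaf, zero_mul, zero_add, obranches]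
  cases E with
  | leaf =>
    rw [if_neg (show ¬ IsRoot b leaf from id)]
    exact Finset.sum_eq_zero fun r _ => Empty.elim r
  | node b' n c =>
    rw [sum_rootSub]
    simp only [rtree_node, cor_node, rbranches_node]
    by_cases hb : b' = b
    · rw [if_pos (show IsRoot b (node b' n c) from hb)]
      simp only [if_pos hb, lf_otree]
      rw [sum_pi_prod_ite _ (fun i => (none : Option (RootSub (c i).shape)))]
      simp only [obranches, flatten_ofFn_singleton, children]
    · rw [if_neg (show ¬ IsRoot b (node b' n c) from hb)]
      simp [if_neg hb]

/-- Distributing the distinguished branch over the inputs of the root: above all other inputs the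
subtree has to be full. -/
theorem sum_der_rbranches (γ : DecTree → R) (b : Bool) (n : ℕ+) (c : Fin n → DecTree)
    (F : (∀ i : Fin n, Option (RootSub (c i).shape)) → R) :
    ∑ r : ∀ i : Fin n, Option (RootSub (c i).shape), der γ (rbranches (node b n c) (mkSub r)) * F r =
      ∑ i, ∑ o, der γ (obranches (c i) o) * F (Function.update (fun j => full (c j)) i o) := by
  classical
  simp only [rbranches_node, der_flatten_ofFn, Finset.sum_mul]
  rw [Finset.sum_comm]
  refine Finset.sum_congr rfl fun i _ => ?_
  simp only [prod_lf_obranches]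
  rw [← (sum_pi_prod_erase_ite (fun r => der γ (obranches (c i) (r i)) * F r)
    (fun j => full (c j)) i).trans (Finset.sum_congr rfl fun o _ => by rw [Function.update_self])]
  exact Finset.sum_congr rfl fun r _ => by ring

theorem otree_update_full {n : ℕ} (c : Fin n → DecTree) (i : Fin n)
    (o : Option (RootSub (c i).shape)) :
    (fun j => otree (c j) (Function.update (fun j => full (c j)) i o j)) =
      Function.update c i (otree (c i) o) := by
  funext j
  rcases eq_or_ne j i with rfl | hj
  · simp
  · simp [Function.update_of_ne hj, otree_full]

/-- Subtrees with two vertices, both decorated by `u`: the branches of the upper vertex are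
inserted between those of the root. -/
theorem sum_wtU_rtree (n : ℕ+) (c : Fin n → DecTree) (Φ : List DecTree → R) :
    ∑ r : ∀ i : Fin n, Option (RootSub (c i).shape),
        wtU (rtree (node true n c) (mkSub r)) * Φ (rbranches (node true n c) (mkSub r)) =
      ∑ i, if IsRoot true (c i) then
        Φ (((List.ofFn c).take i) ++ (children (c i) ++ (List.ofFn c).drop (i + 1))) else 0 := by
  classical
  simp only [rtree_node, rbranches_node, wtU_node_true, der_ofFn, Finset.sum_mul]
  rw [Finset.sum_comm]
  refine Finset.sum_congr rfl fun i _ => ?_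
  have hfl : ∀ o : Option (RootSub (c i).shape),
      (List.ofFn fun j => obranches (c j) (Function.update
        (fun j => (none : Option (RootSub (c j).shape))) i o j)).flatten =
      ((List.ofFn c).take i) ++ (obranches (c i) o ++ (List.ofFn c).drop (i + 1)) := by
    intro o
    have e1 := flatten_ofFn_split (fun j => obranches (c j) (Function.update
        (fun j => (none : Option (RootSub (c j).shape))) i o j)) i
    rw [e1, Function.update_self, take_ofFn_congr (g := fun j => [c j]),
      drop_ofFn_congr (g := fun j => [c j])]
    · have h1 : (List.ofFn fun j => [c j]) = (List.ofFn c).map fun x => [x] := by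
        rw [List.map_ofFn]; rfl
      rw [h1, ← List.map_take, ← List.map_drop, flatten_map_singleton,
        flatten_map_singleton]
    · intro j hj
      rw [Function.update_of_ne (by rintro rfl; omega)]
      rfl
    · intro j hj
      rw [Function.update_of_ne (by rintro rfl; omega)]
      rfl
  rw [← sum_cor_otree true (c i) fun l =>
    Φ (((List.ofFn c).take i) ++ (l ++ (List.ofFn c).drop (i + 1)))]
  simp only [lf_otree]
  refine ((Finset.sum_congr rfl fun r _ => ?_).trans (sum_pi_prod_erase_ite (fun r =>
    cor R true (otree (c i) (r i)) * Φ (List.ofFn fun j => obranches (c j) (r j)).flatten)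
    (fun j => none) i)).trans (Finset.sum_congr rfl fun o _ => ?_)
  · ring
  · simp only [Function.update_self, hfl]

end

end DecTree


namespace DecTree

/-! ### The quadratic identity -/

section

variable {R : Type*} [CommRing R]

/-- A weight that is supported on trees whose root is their only vertex decorated by `u`. -/
def UnaryRoot (γ : DecTree → R) : Prop := ∀ E, γ E ≠ 0 → IsRoot true E ∧ numU E = 1

theorem UnaryRoot.leaf {γ : DecTree → R} (h : UnaryRoot γ) : γ leaf = 0 := by
  by_contra h0
  exact (h _ h0).1

theorem unaryRoot_cor : UnaryRoot (cor R true) := by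
  intro E hE
  obtain ⟨n, rfl⟩ := eq_of_cor_ne_zero hE
  exact ⟨rfl, by simp [numU_node]⟩

theorem unaryRoot_gw (lam : R) : UnaryRoot (gw lam) := by
  intro E hE
  rcases E with _ | ⟨_ | _, n, c⟩
  · exact absurd rfl hE
  · exact absurd rfl hE
  · refine ⟨rfl, ?_⟩
    rw [numU_node, Finset.sum_eq_zero]
    · rfl
    · intro i _
      exact numU_eq_zero_of_quo hE _ (List.mem_ofFn.2 ⟨i, rfl⟩)

theorem cntU_gens_flatten_eq_zero {l : List DecTree} (h : ∀ E ∈ l, numU E = 0) :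
    cntU (l.map gens).flatten = 0 := by
  rw [cntU_flatten, List.sum_eq_zero]
  simp only [List.mem_map]
  rintro _ ⟨_, ⟨E, hE, rfl⟩, rfl⟩
  exact h E hE

theorem cntU_flatten_take {n : ℕ} (c : Fin n → DecTree) (i : Fin n)
    (h : ∀ j ≠ i, numU (c j) = 0) :
    cntU (((List.ofFn fun j => gens (c j)).take i).flatten) = 0 := by
  have e : (List.ofFn fun j => gens (c j)) = (List.ofFn c).map gens := by
    rw [List.map_ofFn]; rfl
  rw [e, ← List.map_take]
  refine cntU_gens_flatten_eq_zero fun E hE => ?_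
  obtain ⟨m, hm, rfl⟩ := List.mem_take_iff_getElem.1 hE
  rw [lt_min_iff, List.length_ofFn] at hm
  rw [List.getElem_ofFn]
  exact h _ fun e => by
    have := congrArg Fin.val e
    simp only at this
    omega

/-- No sign arises if no branch above the subtree contains a `u`. -/
theorem inv_rmarks_of_rbranches {E : DecTree} {r : RootSub E.shape}
    (h : ∀ x ∈ rbranches E r, numU x = 0) : inv (rmarks E r) = 0 := by
  apply inv_eq_zero_of_outs
  rw [outs_rmarks]
  exact cntU_gens_flatten_eq_zero h

/-- No sign arises if no vertex of the subtree except possibly the root is a `u`. -/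
theorem inv_rmarks_of_rtree {b : Bool} {n : ℕ+} {c : Fin n → DecTree}
    (r : ∀ i : Fin n, Option (RootSub (c i).shape)) (h : ∀ i, numU (otree (c i) (r i)) = 0) :
    inv (rmarks (node b n c) (mkSub r)) = 0 := by
  have h1 := ins_rmarks (node b n c) (mkSub r)
  rw [rtree_node, gens, rmarks_node, ins_cons_true, List.cons.injEq] at h1
  rw [rmarks_node, inv_cons_true]
  apply inv_eq_zero_of_ins
  rw [h1.2, cntU_flatten, List.map_ofFn, List.sum_ofFn]
  exact Finset.sum_eq_zero fun i _ => h i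

theorem outs_omarks_full (E : DecTree) : outs (omarks E (full E)) = [] := by
  induction E with
  | leaf => rfl
  | node b n c ih =>
    rw [show omarks (node b n c) (full (node b n c)) =
      rmarks (node b n c) (mkSub fun i => full (c i)) from rfl, rmarks_node, outs_cons_true,
      outs_flatten, List.map_ofFn, List.flatten_eq_nil_iff]
    intro l hl
    obtain ⟨i, rfl⟩ := List.mem_ofFn.1 hl
    exact ih i

theorem ins_omarks_full (E : DecTree) : ins (omarks E (full E)) = gens E := by
  cases E with
  | leaf => rfl
  | node b n c =>
    exact (ins_rmarks _ _).trans (congrArg gens (otree_full (node b n c)))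

theorem cor_ofBranches (b b' : Bool) {l : List DecTree} (hl : l ≠ []) :
    cor R b (ofBranches b' l) = if b' = b then (l.map (lf R)).prod else 0 := by
  obtain ⟨m, hm⟩ : ∃ m : ℕ+, l.length = m := ⟨⟨l.length, List.length_pos_iff.2 hl⟩, rfl⟩
  rw [ofBranches_eq b' hm, cor_node]
  congr 1
  rw [← List.prod_ofFn]
  congr 1
  exact List.ext_getElem (by simp [hm]) fun i h1 h2 => by simp

theorem ofFn_getElem_eq {α : Type*} {l : List α} {m : ℕ} (h : l.length = m) :
    (List.ofFn fun i : Fin m => l[i.val]'(by rw [h]; exact i.2)) = l :=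
  List.ext_getElem (by simp [h]) fun i h1 h2 => by simp

theorem rbranches_ne_nil (E : DecTree) (r : RootSub E.shape) : rbranches E r ≠ [] := by
  intro h
  apply RootSub.branches_ne_nil E.shape r
  rw [← map_shape_rbranches, h]
  rfl

theorem wtV_ofBranches_true (lam : R) {l : List DecTree} (hl : l ≠ []) :
    wtV lam (ofBranches true l) = (l.map (cor R false)).prod := by
  obtain ⟨m, hm⟩ : ∃ m : ℕ+, l.length = m := ⟨⟨l.length, List.length_pos_iff.2 hl⟩, rfl⟩
  rw [ofBranches_eq true hm, wtV_node_true, ← List.prod_ofFn]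
  congr 1
  exact List.ext_getElem (by simp [hm]) fun i h1 h2 => by simp

theorem wtV_ofBranches_false (lam : R) {l : List DecTree} (hl : l ≠ []) :
    wtV lam (ofBranches false l) = - der (gw lam) l := by
  obtain ⟨m, hm⟩ : ∃ m : ℕ+, l.length = m := ⟨⟨l.length, List.length_pos_iff.2 hl⟩, rfl⟩
  rw [ofBranches_eq false hm, wtV_node_false, ofFn_getElem_eq hm]

theorem wtU_ofBranches_true {l : List DecTree} (hl : l ≠ []) :
    wtU (ofBranches true l) = der (cor R true) l := by
  obtain ⟨m, hm⟩ : ∃ m : ℕ+, l.length = m := ⟨⟨l.length, List.length_pos_iff.2 hl⟩, rfl⟩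
  rw [ofBranches_eq true hm, wtU_node_true, ofFn_getElem_eq hm]

theorem wtU_ofBranches_false {l : List DecTree} (hl : l ≠ []) :
    wtU (R := R) (ofBranches false l) = 0 := by
  obtain ⟨m, hm⟩ : ∃ m : ℕ+, l.length = m := ⟨⟨l.length, List.length_pos_iff.2 hl⟩, rfl⟩
  rw [ofBranches_eq false hm, wtU_node_false]

theorem gw_ofBranches_true (lam : R) {l : List DecTree} (hl : l ≠ []) :
    gw lam (ofBranches true l) = quo lam (l.map (lv R)) := by
  obtain ⟨m, hm⟩ : ∃ m : ℕ+, l.length = m := ⟨⟨l.length, List.length_pos_iff.2 hl⟩, rfl⟩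
  rw [ofBranches_eq true hm, gw_node_true, ofFn_getElem_eq hm]

theorem gw_ofBranches_false (lam : R) {l : List DecTree} (hl : l ≠ []) :
    gw lam (ofBranches false l) = 0 := by
  obtain ⟨m, hm⟩ : ∃ m : ℕ+, l.length = m := ⟨⟨l.length, List.length_pos_iff.2 hl⟩, rfl⟩
  rw [ofBranches_eq false hm, gw_node_false]

theorem lf_squot (b : Bool) (E : DecTree) (s : Sub E.shape) : lf R (squot b E s) = 0 := by
  cases E with
  | leaf => exact Empty.elim s
  | node b' n c =>
    rcases s with r | ⟨i, s⟩
    · have hl := rbranches_ne_nil (node b' n c) r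
      obtain ⟨m, hm⟩ : ∃ m : ℕ+, (rbranches (node b' n c) r).length = m :=
        ⟨⟨_, List.length_pos_iff.2 hl⟩, rfl⟩
      change lf R (ofBranches b (rbranches (node b' n c) r)) = 0
      rw [ofBranches_eq b hm]
      rfl
    · rfl

/-- A subtree containing the root, as a subtree. -/
def inlSub {b : Bool} {n : ℕ+} {c : Fin n → DecTree}
    (r : ∀ i : Fin n, Option (RootSub (c i).shape)) : Sub (node b n c).shape :=
  Sum.inl (mkSub (b := b) r)

/-- A subtree of a branch of the root, as a subtree. -/
def inrSub {b : Bool} {n : ℕ+} {c : Fin n → DecTree} (i : Fin n) (s : Sub (c i).shape) :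
    Sub (node b n c).shape := Sum.inr ⟨i, s⟩

section unfold

variable (b : Bool) (n : ℕ+) (c : Fin n → DecTree) (r : ∀ i : Fin n, Option (RootSub (c i).shape))
  (i : Fin n) (s : Sub (c i).shape)

theorem stree_inlSub : stree (node b n c) (inlSub r) = rtree (node b n c) (mkSub r) := rfl

theorem squot_inlSub (b' : Bool) : squot b' (node b n c) (inlSub r) =
    ofBranches b' (rbranches (node b n c) (mkSub r)) := rfl

theorem sgnExp_inlSub : sgnExp (node b n c) (inlSub r) = inv (rmarks (node b n c) (mkSub r)) := rfl

theorem stree_inrSub : stree (node b n c) (inrSub i s) = stree (c i) s := rfl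

theorem squot_inrSub (b' : Bool) : squot b' (node b n c) (inrSub i s) =
    node b n (Function.update c i (squot b' (c i) s)) := rfl

theorem sgnExp_inrSub : sgnExp (node b n c) (inrSub i s) = (if b then 1 else 0) +
    cntU (((List.ofFn fun j => gens (c j)).take i).flatten) + sgnExp (c i) s := rfl

theorem sum_sub (F : Sub (node b n c).shape → R) :
    ∑ s, F s = (∑ r : ∀ i : Fin n, Option (RootSub (c i).shape), F (inlSub r)) +
      ∑ i, ∑ s : Sub (c i).shape, F (inrSub i s) :=
  (Fintype.sum_sum_type (α₁ := RootSub (node b n c).shape) (α₂ := Σ i : Fin n, Sub (c i).shape)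
    F).trans (congrArg₂ (· + ·) rfl (Fintype.sum_sigma _))

end unfold

/-- A quotient is a corolla only if the whole tree is contracted. -/
theorem sum_cor_squot (b b' : Bool) (E : DecTree) (Φ : DecTree → R) (hΦ : Φ leaf = 0) :
    ∑ s : Sub E.shape, (-1) ^ sgnExp E s * (cor R b (squot b' E s) * Φ (stree E s)) =
      if b' = b then Φ E else 0 := by
  classical
  cases E with
  | leaf =>
    rw [hΦ, ite_self]
    exact Finset.sum_eq_zero fun s _ => Empty.elim s
  | node b0 n c =>
    rw [sum_sub]
    rw [Finset.sum_eq_zero (s := (Finset.univ : Finset (Fin n))), add_zero]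
    · have h : ∀ r : ∀ i : Fin n, Option (RootSub (c i).shape),
          (-1 : R) ^ sgnExp (node b0 n c) (inlSub r) *
            (cor R b (squot b' (node b0 n c) (inlSub r)) *
              Φ (stree (node b0 n c) (inlSub r))) =
          if b' = b then (if r = fun i => full (c i) then Φ (node b0 n c) else 0) else 0 := by
        intro r
        rw [sgnExp_inlSub, squot_inlSub, stree_inlSub, cor_ofBranches _ _ (rbranches_ne_nil _ _)]
        split_ifs with hb hr
        · subst hr
          have h1 := prod_lf_obranches (R := R) (node b0 n c) (full (node b0 n c))
          rw [if_pos rfl] at h1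
          have h2 := otree_full (node b0 n c)
          change ((rbranches (node b0 n c) (mkSub fun i => full (c i))).map (lf R)).prod = 1 at h1
          change rtree (node b0 n c) (mkSub fun i => full (c i)) = _ at h2
          rw [h1, h2, inv_eq_zero_of_outs (l := rmarks _ _)
            (congrArg cntU (outs_omarks_full (node b0 n c)))]
          simp
        · have h1 := prod_lf_obranches (R := R) (node b0 n c) (some (mkSub r))
          rw [if_neg] at h1
          · change ((rbranches (node b0 n c) (mkSub r)).map (lf R)).prod = 0 at h1
            rw [h1]
            simp
          · exact fun e => hr (Option.some.inj e)
        · simp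
      rw [Finset.sum_congr rfl fun r _ => h r]
      split_ifs
      · simp
      · simp
    · intro i _
      refine Finset.sum_eq_zero fun s _ => ?_
      rw [squot_inrSub, cor_node, Finset.prod_eq_zero (Finset.mem_univ i), ite_self, zero_mul, mul_zero]
      rw [Function.update_self, lf_squot]

end

end DecTree


namespace DecTree

section

variable {R : Type*} [CommRing R]

theorem cntU_drop_flatten {n : ℕ} (c : Fin n → DecTree) (m : ℕ) :
    cntU (((List.ofFn fun j => gens (c j)).drop m).flatten) =
      ∑ j : Fin n with m ≤ j.val, numU (c j) := by
  rw [cntU_flatten, List.map_drop, List.map_ofFn, sum_drop_ofFn]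
  rfl

/-- The sign for a subtree that is full except that it avoids one branch of the root. -/
theorem inv_rmarks_avoid (b : Bool) (n : ℕ+) (c : Fin n → DecTree) (i : Fin n) :
    inv (rmarks (node b n c) (mkSub (Function.update (fun j => full (c j)) i none))) =
      numU (c i) * ∑ j : Fin n with i < j, numU (c j) := by
  rw [rmarks_node, inv_cons_true, flatten_ofFn_split _ i,
    take_ofFn_congr (g := fun j => omarks (c j) (full (c j))),
    drop_ofFn_congr (g := fun j => omarks (c j) (full (c j))), Function.update_self]
  · have h1 : outs ((List.ofFn fun j => omarks (c j) (full (c j))).take i).flatten = [] := by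
      rw [outs_flatten, List.map_take, List.map_ofFn, List.flatten_eq_nil_iff]
      intro l hl
      obtain ⟨j, rfl⟩ := List.mem_ofFn.1 (List.mem_of_mem_take hl)
      exact outs_omarks_full _
    have h2 : outs ((List.ofFn fun j => omarks (c j) (full (c j))).drop (i + 1)).flatten = [] := by
      rw [outs_flatten, List.map_drop, List.map_ofFn, List.flatten_eq_nil_iff]
      intro l hl
      obtain ⟨j, rfl⟩ := List.mem_ofFn.1 (List.mem_of_mem_drop hl)
      exact outs_omarks_full _
    have h3 : ins ((List.ofFn fun j => omarks (c j) (full (c j))).drop (i + 1)).flatten =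
        ((List.ofFn fun j => gens (c j)).drop (i + 1)).flatten := by
      rw [ins_flatten, List.map_drop, List.map_ofFn]
      congr 3
      funext j
      exact ins_omarks_full _
    rw [inv_append, inv_append, h1, h3, cntU_drop_flatten,
      inv_eq_zero_of_outs (congrArg cntU h1), inv_eq_zero_of_outs (congrArg cntU h2)]
    simp only [omarks, outs_map_false]
    rw [inv_eq_zero_of_ins (l := List.map _ _) (by rw [ins_map_false]; rfl)]
    simp only [cntU_nil, zero_mul, zero_add, add_zero]
    rfl
  · intro j hj
    rw [Function.update_of_ne (by rintro rfl; omega)]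
  · intro j hj
    rw [Function.update_of_ne (by rintro rfl; omega)]

/-- No sign arises if the root is the only vertex of the subtree that is a `u`. -/
theorem inv_rmarks_of_unary {E : DecTree} {r : RootSub E.shape} (h : IsRoot true (rtree E r))
    (h' : numU (rtree E r) = 1) : inv (rmarks E r) = 0 := by
  cases E with
  | leaf => exact Empty.elim r
  | node b m d =>
    obtain rfl : b = true := h
    refine inv_rmarks_of_rtree r fun j => ?_
    have h7 := rtree_node true m d r
    change rtree (node true m d) r = _ at h7
    rw [h7, numU_node] at h'
    simp only [if_true, Nat.add_eq_left, Finset.sum_eq_zero_iff, Finset.mem_univ,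
      true_imp_iff] at h'
    exact h' j

/-- Two distinguished branches of the root contribute opposite signs, according to which of them
belongs to the subtree; so only the configurations inside one branch survive. -/
theorem sum_der_der {γ : DecTree → R} (hγ : UnaryRoot γ) (b : Bool) (n : ℕ+)
    (c : Fin n → DecTree) :
    ∑ r : ∀ i : Fin n, Option (RootSub (c i).shape),
      (-1) ^ inv (rmarks (node b n c) (mkSub r)) *
        (der γ (rbranches (node b n c) (mkSub r)) *
          der γ (List.ofFn fun i => otree (c i) (r i))) =
      ∑ i, (∏ j ∈ Finset.univ.erase i, lf R (c j)) *
        ∑ o, γ (otree (c i) o) * der γ (obranches (c i) o) := by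
  have step := sum_der_rbranches γ b n c fun r =>
    (-1) ^ inv (rmarks (node b n c) (mkSub r)) * der γ (List.ofFn fun i => otree (c i) (r i))
  rw [Finset.sum_congr rfl fun r _ => mul_left_comm _ _ _, step]
  simp only [otree_update_full]
  have hsplit : ∀ i : Fin n, ∑ o, der γ (obranches (c i) o) *
      ((-1) ^ inv (rmarks (node b n c) (mkSub (Function.update (fun j => full (c j)) i o))) *
        der γ (List.ofFn (Function.update c i (otree (c i) o)))) =
      (∑ m, γ (c i) * ((-1) ^ (numU (c i) * ∑ j : Fin n with i < j, numU (c j)) *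
        (γ (Function.update c i leaf m) *
          ∏ j ∈ Finset.univ.erase m, lf R (Function.update c i leaf j)))) +
      (∏ j ∈ Finset.univ.erase i, lf R (c j)) *
        ∑ o, γ (otree (c i) o) * der γ (obranches (c i) o) := by
    intro i
    rw [Fintype.sum_option, Fintype.sum_option]
    congr 1
    · simp only [obranches, otree, der_singleton, inv_rmarks_avoid, der_ofFn, Finset.mul_sum]
    · simp only [otree, hγ.leaf, zero_mul, zero_add, obranches, Finset.mul_sum]
      refine Finset.sum_congr rfl fun r _ => ?_
      have hlf : lf R (rtree (c i) r) = 0 := by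
        have := lf_otree (R := R) (c i) (some r)
        simpa [otree] using this
      rw [der_ofFn_update _ _ _ hlf]
      by_cases h1 : γ (rtree (c i) r) = 0
      · simp [h1]
      by_cases h2 : ∏ j ∈ Finset.univ.erase i, lf R (c j) = 0
      · simp [h2]
      have h3 : ∀ j ≠ i, c j = leaf := fun j hj => eq_leaf_of_lf_ne_zero fun h0 =>
        h2 (Finset.prod_eq_zero (Finset.mem_erase.2 ⟨hj, Finset.mem_univ j⟩) h0)
      have h4 : inv (rmarks (node b n c)
          (mkSub (Function.update (fun j => full (c j)) i (some r)))) = 0 := by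
        have nil : ∀ j ≠ i, omarks (c j) (Function.update (fun j => full (c j)) i (some r) j) =
            [] := by
          intro j hj
          rw [Function.update_of_ne hj, h3 j hj]
          rfl
        rw [rmarks_node, inv_cons_true, flatten_ofFn_split _ i,
          take_ofFn_congr (g := fun _ => []), drop_ofFn_congr (g := fun _ => []),
          Function.update_self]
        · have e : ∀ m : ℕ, ((List.ofFn fun _ : Fin n => ([] : List (Bool × Gen))).take m).flatten =
              [] := fun m => by
            rw [List.flatten_eq_nil_iff]
            intro l hl
            obtain ⟨j, rfl⟩ := List.mem_ofFn.1 (List.mem_of_mem_take hl)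
            rfl
          have e' : ∀ m : ℕ, ((List.ofFn fun _ : Fin n => ([] : List (Bool × Gen))).drop m).flatten =
              [] := fun m => by
            rw [List.flatten_eq_nil_iff]
            intro l hl
            obtain ⟨j, rfl⟩ := List.mem_ofFn.1 (List.mem_of_mem_drop hl)
            rfl
          rw [e, e', List.nil_append, List.append_nil]
          obtain ⟨h5, h6⟩ := hγ _ h1
          simp only [omarks]
          exact inv_rmarks_of_unary h5 h6
        · intro j hj
          exact nil j (by rintro rfl; omega)
        · intro j hj
          exact nil j (by rintro rfl; omega)
      rw [h4]
      ring
  rw [Finset.sum_congr rfl fun i _ => hsplit i, Finset.sum_add_distrib, add_eq_right,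
    ← Finset.sum_product']
  have herase : ∀ i m : Fin n, i ≠ m →
      ∏ j ∈ Finset.univ.erase m, lf R (Function.update c i leaf j) =
        ∏ j ∈ (Finset.univ.erase m).erase i, lf R (c j) := by
    intro i m him
    rw [← Finset.mul_prod_erase _ _ (Finset.mem_erase.2 ⟨him, Finset.mem_univ i⟩),
      Function.update_self, lf_leaf, one_mul]
    refine Finset.prod_congr rfl fun j hj => ?_
    rw [Function.update_of_ne (Finset.ne_of_mem_erase hj)]
  have hsign : ∀ i m : Fin n, i ≠ m → γ (c i) ≠ 0 → γ (c m) ≠ 0 →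
      ∏ j ∈ (Finset.univ.erase m).erase i, lf R (c j) ≠ 0 →
      numU (c i) * ∑ j : Fin n with i < j, numU (c j) = if i < m then 1 else 0 := by
    intro i m him hi hm hp
    rw [(hγ _ hi).2, one_mul]
    have h0 : ∀ j, j ≠ i → j ≠ m → numU (c j) = 0 := fun j hj hj' =>
      numU_eq_zero_of_lf (R := R) fun h0 => hp (Finset.prod_eq_zero
        (Finset.mem_erase.2 ⟨hj, Finset.mem_erase.2 ⟨hj', Finset.mem_univ j⟩⟩) h0)
    rw [Finset.sum_filter, Finset.sum_eq_single m]
    · rw [(hγ _ hm).2]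
    · intro j _ hj
      split_ifs with hij
      · exact h0 j hij.ne' hj
      · rfl
    · simp
  have hneg : ∀ i m : Fin n, i ≠ m →
      γ (c i) * ((-1) ^ (numU (c i) * ∑ j : Fin n with i < j, numU (c j)) *
        (γ (Function.update c i leaf m) *
          ∏ j ∈ Finset.univ.erase m, lf R (Function.update c i leaf j))) +
      γ (c m) * ((-1) ^ (numU (c m) * ∑ j : Fin n with m < j, numU (c j)) *
        (γ (Function.update c m leaf i) *
          ∏ j ∈ Finset.univ.erase i, lf R (Function.update c m leaf j))) = 0 := by
    intro i m him
    rw [herase i m him, herase m i him.symm, Finset.erase_right_comm,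
      Function.update_of_ne him.symm, Function.update_of_ne him]
    by_cases hi : γ (c i) = 0
    · simp [hi]
    by_cases hm : γ (c m) = 0
    · simp [hm]
    by_cases hp : ∏ j ∈ (Finset.univ.erase i).erase m, lf R (c j) = 0
    · simp [hp]
    rw [hsign m i him.symm hm hi hp, hsign i m him hi hm (by rwa [Finset.erase_right_comm])]
    rcases lt_or_gt_of_ne him with h | h
    · rw [if_pos h, if_neg h.not_gt]
      ring
    · rw [if_neg h.not_gt, if_pos h]
      ring
  refine Finset.sum_involution (fun p _ => p.swap) ?_ ?_ ?_ ?_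
  · rintro ⟨i, m⟩ _
    rcases eq_or_ne i m with rfl | him
    · simp [hγ.leaf]
    · exact hneg i m him
  · rintro ⟨i, m⟩ _ h0 h
    obtain rfl : m = i := congrArg Prod.fst h
    simp [hγ.leaf] at h0
  · simp
  · simp

theorem prod_cor_ne_zero {l : List DecTree} (h : (l.map (cor R false)).prod ≠ 0) :
    ∀ x ∈ l, numU x = 0 := fun _ hx => numU_eq_zero_of_cor (R := R) fun h0 =>
  h (List.prod_eq_zero (h0 ▸ List.mem_map_of_mem hx))

/-- Grafting into a corolla reproduces the weights. -/
theorem sum_cor_squot_wt (lam : R) (b : Bool) (E : DecTree) :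
    ∑ s : Sub E.shape, (-1) ^ sgnExp E s * (cor R b (squot true E s) * wtU (stree E s) +
      cor R b (squot false E s) * wtV lam (stree E s)) = wt lam b E := by
  simp only [mul_add, Finset.sum_add_distrib]
  rw [sum_cor_squot _ _ _ wtU rfl, sum_cor_squot _ _ _ (wtV lam) rfl]
  cases b <;> simp [wt]

theorem wtV_eq (lam : R) (E : DecTree) :
    wtV lam E = (if IsRoot true E then ((children E).map (cor R false)).prod else 0) -
      if IsRoot false E then der (gw lam) (children E) else 0 := by
  rcases E with _ | ⟨_ | _, n, c⟩
  · simp [wtV, IsRoot]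
  · simp [wtV, IsRoot, children]
  · simp [wtV, IsRoot, children, List.map_ofFn, List.prod_ofFn]

theorem prod_update_erase {n : ℕ} (f : DecTree → R) (c : Fin n → DecTree) (i : Fin n) (q : DecTree) :
    ∏ j, f (Function.update c i q j) = f q * ∏ j ∈ Finset.univ.erase i, f (c j) := by
  rw [← Finset.mul_prod_erase _ _ (Finset.mem_univ i), Function.update_self]
  congr 1
  refine Finset.prod_congr rfl fun j hj => ?_
  rw [Function.update_of_ne (Finset.ne_of_mem_erase hj)]

/-- If the root is a `u`, the terms whose subtree contains the root are indexed by the branch that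
is merged with the root or split off, and they cancel those of the subtrees of this branch. -/
theorem sum_wtV_of_root_u (lam : R) (n : ℕ+) (c : Fin n → DecTree) :
    ∑ s : Sub (node true n c).shape, (-1) ^ sgnExp (node true n c) s *
      (wtV lam (squot true (node true n c) s) * wtU (stree (node true n c) s) +
        wtV lam (squot false (node true n c) s) * wtV lam (stree (node true n c) s)) = 0 := by
  rw [sum_sub]
  simp only [stree_inlSub, squot_inlSub, sgnExp_inlSub, stree_inrSub, squot_inrSub, sgnExp_inrSub,
    ↓reduceIte, wtV_ofBranches_true _ (rbranches_ne_nil _ _), wtV_ofBranches_false _ (rbranches_ne_nil _ _)]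
  -- For the subtrees containing the root all signs that occur with a nonzero weight are trivial.
  have h1 : ∀ r : ∀ i : Fin n, Option (RootSub (c i).shape),
      (-1) ^ inv (rmarks (node true n c) (mkSub r)) *
        (((rbranches (node true n c) (mkSub r)).map (cor R false)).prod *
          wtU (rtree (node true n c) (mkSub r)) +
        -der (gw lam) (rbranches (node true n c) (mkSub r)) *
          wtV lam (rtree (node true n c) (mkSub r))) =
      wtU (rtree (node true n c) (mkSub r)) *
        ((rbranches (node true n c) (mkSub r)).map (cor R false)).prod -
      der (gw lam) (rbranches (node true n c) (mkSub r)) *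
        ∏ i, cor R false (otree (c i) (r i)) := by
    intro r
    rw [mul_add, sub_eq_add_neg]
    congr 1
    · by_cases h0 : ((rbranches (node true n c) (mkSub r)).map (cor R false)).prod = 0
      · simp [h0]
      · rw [inv_rmarks_of_rbranches (prod_cor_ne_zero h0)]
        ring
    · rw [rtree_node, wtV_node_true]
      by_cases h0 : ∏ i, cor R false (otree (c i) (r i)) = 0
      · simp [h0]
      · rw [inv_rmarks_of_rtree r fun i => numU_eq_zero_of_cor (R := R) fun hi =>
          h0 (Finset.prod_eq_zero (Finset.mem_univ i) hi)]
        ring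
  rw [Finset.sum_congr rfl fun r _ => h1 r, Finset.sum_sub_distrib,
    sum_wtU_rtree n c fun l => (l.map (cor R false)).prod,
    sum_der_rbranches (gw lam) true n c fun r => ∏ i, cor R false (otree (c i) (r i))]
  have h2 : ∀ (i : Fin n) (o : Option (RootSub (c i).shape)),
      ∏ j, cor R false (otree (c j) (Function.update (fun j => full (c j)) i o j)) =
        cor R false (otree (c i) o) * ∏ j ∈ Finset.univ.erase i, cor R false (c j) := by
    intro i o
    rw [← prod_update_erase (cor R false), ← otree_update_full]
  have h3 : ∀ i : Fin n, ∑ o, der (gw lam) (obranches (c i) o) *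
      ∏ j, cor R false (otree (c j) (Function.update (fun j => full (c j)) i o j)) =
      (∏ j ∈ Finset.univ.erase i, cor R false (c j)) *
        if IsRoot false (c i) then der (gw lam) (children (c i)) else 0 := by
    intro i
    rw [← sum_cor_otree, Finset.mul_sum]
    refine Finset.sum_congr rfl fun o _ => ?_
    rw [h2]
    ring
  have h4 : ∀ i : Fin n, (if IsRoot true (c i) then
      (((List.ofFn c).take i ++ (children (c i) ++ (List.ofFn c).drop (i + 1))).map
        (cor R false)).prod else 0) =
      (∏ j ∈ Finset.univ.erase i, cor R false (c j)) *
        if IsRoot true (c i) then ((children (c i)).map (cor R false)).prod else 0 := by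
    intro i
    rw [prod_ofFn_erase, mul_ite, mul_zero]
    congr 1
    simp only [List.map_append, List.prod_append, List.map_take, List.map_drop, List.map_ofFn]
    simp only [Function.comp_def]
    ring
  rw [Finset.sum_congr rfl fun i _ => h3 i, Finset.sum_congr rfl fun i _ => h4 i,
    ← Finset.sum_sub_distrib, ← Finset.sum_add_distrib]
  refine Finset.sum_eq_zero fun i _ => ?_
  rw [← mul_sub, ← wtV_eq]
  -- For a subtree of a branch the root gives the sign `-1`, and no other `u` precedes that branch.
  have h5 : ∀ s : Sub (c i).shape, (-1) ^ (1 +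
      cntU (((List.ofFn fun j => gens (c j)).take i).flatten) + sgnExp (c i) s) *
      (wtV lam (node true n (Function.update c i (squot true (c i) s))) * wtU (stree (c i) s) +
        wtV lam (node true n (Function.update c i (squot false (c i) s))) *
          wtV lam (stree (c i) s)) =
      - (∏ j ∈ Finset.univ.erase i, cor R false (c j)) * ((-1) ^ sgnExp (c i) s *
        (cor R false (squot true (c i) s) * wtU (stree (c i) s) +
          cor R false (squot false (c i) s) * wtV lam (stree (c i) s))) := by
    intro s
    rw [wtV_node_true, wtV_node_true, prod_update_erase, prod_update_erase]
    by_cases h0 : ∏ j ∈ Finset.univ.erase i, cor R false (c j) = 0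
    · simp [h0]
    · rw [cntU_flatten_take c i fun j hj => numU_eq_zero_of_cor (R := R) fun hj0 =>
        h0 (Finset.prod_eq_zero (Finset.mem_erase.2 ⟨hj, Finset.mem_univ j⟩) hj0)]
      rw [add_zero, pow_add]
      ring
  rw [Finset.sum_congr rfl fun s _ => h5 s, ← Finset.mul_sum, sum_cor_squot_wt]
  simp [wt]

/-- The quadratic identity for `gw`, the weight of the branch above a root `v`: the contractions
weighted by `wtU` and `wtV` add up to the ways of cutting the tree into two trees that both
contribute to `gw`. -/
theorem sum_gw_squot (lam : R) (E : DecTree) :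
    ∑ s : Sub E.shape, (-1) ^ sgnExp E s * (gw lam (squot true E s) * wtU (stree E s) +
      gw lam (squot false E s) * wtV lam (stree E s)) =
    ∑ o, gw lam (otree E o) * der (gw lam) (obranches E o) := by
  rcases E with _ | ⟨_ | _, n, c⟩
  · rw [Fintype.sum_option, Finset.sum_eq_zero, Finset.sum_eq_zero]
    · simp [otree]
    · exact fun r _ => Empty.elim r
    · exact fun r _ => Empty.elim r
  · rw [sum_sub, Fintype.sum_option, sum_rootSub]
    simp only [stree_inlSub, squot_inlSub, squot_inrSub, gw_node_false, otree, gw_leaf,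
      rtree_node, wtU_node_false, gw_ofBranches_false _ (rbranches_ne_nil _ _)]
    simp
  · rw [sum_sub, Fintype.sum_option, sum_rootSub]
    simp only [stree_inlSub, squot_inlSub, sgnExp_inlSub, stree_inrSub, squot_inrSub,
      sgnExp_inrSub, ↓reduceIte, otree, gw_leaf, zero_mul, zero_add, add_zero, obranches,
      gw_ofBranches_true _ (rbranches_ne_nil _ _), gw_ofBranches_false _ (rbranches_ne_nil _ _)]
    -- For the subtrees containing the root all signs that occur with a nonzero weight are trivial.
    have h1 : ∀ r : ∀ i : Fin n, Option (RootSub (c i).shape),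
        (-1) ^ inv (rmarks (node true n c) (mkSub r)) *
          (quo lam ((rbranches (node true n c) (mkSub r)).map (lv R)) *
            wtU (rtree (node true n c) (mkSub r))) =
        wtU (rtree (node true n c) (mkSub r)) *
          quo lam ((rbranches (node true n c) (mkSub r)).map (lv R)) := by
      intro r
      by_cases h0 : quo lam ((rbranches (node true n c) (mkSub r)).map (lv R)) = 0
      · simp [h0]
      · rw [inv_rmarks_of_rbranches (numU_eq_zero_of_quo h0)]
        ring
    rw [Finset.sum_congr rfl fun r _ => h1 r, sum_wtU_rtree n c fun l => quo lam (l.map (lv R))]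
    -- These are the values of `quo` with the entry `i` replaced by a leaf or by a corolla `v`.
    set q10 : Fin n → R := fun i => quo lam
      (((List.ofFn c).take i).map (lv R) ++ (1, 0) :: ((List.ofFn c).drop (i + 1)).map (lv R))
      with hq10
    set q01 : Fin n → R := fun i => quo lam
      (((List.ofFn c).take i).map (lv R) ++ (0, 1) :: ((List.ofFn c).drop (i + 1)).map (lv R))
      with hq01
    have hquo : ∀ (i : Fin n) (q : DecTree),
        quo lam ((List.ofFn (Function.update c i q)).map (lv R)) =
          lf R q * q10 i + cor R false q * q01 i := by
      intro i q
      rw [ofFn_update, List.map_append, List.map_cons, quo_append_cons]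
      rfl
    have hq01' : ∀ i, q01 i ≠ 0 → ∀ j ≠ i, numU (c j) = 0 := by
      intro i hi j hj
      refine numU_eq_zero_of_quo (lam := lam)
        (l := List.ofFn (Function.update c i (node false 1 fun _ => leaf))) ?_ _
        (List.mem_ofFn.2 ⟨j, Function.update_of_ne hj _ _⟩)
      rw [hquo, lf_node, cor_corolla, if_pos rfl, zero_mul, zero_add, one_mul]
      exact hi
    -- For a subtree of a branch the root gives the sign `-1`, and no other `u` precedes that branch.
    have h2 : ∀ (i : Fin n) (s : Sub (c i).shape), (-1) ^ (1 +
        cntU (((List.ofFn fun j => gens (c j)).take i).flatten) + sgnExp (c i) s) *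
        (gw lam (node true n (Function.update c i (squot true (c i) s))) * wtU (stree (c i) s) +
          gw lam (node true n (Function.update c i (squot false (c i) s))) *
            wtV lam (stree (c i) s)) =
        - q01 i * ((-1) ^ sgnExp (c i) s *
          (cor R false (squot true (c i) s) * wtU (stree (c i) s) +
            cor R false (squot false (c i) s) * wtV lam (stree (c i) s))) := by
      intro i s
      rw [gw_node_true, gw_node_true, hquo, hquo, lf_squot, lf_squot]
      by_cases h0 : q01 i = 0
      · simp [h0]
      · rw [cntU_flatten_take c i (hq01' i h0), add_zero, pow_add]
        ring
    have h3 : ∀ i : Fin n, ∑ s : Sub (c i).shape, (-1) ^ (1 +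
        cntU (((List.ofFn fun j => gens (c j)).take i).flatten) + sgnExp (c i) s) *
        (gw lam (node true n (Function.update c i (squot true (c i) s))) * wtU (stree (c i) s) +
          gw lam (node true n (Function.update c i (squot false (c i) s))) *
            wtV lam (stree (c i) s)) = - q01 i * wtV lam (c i) := by
      intro i
      rw [Finset.sum_congr rfl fun s _ => h2 i s, ← Finset.mul_sum, sum_cor_squot_wt]
      simp [wt]
    rw [Finset.sum_congr rfl fun i _ => h3 i]
    -- In a nonzero term on the right, the subtree is full in all branches but one.
    have h4 : ∑ r : ∀ i : Fin n, Option (RootSub (c i).shape),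
        gw lam (rtree (node true n c) (mkSub r)) *
          der (gw lam) (rbranches (node true n c) (mkSub r)) =
        ∑ i, (q10 i * gw lam (c i) +
          q01 i * if IsRoot false (c i) then der (gw lam) (children (c i)) else 0) := by
      rw [Finset.sum_congr rfl fun r _ => mul_comm _ _]
      simp only [rtree_node, gw_node_true]
      rw [sum_der_rbranches (gw lam) true n c fun r =>
        quo lam ((List.ofFn fun i => otree (c i) (r i)).map (lv R))]
      simp only [otree_update_full, hquo]
      refine Finset.sum_congr rfl fun i _ => ?_
      have e1 : ∑ o, lf R (otree (c i) o) * der (gw lam) (obranches (c i) o) = gw lam (c i) := by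
        classical
        simp [lf_otree, obranches, der_singleton]
      rw [← sum_cor_otree, ← e1, Finset.mul_sum, Finset.mul_sum, ← Finset.sum_add_distrib]
      exact Finset.sum_congr rfl fun o _ => by ring
    rw [h4, ← Finset.sum_add_distrib]
    refine Finset.sum_congr rfl fun i _ => ?_
    rw [wtV_eq]
    by_cases hr : IsRoot true (c i)
    · rw [if_pos hr]
      have hins := quo_insert lam (((List.ofFn c).take i).map (lv R))
        ((children (c i)).map (lv R)) (((List.ofFn c).drop (i + 1)).map (lv R))
      have e2 : ((children (c i)).map (lv R)).map Prod.snd =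
        (children (c i)).map (cor R false) := by rw [List.map_map]; rfl
      have e3 : quo lam ((children (c i)).map (lv R)) = gw lam (c i) := by
        generalize c i = E at hr
        rcases E with _ | ⟨b, m, d⟩
        · exact absurd hr id
        · obtain rfl : b = true := hr
          rfl
      have hr' : ¬ IsRoot false (c i) := by
        generalize c i = E at hr
        rcases E with _ | ⟨b, m, d⟩
        · exact id
        · obtain rfl : b = true := hr
          exact fun h => Bool.noConfusion h
      rw [List.map_append, List.map_append, hins, e2, e3, if_pos hr, if_neg hr']
      ring
    · have e3 : gw lam (c i) = 0 := by
        generalize c i = E at hr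
        rcases E with _ | ⟨_ | _, m, d⟩
        · rfl
        · rfl
        · exact absurd rfl hr
      rw [if_neg hr, if_neg hr, e3]
      ring

/-- The subtrees of the branches contribute a factor for each branch. -/
theorem sum_inrSub (lam : R) (γ : DecTree → R) (e : ℕ) (n : ℕ+) (c : Fin n → DecTree)
    (i : Fin n) :
    ∑ s : Sub (c i).shape, (-1) ^ (e +
      cntU (((List.ofFn fun j => gens (c j)).take i).flatten) + sgnExp (c i) s) *
      (der γ (List.ofFn (Function.update c i (squot true (c i) s))) * wtU (stree (c i) s) +
        der γ (List.ofFn (Function.update c i (squot false (c i) s))) *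
          wtV lam (stree (c i) s)) =
      (-1) ^ e * ((∏ j ∈ Finset.univ.erase i, lf R (c j)) *
        ∑ s : Sub (c i).shape, (-1) ^ sgnExp (c i) s *
          (γ (squot true (c i) s) * wtU (stree (c i) s) +
            γ (squot false (c i) s) * wtV lam (stree (c i) s))) := by
  rw [Finset.mul_sum, Finset.mul_sum]
  refine Finset.sum_congr rfl fun s _ => ?_
  rw [der_ofFn_update _ _ _ (lf_squot _ _ _), der_ofFn_update _ _ _ (lf_squot _ _ _)]
  by_cases h0 : ∏ j ∈ Finset.univ.erase i, lf R (c j) = 0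
  · simp [h0]
  · rw [cntU_flatten_take c i fun j hj => numU_eq_zero_of_lf (R := R) fun hj0 =>
      h0 (Finset.prod_eq_zero (Finset.mem_erase.2 ⟨hj, Finset.mem_univ j⟩) hj0)]
    rw [add_zero, pow_add]
    ring

/-- If the root is a `v`, the contributions of each branch cancel by `sum_gw_squot`. -/
theorem sum_wtV_of_root_v (lam : R) (n : ℕ+) (c : Fin n → DecTree) :
    ∑ s : Sub (node false n c).shape, (-1) ^ sgnExp (node false n c) s *
      (wtV lam (squot true (node false n c) s) * wtU (stree (node false n c) s) +
        wtV lam (squot false (node false n c) s) * wtV lam (stree (node false n c) s)) = 0 := by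
  rw [sum_sub]
  simp only [stree_inlSub, squot_inlSub, sgnExp_inlSub, stree_inrSub, squot_inrSub, sgnExp_inrSub,
    wtV_ofBranches_false _ (rbranches_ne_nil _ _), rtree_node, wtU_node_false, wtV_node_false,
    mul_zero, zero_add, neg_mul_neg]
  rw [sum_der_der (unaryRoot_gw lam)]
  simp only [neg_mul, ← neg_add, mul_neg, Finset.sum_neg_distrib]
  rw [Finset.sum_congr rfl fun i _ => sum_inrSub lam (gw lam) (if false = true then 1 else 0) n c i]
  simp only [sum_gw_squot]
  simp

/-- The weights of the operations on the generators `v` satisfy the relations of a homotopy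
cooperad. -/
theorem sum_wtV (lam : R) (E : DecTree) :
    ∑ s : Sub E.shape, (-1) ^ sgnExp E s * (wtV lam (squot true E s) * wtU (stree E s) +
      wtV lam (squot false E s) * wtV lam (stree E s)) = 0 := by
  rcases E with _ | ⟨_ | _, n, c⟩
  · exact Finset.sum_eq_zero fun s _ => Empty.elim s
  · exact sum_wtV_of_root_v lam n c
  · exact sum_wtV_of_root_u lam n c

/-- The weights of the operations on the generators `u` satisfy the relations of a homotopy
cooperad. -/
theorem sum_wtU (lam : R) (E : DecTree) :
    ∑ s : Sub E.shape, (-1) ^ sgnExp E s * (wtU (squot true E s) * wtU (stree E s) +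
      wtU (squot false E s) * wtV lam (stree E s)) = 0 := by
  rcases E with _ | ⟨_ | _, n, c⟩
  · exact Finset.sum_eq_zero fun s _ => Empty.elim s
  · rw [sum_sub]
    simp only [stree_inlSub, squot_inlSub, squot_inrSub, rtree_node, wtU_node_false,
      wtU_ofBranches_false (rbranches_ne_nil _ _)]
    simp
  · rw [sum_sub]
    simp only [stree_inlSub, squot_inlSub, sgnExp_inlSub, stree_inrSub, squot_inrSub,
      sgnExp_inrSub, ↓reduceIte, wtU_ofBranches_true (rbranches_ne_nil _ _),
      wtU_ofBranches_false (rbranches_ne_nil _ _), rtree_node, wtU_node_true, zero_mul, add_zero]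
    rw [sum_der_der unaryRoot_cor,
      Finset.sum_congr rfl fun i _ => sum_inrSub lam (cor R true) 1 n c i,
      ← Finset.sum_add_distrib]
    refine Finset.sum_eq_zero fun i _ => ?_
    rw [sum_cor_otree, sum_cor_squot_wt]
    have : (if IsRoot true (c i) then der (cor R true) (children (c i)) else 0) =
        wt lam true (c i) := by
      rcases c i with _ | ⟨_ | _, m, d⟩ <;> simp [IsRoot, wt, wtU, children]
    rw [this]
    simp

end

end DecTree


/-! ### Coordinates on tensor powers -/

section coordinates

variable (k : Type*) [Field k]

/-- The coordinate of a tensor at the basis vector given by a list of generators. Only the first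
`n` entries of the list matter; missing ones are read as `u₁`. -/
noncomputable def lc {n : ℕ} (W : List Gen) : ⨂[k]^n (Space k) →ₗ[k] k :=
  PiTensorProduct.lift ((MultilinearMap.mkPiAlgebra k (Fin n) k).compLinearMap fun i =>
    Finsupp.lapply (W.getD i (Gen.u 1)))

/-- The basis vector given by a list of generators. -/
noncomputable def tg (n : ℕ) (Y : List Gen) : ⨂[k]^n (Space k) :=
  PiTensorProduct.tprod k fun i : Fin n => Finsupp.single (Y.getD i (Gen.u 1)) 1

variable {k}

theorem lc_tprod {n : ℕ} (W : List Gen) (f : Fin n → Space k) :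
    lc k W (PiTensorProduct.tprod k f) = ∏ i, f i (W.getD i (Gen.u 1)) := by
  simp [lc]

theorem tprod_eq_tg {n : ℕ} (y : Fin n → Gen) :
    (PiTensorProduct.tprod k fun i => (Finsupp.single (y i) 1 : Space k)) =
      tg k n (List.ofFn y) := by
  simp [tg]

theorem ext_getD {α : Type*} {n : ℕ} {A B : List α} (d : α) (hA : A.length = n) (hB : B.length = n)
    (h : ∀ i : Fin n, A.getD i d = B.getD i d) : A = B := by
  refine List.ext_getElem (hA.trans hB.symm) fun i h1 h2 => ?_
  have := h ⟨i, hA ▸ h1⟩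
  simpa [List.getD_eq_getElem, h1, h2] using this

open scoped Classical in
theorem lc_tg {n : ℕ} {W Y : List Gen} (hW : W.length = n) (hY : Y.length = n) :
    lc k W (tg k n Y) = if Y = W then 1 else 0 := by
  rw [tg, lc_tprod]
  split_ifs with h
  · subst h
    simp
  · obtain ⟨i, hi⟩ : ∃ i : Fin n, Y.getD i (Gen.u 1) ≠ W.getD i (Gen.u 1) := by
      by_contra! h'
      exact h (ext_getD _ hY hW h')
    exact Finset.prod_eq_zero (Finset.mem_univ i) (Finsupp.single_eq_of_ne' hi)

theorem linearMap_ext_tg {n : ℕ} {M : Type*} [AddCommGroup M] [Module k M]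
    {f g : ⨂[k]^n (Space k) →ₗ[k] M}
    (h : ∀ Y : List Gen, Y.length = n → f (tg k n Y) = g (tg k n Y)) : f = g := by
  refine PiTensorProduct.ext (Module.Basis.ext_multilinear (fun _ : Fin n =>
    (Finsupp.basisSingleOne : Module.Basis Gen k (Space k))) fun y => ?_)
  simp only [LinearMap.compMultilinearMap_apply, Finsupp.coe_basisSingleOne]
  rw [tprod_eq_tg]
  exact h _ (by simp)

theorem tensor_ext {n : ℕ} {x y : ⨂[k]^n (Space k)}
    (h : ∀ W : List Gen, W.length = n → lc k W x = lc k W y) : x = y := by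
  classical
  apply (PiTensorProduct.ofFinsuppEquiv' (R := k) (ι := Fin n) (κ := fun _ => Gen)).injective
  ext w
  have e : (Finsupp.lapply w ∘ₗ
      (PiTensorProduct.ofFinsuppEquiv' (R := k) (ι := Fin n) (κ := fun _ => Gen)).toLinearMap) =
      lc k (List.ofFn w) := by
    refine linearMap_ext_tg fun Y hY => ?_
    rw [tg, lc_tprod]
    rw [LinearMap.comp_apply, LinearEquiv.coe_coe, Finsupp.lapply_apply,
      PiTensorProduct.ofFinsuppEquiv'_apply_apply]
    simp
  have h' := h (List.ofFn w) (by simp)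
  rw [← e] at h'
  exact h'

theorem lc_cast {n m : ℕ} (h : n = m) (W : List Gen) (x : ⨂[k]^n (Space k)) :
    lc k W (TensorPower.cast k (Space k) h x) = lc k W x := by
  subst h
  simp

theorem getD_append_castAdd {α : Type*} {n m : ℕ} {A B : List α} (d : α) (hA : A.length = n)
    (i : Fin n) : (A ++ B).getD (Fin.castAdd m i) d = A.getD i d :=
  List.getD_append _ _ _ _ (by rw [hA]; exact i.2)

theorem getD_append_natAdd {α : Type*} {n m : ℕ} {A B : List α} (d : α) (hA : A.length = n)
    (i : Fin m) : (A ++ B).getD (Fin.natAdd n i) d = B.getD i d := by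
  rw [List.getD_append_right _ _ _ _ (by simp [hA])]
  simp [hA]

theorem lc_mul {n m : ℕ} {A B : List Gen} (hA : A.length = n) (x : ⨂[k]^n (Space k))
    (y : ⨂[k]^m (Space k)) :
    lc k (A ++ B) (TensorPower.mulEquiv (x ⊗ₜ y)) = lc k A x * lc k B y := by
  induction x using PiTensorProduct.induction_on with
  | add x x' hx hx' => rw [TensorProduct.add_tmul, map_add, map_add, hx, hx', map_add, add_mul]
  | smul_tprod r f =>
    rw [← TensorProduct.smul_tmul', map_smul, map_smul, map_smul, smul_mul_assoc]
    congr 1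
    induction y using PiTensorProduct.induction_on with
    | add y y' hy hy' => rw [TensorProduct.tmul_add, map_add, map_add, hy, hy', map_add, mul_add]
    | smul_tprod s g =>
      rw [TensorProduct.tmul_smul, map_smul, map_smul, map_smul, mul_smul_comm]
      congr 1
      have := TensorPower.tprod_mul_tprod k f g
      rw [TensorPower.gMul_def] at this
      rw [this, lc_tprod, lc_tprod, lc_tprod, Fin.prod_univ_add]
      simp only [Fin.append_left, Fin.append_right, getD_append_castAdd _ hA,
        getD_append_natAdd _ hA]

theorem tg_append {n m : ℕ} {A B : List Gen} (hA : A.length = n) :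
    tg k (n + m) (A ++ B) = TensorPower.mulEquiv (tg k n A ⊗ₜ tg k m B) := by
  have := TensorPower.tprod_mul_tprod k
    (fun i : Fin n => (Finsupp.single (A.getD i (Gen.u 1)) 1 : Space k))
    (fun i : Fin m => (Finsupp.single (B.getD i (Gen.u 1)) 1 : Space k))
  rw [TensorPower.gMul_def] at this
  rw [tg, tg, tg, this]
  congr 1
  funext i
  refine Fin.addCases (fun i => ?_) (fun i => ?_) i
  · rw [Fin.append_left, getD_append_castAdd _ hA]
  · rw [Fin.append_right, getD_append_natAdd _ hA]

/-! ### The structure maps in coordinates -/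

/-- The parity of a generator as a natural number. -/
def Gen.pv (g : Gen) : ℕ := if g.isU then 0 else 1

theorem degree_eq_pv (g : Gen) : g.degree = g.pv := by cases g <;> rfl

theorem single_mem_comp (g : Gen) :
    (Finsupp.single g 1 : Space k) ∈ (collection k).comp g.arity g.degree :=
  Finsupp.single_mem_supported k 1 ⟨rfl, rfl⟩

theorem parityProj_single (p : ZMod 2) (g : Gen) :
    (collection k).parityProj p (Finsupp.single g 1) =
      if (g.pv : ZMod 2) = p then Finsupp.single g 1 else 0 := by
  rw [GradedCollection.parityProj_apply _ p (single_mem_comp g), degree_eq_pv, Int.cast_natCast]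

theorem involution_pow_single (j : ℕ) (g : Gen) :
    ((collection k).involution ^ j : Module.End k (Space k)) (Finsupp.single g 1) =
      (-1 : k) ^ (j * g.pv) • Finsupp.single g 1 := by
  have h1 : (collection k).involution (Finsupp.single g 1) =
      (-1 : k) ^ g.pv • (Finsupp.single g 1 : Space k) := by
    rw [GradedCollection.involution, LinearMap.sub_apply, parityProj_single, parityProj_single]
    cases g <;> simp [Gen.pv, Gen.isU]
  induction j with
  | zero => simp
  | succ j ih =>
    rw [pow_succ', Module.End.mul_apply, ih, map_smul, h1, smul_smul, ← pow_add, Nat.succ_mul]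

/-- The number of entries `v` in a list of generators. -/
def cntV (l : List Gen) : ℕ := (l.map Gen.pv).sum

@[simp] theorem cntV_nil : cntV [] = 0 := rfl
@[simp] theorem cntV_cons (g : Gen) (l : List Gen) : cntV (g :: l) = g.pv + cntV l := rfl
@[simp] theorem cntV_append (l l' : List Gen) : cntV (l ++ l') = cntV l + cntV l' := by
  simp [cntV]

theorem sum_pv_getD {n : ℕ} {A : List Gen} (hA : A.length = n) :
    ∑ i : Fin n, (A.getD i (Gen.u 1)).pv = cntV A := by
  subst hA
  rw [cntV, ← List.sum_ofFn]
  congr 1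
  exact List.ext_getElem (by simp) fun i h1 h2 => by simp

theorem map_involution_tg {n j : ℕ} {A : List Gen} (hA : A.length = n) :
    PiTensorProduct.map (fun _ : Fin n => ((collection k).involution ^ j : Module.End k (Space k)))
      (tg k n A) = (-1 : k) ^ (j * cntV A) • tg k n A := by
  rw [tg, PiTensorProduct.map_tprod]
  simp only [involution_pow_single]
  rw [MultilinearMap.map_smul_univ, Finset.prod_pow_eq_pow_sum, ← Finset.mul_sum, sum_pv_getD hA]

theorem lc_insertMap_tg {a j b : ℕ} {A M B A' B' : List Gen} (y : Gen) (hA : A.length = a)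
    (hM : M.length = j) (hA' : A'.length = a)
    (f : Space k →ₗ[k] ⨂[k]^j (Space k)) :
    lc k (A ++ (M ++ B)) ((collection k).insertMap a j b f (tg k (a + 1 + b) (A' ++ y :: B'))) =
      (-1) ^ (j * cntV A') * (lc k A (tg k a A') * lc k M (f (Finsupp.single y 1)) *
        lc k B (tg k b B')) := by
  have h1 : A' ++ y :: B' = (A' ++ [y]) ++ B' := by simp
  have h2 : (PiTensorProduct.subsingletonEquiv (0 : Fin 1) : (⨂[k]^1 (Space k)) ≃ₗ[k] Space k)
      (tg k 1 [y]) =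
      Finsupp.single y 1 := by
    rw [tg, PiTensorProduct.subsingletonEquiv_apply_tprod]
    rfl
  rw [h1, tg_append (by simp [hA']), tg_append hA', ← List.append_assoc]
  simp only [GradedCollection.insertMap, LinearMap.comp_apply, LinearEquiv.coe_coe,
    LinearEquiv.symm_apply_apply, TensorProduct.map_tmul, h2, map_involution_tg hA',
    LinearMap.id_apply]
  rw [lc_mul (by simp [hA, hM]), lc_mul hA, map_smul, smul_eq_mul]
  ring

/-- The coordinates of `(id ⊗ f ⊗ id) x` for a tensor `x` whose entry at the place of `f` has
arity `m`. -/
theorem lc_insertMap {a j b : ℕ} {A M B : List Gen} (hA : A.length = a) (hM : M.length = j)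
    (hB : B.length = b) (m : ℕ+) (f : Space k →ₗ[k] ⨂[k]^j (Space k))
    {x : ⨂[k]^(a + 1 + b) (Space k)}
    (hx : x ∈ Submodule.span k {x | ∃ (A' : List Gen) (y : Gen) (B' : List Gen), A'.length = a ∧
      B'.length = b ∧ y.arity = m ∧ x = tg k (a + 1 + b) (A' ++ y :: B')}) :
    lc k (A ++ (M ++ B)) ((collection k).insertMap a j b f x) =
      (-1) ^ (j * cntV A) *
        (lc k (A ++ gen true m :: B) x * lc k M (f (Finsupp.single (gen true m) 1)) +
          lc k (A ++ gen false m :: B) x * lc k M (f (Finsupp.single (gen false m) 1))) := by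
  classical
  induction hx using Submodule.span_induction with
  | mem x hx =>
    obtain ⟨A', y, B', hA', hB', hy, rfl⟩ := hx
    have hl : ∀ (z : Gen) (l l' : List Gen), l.length = a → l'.length = b →
        (l ++ z :: l').length = a + 1 + b := fun z l l' h h' => by simp [h, h']; omega
    rw [lc_insertMap_tg y hA hM hA', lc_tg hA hA', lc_tg hB hB', lc_tg (hl _ _ _ hA hB) (hl _ _ _ hA' hB'),
      lc_tg (hl _ _ _ hA hB) (hl _ _ _ hA' hB')]
    have hinj : ∀ z : Gen, A' ++ y :: B' = A ++ z :: B ↔ A' = A ∧ y = z ∧ B' = B := by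
      intro z
      constructor
      · intro h
        obtain ⟨h1, h2⟩ := List.append_inj h (hA'.trans hA.symm)
        exact ⟨h1, (List.cons.inj h2).1, (List.cons.inj h2).2⟩
      · rintro ⟨rfl, rfl, rfl⟩
        rfl
    simp only [hinj]
    by_cases h1 : A' = A
    · by_cases h2 : B' = B
      · subst h1 h2
        rcases y with n | n
        · obtain rfl : n = m := hy
          simp [gen]
        · obtain rfl : n = m := hy
          simp [gen]
      · simp [h2]
    · simp [h1]
  | zero => simp
  | add x y _ _ hx hy => simp only [map_add, hx, hy]; ring
  | smul c x _ hx => simp only [map_smul, hx, smul_eq_mul]; ring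

/-- The parities of a list of generators. -/
def par (n : ℕ) (V : List Gen) : Fin n → ZMod 2 := fun i => ((V.getD i (Gen.u 1)).pv : ZMod 2)

theorem permAction_tg {n : ℕ} (σ : Equiv.Perm (Fin n)) {Y : List Gen} :
    (collection k).permAction σ (tg k n Y) =
      (GradedCollection.koszulSign σ (par n Y) : k) •
        PiTensorProduct.tprod k fun i : Fin n => Finsupp.single (Y.getD (σ i) (Gen.u 1)) 1 := by
  rw [GradedCollection.permAction, LinearMap.sum_apply, Finset.sum_eq_single (par n Y)]
  · rw [LinearMap.smul_apply, LinearMap.comp_apply, tg, PiTensorProduct.map_tprod,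
      LinearEquiv.coe_coe]
    congr 1
    refine (PiTensorProduct.reindex_tprod _ _).trans ?_
    congr 1
    funext i
    simp [parityProj_single, par]
  · intro p _ hp
    obtain ⟨i, hi⟩ := Function.ne_iff.1 hp
    rw [LinearMap.smul_apply, LinearMap.comp_apply, tg, PiTensorProduct.map_tprod,
      MultilinearMap.map_coord_zero (i := i), map_zero, smul_zero]
    rw [parityProj_single, if_neg]
    exact fun h => hi (by rw [← h]; rfl)
  · simp

theorem lc_permAction {n : ℕ} (σ : Equiv.Perm (Fin n)) (W : List Gen) (x : ⨂[k]^n (Space k)) :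
    lc k W ((collection k).permAction σ⁻¹ x) =
      (GradedCollection.koszulSign σ⁻¹
        (par n (List.ofFn fun i => W.getD (σ i) (Gen.u 1))) : k) *
        lc k (List.ofFn fun i => W.getD (σ i) (Gen.u 1)) x := by
  classical
  have e : lc k W ∘ₗ (collection k).permAction σ⁻¹ =
      (GradedCollection.koszulSign σ⁻¹
        (par n (List.ofFn fun i => W.getD (σ i) (Gen.u 1))) : k) •
        lc k (List.ofFn fun i => W.getD (σ i) (Gen.u 1)) := by
    refine linearMap_ext_tg fun Y hY => ?_
    rw [LinearMap.comp_apply, permAction_tg, map_smul, LinearMap.smul_apply, smul_eq_mul,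
      smul_eq_mul, lc_tprod, ← Equiv.prod_comp σ, lc_tg (by simp) hY]
    by_cases h : Y = List.ofFn fun i => W.getD (σ i) (Gen.u 1)
    · rw [if_pos h, ← h]
      congr 1
      refine Finset.prod_eq_one fun i _ => ?_
      subst h
      simp
    · rw [if_neg h, mul_zero]
      obtain ⟨i, hi⟩ : ∃ i : Fin n, Y.getD i (Gen.u 1) ≠
          (List.ofFn fun i => W.getD (σ i) (Gen.u 1)).getD i (Gen.u 1) := by
        by_contra! h'
        exact h (ext_getD _ hY (by simp) h')
      rw [Finset.prod_eq_zero (Finset.mem_univ i), mul_zero]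
      rw [Finsupp.single_eq_of_ne']
      simpa using hi
  exact LinearMap.congr_fun e x

end coordinates


/-! ### Sorting the vertices -/

/-- A stable sort by a key with values at most two lists the three fibres of the key. -/
theorem ofFn_sort {n : ℕ} (key : Fin n → ℕ) (hkey : ∀ i, key i ≤ 2) :
    List.ofFn (Tuple.sort key) = (List.finRange n).filter (fun i => key i = 0) ++
      ((List.finRange n).filter (fun i => key i = 1) ++
        (List.finRange n).filter (fun i => key i = 2)) := by
  have hs := (Tuple.eq_sort_iff (f := key) (σ := Tuple.sort key)).1 rfl
  refine List.Perm.eq_of_pairwise (le := fun i j => key i < key j ∨ (key i = key j ∧ i < j))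
    ?_ ?_ ?_ ?_
  · intro a b _ _ h h'
    rcases h with h | ⟨h, h1⟩ <;> rcases h' with h' | ⟨h', h2⟩ <;> omega
  · rw [List.pairwise_ofFn]
    intro i j hij
    rcases (hs.1 hij.le).lt_or_eq with h | h
    · exact Or.inl h
    · exact Or.inr ⟨h, hs.2 i j hij h⟩
  · have hp : ∀ m, ((List.finRange n).filter (fun i => key i = m)).Pairwise
        fun i j => key i < key j ∨ (key i = key j ∧ i < j) := by
      intro m
      rw [List.pairwise_filter]
      refine (List.pairwise_lt_finRange n).imp fun {i j} hij hi hj => ?_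
      simp only [decide_eq_true_eq] at hi hj
      exact Or.inr ⟨hi.trans hj.symm, hij⟩
    rw [List.pairwise_append, List.pairwise_append]
    refine ⟨hp 0, ⟨hp 1, hp 2, ?_⟩, ?_⟩
    · intro i hi j hj
      simp only [List.mem_filter, decide_eq_true_eq] at hi hj
      exact Or.inl (by omega)
    · intro i hi j hj
      simp only [List.mem_append, List.mem_filter, decide_eq_true_eq] at hi hj
      exact Or.inl (by omega)
  · rw [List.perm_ext_iff_of_nodup]
    · intro i
      simp only [List.mem_ofFn, List.mem_append, List.mem_filter, List.mem_finRange,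
        decide_eq_true_eq, true_and]
      refine ⟨fun _ => by have := hkey i; omega, fun _ => ⟨(Tuple.sort key).symm i, by simp⟩⟩
    · exact List.nodup_ofFn.2 (Tuple.sort key).injective
    · have hn := fun m => (List.nodup_finRange n).filter (fun i => decide (key i = m))
      rw [List.nodup_append, List.nodup_append]
      refine ⟨hn 0, ⟨hn 1, hn 2, ?_⟩, ?_⟩
      · intro i hi j hj
        simp only [List.mem_filter, decide_eq_true_eq] at hi hj
        rintro rfl
        omega
      · intro i hi j hj
        simp only [List.mem_append, List.mem_filter, decide_eq_true_eq] at hi hj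
        rintro rfl
        omega

/-- The key by which the vertices are sorted. -/
def sortKey (n p : ℕ) (marks : List Bool) (v : Fin n) : ℕ :=
  if v.val < p then 0 else if marks.getD v.val false = true then 1 else 2

theorem sortKey_le (n p : ℕ) (marks : List Bool) (v : Fin n) : sortKey n p marks v ≤ 2 := by
  unfold sortKey
  split_ifs <;> omega

/-- A list of generators together with their keys. -/
def keyed (pre : List Gen) (post : List (Bool × Gen)) : List (ℕ × Gen) :=
  pre.map (Prod.mk 0) ++ post.map fun x => (if x.1 then 1 else 2, x.2)

theorem length_keyed (pre : List Gen) (post : List (Bool × Gen)) :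
    (keyed pre post).length = (pre ++ post.map Prod.snd).length := by simp [keyed]

theorem map_snd_keyed (pre : List Gen) (post : List (Bool × Gen)) :
    (keyed pre post).map Prod.snd = pre ++ post.map Prod.snd := by
  simp [keyed, Function.comp_def]

theorem sortKey_eq (pre : List Gen) (post : List (Bool × Gen)) {n : ℕ}
    (hn : (pre ++ post.map Prod.snd).length = n) (v : Fin n) :
    sortKey n pre.length (List.replicate pre.length false ++ post.map Prod.fst) v =
      ((keyed pre post)[v.val]'(by rw [length_keyed, hn]; exact v.2)).1 := by
  have hv : v.val < pre.length + post.length := by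
    have := v.2
    simpa [← hn] using this
  unfold sortKey
  by_cases h : v.val < pre.length
  · rw [if_pos h]
    simp [keyed, List.getElem_append_left, h]
  · rw [if_neg h]
    simp only [keyed]
    rw [List.getElem_append_right (by simpa using h), List.getD_append_right _ _ _ _ (by simpa using h)]
    simp only [List.length_replicate, List.length_map, List.getElem_map]
    rw [List.getD_eq_getElem _ _ (by simp; omega), List.getElem_map]

theorem ofFn_getD_sort (pre : List Gen) (post : List (Bool × Gen)) {n : ℕ}
    (hn : (pre ++ post.map Prod.snd).length = n) :
    (List.ofFn fun i : Fin n => (pre ++ post.map Prod.snd).getD (Tuple.sort (sortKey n pre.length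
      (List.replicate pre.length false ++ post.map Prod.fst)) i) (Gen.u 1)) =
      pre ++ (ins post ++ outs post) := by
  set key := sortKey n pre.length (List.replicate pre.length false ++ post.map Prod.fst) with hk
  set get : Fin n → ℕ × Gen := fun v =>
    (keyed pre post)[v.val]'(by rw [length_keyed, hn]; exact v.2) with hget
  have h1 : (List.finRange n).map get = keyed pre post := by
    rw [← List.ofFn_eq_map]
    exact List.ext_getElem (by simp [length_keyed, ← hn]) fun i _ _ => by simp [hget]
  have h2 : ∀ v : Fin n, (pre ++ post.map Prod.snd).getD v (Gen.u 1) = (get v).2 := by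
    intro v
    rw [List.getD_eq_getElem _ _ (by rw [hn]; exact v.2)]
    simp only [hget, ← map_snd_keyed, List.getElem_map]
  have h3 : ∀ m, ((List.finRange n).filter fun i => key i = m).map (fun v => (get v).2) =
      ((keyed pre post).filter fun x => x.1 = m).map Prod.snd := by
    intro m
    rw [← h1, List.filter_map, List.map_map]
    congr 2
    funext v
    simp only [Function.comp, hk, sortKey_eq pre post hn, hget]
  have h4 : (List.ofFn fun i : Fin n => (pre ++ post.map Prod.snd).getD (Tuple.sort key i) (Gen.u 1)) =
      (List.ofFn (Tuple.sort key)).map fun v => (get v).2 := by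
    rw [List.map_ofFn]
    congr 1
    funext i
    exact h2 _
  rw [h4, ofFn_sort key (sortKey_le _ _ _), List.map_append, List.map_append, h3, h3, h3]
  have e : ∀ m, ((keyed pre post).filter fun x => x.1 = m).map Prod.snd =
      (if m = 0 then pre else []) ++
        (post.filter fun x => (if x.1 then 1 else 2) = m).map Prod.snd := by
    intro m
    rw [keyed, List.filter_append, List.map_append]
    congr 1
    · split_ifs with hm
      · subst hm
        simp [List.filter_map, Function.comp_def]
      · simp [List.filter_map, Function.comp_def, Ne.symm hm]
    · rw [List.filter_map, List.map_map]
      rfl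
  rw [e, e, e]
  have e0 : (post.filter fun x => decide ((if x.1 then 1 else 2) = 0)) = [] := by
    rw [List.filter_eq_nil_iff]
    intro x _
    split_ifs <;> simp
  have e1 : (post.filter fun x => decide ((if x.1 then 1 else 2) = 1)) = post.filter fun x => x.1 := by
    congr 1
    funext x
    rcases x with ⟨_ | _, _⟩ <;> rfl
  have e2 : (post.filter fun x => decide ((if x.1 then 1 else 2) = 2)) = post.filter fun x => !x.1 := by
    congr 1
    funext x
    rcases x with ⟨_ | _, _⟩ <;> rfl
  rw [e0, e1, e2]
  simp [ins, outs]

theorem sort_symm_lt_iff {n : ℕ} (key : Fin n → ℕ) {s t : Fin n} (h : s < t) :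
    (Tuple.sort key)⁻¹ t < (Tuple.sort key)⁻¹ s ↔ key t < key s := by
  have hs := (Tuple.eq_sort_iff (f := key) (σ := Tuple.sort key)).1 rfl
  have hmono : ∀ i j, (Tuple.sort key)⁻¹ i ≤ (Tuple.sort key)⁻¹ j → key i ≤ key j := by
    intro i j hij
    have := hs.1 hij
    simpa using this
  constructor
  · intro hlt
    refine lt_of_le_of_ne (hmono _ _ hlt.le) fun he => ?_
    have := hs.2 _ _ hlt (by simpa using he)
    rw [show ∀ x, Tuple.sort key ((Tuple.sort key)⁻¹ x) = x from
      Equiv.apply_symm_apply (Tuple.sort key), show ∀ x, Tuple.sort key ((Tuple.sort key)⁻¹ x) = x from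
      Equiv.apply_symm_apply (Tuple.sort key)] at this
    exact absurd this h.not_gt
  · intro hlt
    by_contra hle
    exact absurd (hmono _ _ (not_lt.1 hle)) hlt.not_ge

/-! ### Signs -/

/-- One for `u_n`, which is odd after desuspension, and zero for `v_n`. -/
def Gen.qv (g : Gen) : ℕ := if g.isU then 1 else 0

theorem sum_inversions_list (l : List (ℕ × Gen)) :
    ∑ s : Fin l.length, ∑ t : Fin l.length,
      (if s < t ∧ (l[t.val]'t.2).1 < (l[s.val]'s.2).1 then
        (l[s.val]'s.2).2.qv * (l[t.val]'t.2).2.qv else 0) =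
      l.rec 0 fun x l r => (l.map fun y => if y.1 < x.1 then x.2.qv * y.2.qv else 0).sum + r := by
  induction l with
  | nil => rfl
  | cons x l ih =>
    simp only
    rw [← ih, ← Fin.sum_univ_fun_getElem]
    simp only [List.length_cons]
    rw [Fin.sum_univ_succ, Fin.sum_univ_succ]
    congr 1
    · simp
    · refine Finset.sum_congr rfl fun s _ => ?_
      rw [Fin.sum_univ_succ]
      simp

theorem sum_inversions_keyed (pre : List Gen) (post : List (Bool × Gen)) :
    ∑ s : Fin (keyed pre post).length, ∑ t : Fin (keyed pre post).length,
      (if s < t ∧ ((keyed pre post)[t.val]'t.2).1 < ((keyed pre post)[s.val]'s.2).1 then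
        ((keyed pre post)[s.val]'s.2).2.qv * ((keyed pre post)[t.val]'t.2).2.qv else 0) =
      inv post := by
  rw [sum_inversions_list]
  induction pre with
  | nil =>
    induction post with
    | nil => rfl
    | cons x post ih =>
      simp only [keyed, List.map_nil, List.nil_append, List.map_cons] at ih ⊢
      rw [ih, inv]
      congr 1
      rcases x with ⟨_ | _, g⟩
      · clear ih
        induction post with
        | nil => simp
        | cons y post ih =>
          rcases y with ⟨_ | _, h⟩
          · simpa using ih
          · simp only [List.map_cons, List.sum_cons, ih]
            cases hg : g.isU <;> simp [Gen.qv, hg]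
      · simp only [Bool.not_true, Bool.false_and, Bool.false_eq_true, if_false]
        refine List.sum_eq_zero fun m hm => ?_
        simp only [List.map_map, List.mem_map] at hm
        obtain ⟨⟨b, y⟩, _, rfl⟩ := hm
        cases b <;> simp
  | cons x pre ih =>
    simp only [keyed, List.map_cons, List.cons_append] at ih ⊢
    rw [ih, Nat.add_eq_right]
    refine List.sum_eq_zero fun m hm => ?_
    obtain ⟨y, _, rfl⟩ := List.mem_map.1 hm
    simp

theorem sum_inversions (pre : List Gen) (post : List (Bool × Gen)) {n : ℕ}
    (hn : (pre ++ post.map Prod.snd).length = n) :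
    ∑ s : Fin n, ∑ t : Fin n,
      (if s < t ∧ (Tuple.sort (sortKey n pre.length
          (List.replicate pre.length false ++ post.map Prod.fst)))⁻¹ t <
        (Tuple.sort (sortKey n pre.length
          (List.replicate pre.length false ++ post.map Prod.fst)))⁻¹ s then
        ((pre ++ post.map Prod.snd).getD s (Gen.u 1)).qv *
          ((pre ++ post.map Prod.snd).getD t (Gen.u 1)).qv else 0) = inv post := by
  obtain rfl : (keyed pre post).length = n := (length_keyed _ _).trans hn
  rw [← sum_inversions_keyed pre post]
  refine Finset.sum_congr rfl fun s _ => Finset.sum_congr rfl fun t _ => ?_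
  have h2 : ∀ v : Fin (keyed pre post).length, (pre ++ post.map Prod.snd).getD v (Gen.u 1) =
      ((keyed pre post)[v.val]'v.2).2 := by
    intro v
    rw [List.getD_eq_getElem _ _ (by rw [hn]; exact v.2)]
    simp only [← map_snd_keyed, List.getElem_map]
  rw [h2, h2]
  refine if_congr (and_congr_right fun h => ?_) rfl rfl
  rw [sort_symm_lt_iff _ h, sortKey_eq pre post hn, sortKey_eq pre post hn]

theorem sign_eq_pow {n : ℕ} (τ : Equiv.Perm (Fin n)) :
    ((Equiv.Perm.sign τ : ℤˣ) : ℤ) =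
      (-1) ^ ∑ s : Fin n, ∑ t : Fin n, if s < t ∧ τ t < τ s then 1 else 0 := by
  rw [Equiv.Perm.sign_eq_prod_prod_Ioi, Units.coe_prod, ← Finset.prod_pow_eq_pow_sum]
  refine Finset.prod_congr rfl fun s _ => ?_
  rw [Units.coe_prod, ← Finset.prod_pow_eq_pow_sum, ← Finset.prod_subset (Finset.subset_univ (Finset.Ioi s))]
  · refine Finset.prod_congr rfl fun t ht => ?_
    rw [Finset.mem_Ioi] at ht
    have hne : τ s ≠ τ t := fun h => ht.ne (τ.injective h)
    rcases lt_or_gt_of_ne hne with h | h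
    · simp [h, h.not_gt]
    · simp [h, h.not_gt, ht]
  · intro t _ ht
    rw [Finset.mem_Ioi] at ht
    simp [ht]

theorem koszulSign_eq_pow {n : ℕ} (σ : Equiv.Perm (Fin n)) (W : List Gen) :
    GradedCollection.koszulSign σ⁻¹ (par n (List.ofFn fun i => W.getD (σ i) (Gen.u 1))) =
      (-1) ^ ∑ s : Fin n, ∑ t : Fin n, if s < t ∧ σ⁻¹ t < σ⁻¹ s then
        (W.getD s (Gen.u 1)).pv * (W.getD t (Gen.u 1)).pv else 0 := by
  have hp : ∀ s, (par n (List.ofFn fun i => W.getD (σ i) (Gen.u 1)) (σ⁻¹ s)).val =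
      (W.getD s (Gen.u 1)).pv := by
    intro s
    have : (List.ofFn fun i => W.getD (σ i) (Gen.u 1)).getD (σ⁻¹ s).val (Gen.u 1) =
        W.getD s (Gen.u 1) := by
      rw [List.getD_eq_getElem _ _ (by simp)]
      simp
    rw [par, this]
    cases W.getD s (Gen.u 1) <;> rfl
  rw [GradedCollection.koszulSign, ← Finset.prod_pow_eq_pow_sum]
  refine Finset.prod_congr rfl fun s _ => ?_
  rw [← Finset.prod_pow_eq_pow_sum, Finset.prod_filter]
  refine Finset.prod_congr rfl fun t _ => ?_
  rw [hp, hp]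
  split_ifs <;> simp

theorem card_inversions {n : ℕ} (τ : Equiv.Perm (Fin n)) (s : Fin n) :
    (∑ t : Fin n, if s < t ∧ τ t < τ s then 1 else 0) + s.val =
      (∑ t : Fin n, if t < s ∧ τ s < τ t then 1 else 0) + (τ s).val := by
  have h1 : (s : ℕ) = ∑ t : Fin n, if t < s then 1 else 0 := by
    rw [← Finset.card_filter]
    have : (Finset.univ.filter fun t : Fin n => t < s) = Finset.Iio s := by ext; simp
    rw [this, Fin.card_Iio]
  have h2 : (τ s : ℕ) = ∑ t : Fin n, if τ t < τ s then 1 else 0 := by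
    rw [Equiv.sum_comp τ (fun t => if t < τ s then 1 else 0), ← Finset.card_filter]
    have : (Finset.univ.filter fun t : Fin n => t < τ s) = Finset.Iio (τ s) := by ext; simp
    rw [this, Fin.card_Iio]
  rw [h1, h2, ← Finset.sum_add_distrib, ← Finset.sum_add_distrib]
  refine Finset.sum_congr rfl fun t _ => ?_
  rcases lt_trichotomy s t with h | rfl | h
  · have hne : τ s ≠ τ t := fun e => h.ne (τ.injective e)
    rcases lt_or_gt_of_ne hne with h' | h' <;> simp [h, h', h.not_gt, h'.not_gt]
  · simp
  · have hne : τ s ≠ τ t := fun e => h.ne' (τ.injective e)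
    rcases lt_or_gt_of_ne hne with h' | h' <;> simp [h, h', h.not_gt, h'.not_gt]

theorem neg_one_pow_eq_of_cast {a b : ℕ} (h : (a : ZMod 2) = b) : (-1 : ℤ) ^ a = (-1) ^ b := by
  rw [neg_one_pow_eq_pow_mod_two, neg_one_pow_eq_pow_mod_two (n := b)]
  congr 1
  exact (ZMod.natCast_eq_natCast_iff' a b 2).1 h

/-- The position weighted number of entries `v` determines the difference between the Koszul signs
before and after desuspension. -/
theorem sign_mul_koszulSign {n : ℕ} (σ : Equiv.Perm (Fin n)) (W : List Gen) :
    ((Equiv.Perm.sign σ⁻¹ : ℤˣ) : ℤ) *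
      GradedCollection.koszulSign σ⁻¹ (par n (List.ofFn fun i => W.getD (σ i) (Gen.u 1))) =
    (-1) ^ ((∑ s : Fin n, ∑ t : Fin n, if s < t ∧ σ⁻¹ t < σ⁻¹ s then
        (W.getD s (Gen.u 1)).qv * (W.getD t (Gen.u 1)).qv else 0) +
      ((∑ s : Fin n, s.val * (W.getD s (Gen.u 1)).pv) +
        ∑ i : Fin n, i.val * (W.getD (σ i) (Gen.u 1)).pv)) := by
  rw [koszulSign_eq_pow, sign_eq_pow, ← pow_add]
  apply neg_one_pow_eq_of_cast
  have hpq : ∀ g h : Gen, (1 : ZMod 2) + (g.pv * h.pv : ℕ) =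
      (g.qv * h.qv : ℕ) + (g.pv + h.pv : ℕ) := by
    intro g h
    rcases g with _ | _ <;> rcases h with _ | _ <;> (simp [Gen.pv, Gen.qv, Gen.isU]; try decide)
  have e1 : ((∑ s : Fin n, ∑ t : Fin n, if s < t ∧ σ⁻¹ t < σ⁻¹ s then 1 else 0 : ℕ) : ZMod 2) +
      ((∑ s : Fin n, ∑ t : Fin n, if s < t ∧ σ⁻¹ t < σ⁻¹ s then
        (W.getD s (Gen.u 1)).pv * (W.getD t (Gen.u 1)).pv else 0 : ℕ) : ZMod 2) =
      ((∑ s : Fin n, ∑ t : Fin n, if s < t ∧ σ⁻¹ t < σ⁻¹ s then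
        (W.getD s (Gen.u 1)).qv * (W.getD t (Gen.u 1)).qv else 0 : ℕ) : ZMod 2) +
      ((∑ s : Fin n, ∑ t : Fin n, if s < t ∧ σ⁻¹ t < σ⁻¹ s then
        (W.getD s (Gen.u 1)).pv + (W.getD t (Gen.u 1)).pv else 0 : ℕ) : ZMod 2) := by
    simp only [Nat.cast_sum, ← Finset.sum_add_distrib]
    refine Finset.sum_congr rfl fun s _ => Finset.sum_congr rfl fun t _ => ?_
    split_ifs
    · exact_mod_cast hpq _ _
    · simp
  have e2 : (∑ s : Fin n, ∑ t : Fin n, if s < t ∧ σ⁻¹ t < σ⁻¹ s then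
        (W.getD s (Gen.u 1)).pv + (W.getD t (Gen.u 1)).pv else 0) =
      ∑ s : Fin n, ((∑ t : Fin n, if s < t ∧ σ⁻¹ t < σ⁻¹ s then 1 else 0) +
        ∑ t : Fin n, if t < s ∧ σ⁻¹ s < σ⁻¹ t then 1 else 0) * (W.getD s (Gen.u 1)).pv := by
    have h1 : ∀ s t : Fin n, (if s < t ∧ σ⁻¹ t < σ⁻¹ s then
        (W.getD s (Gen.u 1)).pv + (W.getD t (Gen.u 1)).pv else 0) =
        (if s < t ∧ σ⁻¹ t < σ⁻¹ s then 1 else 0) * (W.getD s (Gen.u 1)).pv +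
          (if s < t ∧ σ⁻¹ t < σ⁻¹ s then 1 else 0) * (W.getD t (Gen.u 1)).pv := by
      intro s t
      split_ifs <;> simp
    simp only [h1, Finset.sum_add_distrib, add_mul, Finset.sum_mul]
    congr 1
    exact Finset.sum_comm
  have e3 : (∑ i : Fin n, i.val * (W.getD (σ i) (Gen.u 1)).pv) =
      ∑ s : Fin n, (σ⁻¹ s).val * (W.getD s (Gen.u 1)).pv := by
    rw [← Equiv.sum_comp σ fun s => (σ⁻¹ s).val * (W.getD s (Gen.u 1)).pv]
    simp
  push_cast only [Nat.cast_add]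
  rw [e1]
  congr 1
  rw [← Nat.cast_add, e3, e2, ← Finset.sum_add_distrib, Nat.cast_sum, Nat.cast_sum]
  refine Finset.sum_congr rfl fun s _ => ?_
  rw [← add_mul, Nat.cast_mul, Nat.cast_mul]
  congr 1
  have h := congrArg (Nat.cast : ℕ → ZMod 2) (card_inversions σ⁻¹ s)
  push_cast only [Nat.cast_add] at h ⊢
  generalize ((∑ t : Fin n, if s < t ∧ σ⁻¹ t < σ⁻¹ s then 1 else 0 : ℕ) : ZMod 2) = x at h ⊢
  generalize ((∑ t : Fin n, if t < s ∧ σ⁻¹ s < σ⁻¹ t then 1 else 0 : ℕ) : ZMod 2) = y at h ⊢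
  generalize ((s.val : ℕ) : ZMod 2) = z at h ⊢
  generalize (((σ⁻¹ s).val : ℕ) : ZMod 2) = w at h ⊢
  revert x y z w
  decide

/-- The exponent of the sign of the desuspension of a monomial: each `v` contributes the number
of the factors after it. -/
def nexp : List Gen → ℕ
  | [] => 0
  | g :: l => l.length * g.pv + nexp l

theorem nexp_append (l l' : List Gen) :
    nexp (l ++ l') = nexp l + nexp l' + l'.length * cntV l := by
  induction l with
  | nil => simp [nexp]
  | cons g l ih =>
    simp only [List.cons_append, nexp, ih, List.length_append, cntV_cons]
    ring

theorem sum_mul_pv {n : ℕ} (W : List Gen) (hW : W.length = n) :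
    (∑ s : Fin n, s.val * (W.getD s (Gen.u 1)).pv) + nexp W + cntV W = n * cntV W := by
  subst hW
  induction W with
  | nil => rfl
  | cons g W ih =>
    rw [show (∑ s : Fin (g :: W).length, s.val * ((g :: W).getD s (Gen.u 1)).pv) =
      ∑ s : Fin W.length, (s.val + 1) * (W.getD s (Gen.u 1)).pv from by
        refine (Fin.sum_univ_succ _).trans ?_
        simp]
    simp only [add_mul, Finset.sum_add_distrib, one_mul]
    rw [sum_pv_getD rfl, nexp, cntV_cons, List.length_cons]
    linear_combination ih

theorem cntU_add_cntV (l : List Gen) : cntU l + cntV l = l.length := by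
  induction l with
  | nil => rfl
  | cons g l ih =>
    rw [cntU_cons, cntV_cons, List.length_cons, ← ih]
    cases g <;> simp [Gen.pv, Gen.isU] <;> ring

/-- The total sign of a term of the relations becomes, after desuspension, the Koszul sign for
which only the generators `u` are odd. -/
theorem total_sign (pre : List Gen) (post : List (Bool × Gen)) (g : Gen) {n : ℕ}
    (hn : (pre ++ post.map Prod.snd).length = n)
    (hg : (g.pv : ZMod 2) = cntV (ins post) + (ins post).length) (σ : Equiv.Perm (Fin n))
    (hσ : σ = Tuple.sort (sortKey n pre.length
          (List.replicate pre.length false ++ post.map Prod.fst))) :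
    ((Equiv.Perm.sign σ⁻¹ : ℤˣ) : ℤ) *
      (-1) ^ (pre.length + (ins post).length * (outs post).length) *
      GradedCollection.koszulSign σ⁻¹
        (par n (List.ofFn fun i => (pre ++ post.map Prod.snd).getD (σ i) (Gen.u 1))) *
      (-1) ^ ((ins post).length * cntV pre) *
      (-1) ^ (nexp (pre ++ g :: outs post) + nexp (ins post)) =
    (-1) ^ nexp (pre ++ post.map Prod.snd) * (-1) ^ (cntU pre + inv post) := by
  have hV := ofFn_getD_sort pre post hn
  rw [← hσ] at hV
  have hs := sign_mul_koszulSign σ (pre ++ post.map Prod.snd)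
  have hinv := sum_inversions pre post hn
  rw [← hσ] at hinv
  rw [hinv] at hs
  have h1 := sum_mul_pv _ hn
  have hlen : (pre ++ (ins post ++ outs post)).length = n := by rw [← hV]; simp
  have h2 := sum_mul_pv _ hlen
  have e : (∑ i : Fin n, i.val * ((pre ++ post.map Prod.snd).getD (σ i) (Gen.u 1)).pv) =
      ∑ s : Fin n, s.val * ((pre ++ (ins post ++ outs post)).getD s (Gen.u 1)).pv := by
    rw [← hV]
    refine Finset.sum_congr rfl fun i _ => ?_
    rw [List.getD_eq_getElem (List.ofFn _) _ (by simp), List.getElem_ofFn]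
  have hc : cntV (pre ++ post.map Prod.snd) = cntV (pre ++ (ins post ++ outs post)) := by
    rw [← hV, ← sum_pv_getD hn, ← Equiv.sum_comp σ, cntV, List.map_ofFn, List.sum_ofFn]
    rfl
  rw [e] at hs
  rw [mul_right_comm _ (_ ^ _) (GradedCollection.koszulSign _ _), hs]
  simp only [← pow_add]
  apply neg_one_pow_eq_of_cast
  have hU := congrArg (Nat.cast : ℕ → ZMod 2) (cntU_add_cntV pre)
  have h1' := congrArg (Nat.cast : ℕ → ZMod 2) h1
  have h2' := congrArg (Nat.cast : ℕ → ZMod 2) h2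
  simp only [nexp_append, nexp, cntV_append, List.length_append, List.length_cons, hc] at h1' h2' ⊢
  push_cast only [Nat.cast_add, Nat.cast_mul, Nat.cast_one] at h1' h2' hU hg ⊢
  have two : (2 : ZMod 2) = 0 := rfl
  linear_combination h1' + h2' + ((outs post).length : ZMod 2) * hg - hU +
    (((n : ZMod 2) - 1) * (cntV pre + (cntV (ins post) + cntV (outs post))) -
      (nexp pre + nexp (post.map Prod.snd) + (post.map Prod.snd).length * cntV pre) + (ins post).length * (outs post).length +
      cntV pre) * two


/-! ### The operations in coordinates -/

section

variable (k : Type*) [Field k]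

/-- The indicator function of the generators `u` (for `true`) or `v` (for `false`). -/
def ind (b : Bool) (g : Gen) : k := if g.isU = b then 1 else 0

variable {k}

@[simp] theorem ind_gen (b b' : Bool) (n : ℕ+) : ind k b (gen b' n) = if b' = b then 1 else 0 := by
  simp [ind]

theorem getD_arity {T : PTree} {W : List Gen} (hW : W.map Gen.arity = T.arities)
    (l : Fin T.weight) : (W.getD l (Gen.u 1)).arity = T.arity l := by
  have hl : l.val < W.length := by
    have := congrArg List.length hW
    rw [List.length_map] at this
    rw [this]
    exact l.2
  rw [List.getD_eq_getElem _ _ hl]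
  simp [arity, ← hW]

theorem u_apply (n : ℕ+) {g : Gen} (hg : g.arity = n) : u k n g = ind k true g := by
  subst hg
  cases g <;> simp [u, ind, Gen.isU, Gen.arity]

theorem v_apply (n : ℕ+) {g : Gen} (hg : g.arity = n) : v k n g = ind k false g := by
  subst hg
  cases g <;> simp [v, ind, Gen.isU, Gen.arity]

theorem prod_getD_cons {n : ℕ} (f : ℕ → Gen → k) (g : Gen) (l : List Gen)
    (h : (g :: l).length = n) :
    ∏ i : Fin n, f i ((g :: l).getD i (Gen.u 1)) =
      f 0 g * ∏ i : Fin l.length, f (i + 1) (l.getD i (Gen.u 1)) := by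
  subst h
  exact Fin.prod_univ_succ _

theorem prod_getD (f : Gen → k) (l : List Gen) :
    ∏ i : Fin l.length, f (l.getD i (Gen.u 1)) = (l.map f).prod := by
  rw [← List.prod_ofFn]
  congr 1
  exact List.ext_getElem (by simp) fun i h1 h2 => by simp

theorem length_of_arities {T : PTree} {W : List Gen} (hW : W.map Gen.arity = T.arities) :
    W.length = T.weight := by
  rw [weight, ← hW, List.length_map]

theorem lc_allU {T : PTree} {W : List Gen} (hW : W.map Gen.arity = T.arities) :
    lc k W (allU k T) = (W.map (ind k true)).prod := by
  rw [allU, lc_tprod, ← prod_getD, Finset.prod_congr rfl fun l _ => u_apply _ (getD_arity hW l)]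
  rw [length_of_arities hW]

theorem lc_uAt {T : PTree} {W : List Gen} (hW : W.map Gen.arity = T.arities) (m : ℕ) :
    lc k W (uAt k T m) =
      ∏ l : Fin T.weight, ind k (decide (l.val = m)) (W.getD l (Gen.u 1)) := by
  rw [uAt, lc_tprod]
  refine Finset.prod_congr rfl fun l _ => ?_
  split_ifs with h
  · rw [u_apply _ (getD_arity hW l), decide_eq_true h]
  · rw [v_apply _ (getD_arity hW l), decide_eq_false h]

theorem lc_uAt_zero {T : PTree} {g : Gen} {W : List Gen}
    (hW : (g :: W).map Gen.arity = T.arities) :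
    lc k (g :: W) (uAt k T 0) = ind k true g * (W.map (ind k false)).prod := by
  rw [lc_uAt hW, prod_getD_cons (fun i x => ind k (decide (i = 0)) x) g W (length_of_arities hW),
    ← prod_getD]
  simp

theorem lc_uAt_one {T : PTree} {g h : Gen} {W : List Gen}
    (hW : (g :: h :: W).map Gen.arity = T.arities) :
    lc k (g :: h :: W) (uAt k T 1) =
      ind k false g * (ind k true h * (W.map (ind k false)).prod) := by
  rw [lc_uAt hW, prod_getD_cons (fun i x => ind k (decide (i = 1)) x) g _ (length_of_arities hW),
    prod_getD_cons (fun i x => ind k (decide (i + 1 = 1)) x) h W rfl, ← prod_getD]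
  simp

theorem prod_ind_false (W : List Gen) :
    (W.map (ind k false)).prod = if cntU W = 0 then 1 else 0 := by
  induction W with
  | nil => simp
  | cons g W ih =>
    rw [List.map_cons, List.prod_cons, ih, cntU_cons]
    cases hg : g.isU <;> simp [ind, hg]

/-- A list of `m` generators `v` has the desuspension exponent `m (m - 1) / 2`. -/
theorem nexp_of_cntU {W : List Gen} (h : cntU W = 0) :
    nexp W = W.length * (W.length - 1) / 2 := by
  rw [← Finset.sum_range_id_mul_two, Nat.mul_div_cancel _ two_pos]
  induction W with
  | nil => rfl
  | cons g W ih =>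
    rw [cntU_cons] at h
    have hg : g.pv = 1 := by
      cases hg : g.isU
      · simp [Gen.pv, hg]
      · simp [hg] at h
    rw [nexp, hg, ih (by omega), List.length_cons, Finset.sum_range_succ]
    omega

end

namespace DecTree

/-! ### Shapes of decorated trees -/

/-- The decorated corolla. -/
def corolla (b : Bool) (n : ℕ+) : DecTree := node b n fun _ => leaf

/-- A decorated root with a tree grafted on its leaf `i`. -/
def graft (b : Bool) (a : ℕ+) (i : Fin a) (E : DecTree) : DecTree :=
  node b a (Function.update (fun _ => leaf) i E)

theorem shape_corolla (b : Bool) (n : ℕ+) : (corolla b n).shape = PTree.corolla n := rfl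

theorem shape_graft (b : Bool) (a : ℕ+) (i : Fin a) (E : DecTree) :
    (graft b a i E).shape = PTree.node a (Function.update (fun _ => PTree.leaf) i E.shape) := by
  rw [graft, shape]
  congr 1
  funext j
  rcases eq_or_ne j i with rfl | hj
  · simp
  · simp [Function.update_of_ne hj, shape]

theorem gens_corolla (b : Bool) (n : ℕ+) : (corolla b n).gens = [gen b n] := by
  simp [corolla, gens]

theorem gens_graft (b : Bool) (a : ℕ+) (i : Fin a) (E : DecTree) :
    (graft b a i E).gens = gen b a :: E.gens := by
  have h := flatten_ofFn_split (fun j => gens (Function.update (fun _ => leaf) i E j)) i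
  rw [take_ofFn_congr (g := fun _ => []), drop_ofFn_congr (g := fun _ => [])] at h
  · rw [graft, gens, h]
    simp
  · intro j hj
    rw [Function.update_of_ne (by rintro rfl; omega), gens]
  · intro j hj
    rw [Function.update_of_ne (by rintro rfl; omega), gens]

theorem eq_leaf_of_shape {E : DecTree} (h : E.shape = PTree.leaf) : E = leaf := by
  cases E with
  | leaf => rfl
  | node b n c => exact PTree.noConfusion h

theorem eq_node_of_shape {E : DecTree} {n : ℕ+} {c' : Fin n → PTree}
    (h : E.shape = PTree.node n c') : ∃ b c, E = node b n c ∧ ∀ i, (c i).shape = c' i := by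
  cases E with
  | leaf => exact PTree.noConfusion h
  | node b m c =>
    rw [shape, PTree.node.injEq] at h
    obtain ⟨rfl, h⟩ := h
    exact ⟨b, c, rfl, congrFun (eq_of_heq h)⟩

theorem eq_corolla_of_shape {E : DecTree} {n : ℕ+} (h : E.shape = PTree.corolla n) :
    ∃ b, E = corolla b n := by
  obtain ⟨b, c, rfl, hc⟩ := eq_node_of_shape h
  exact ⟨b, congrArg (node b n) (funext fun i => eq_leaf_of_shape (hc i))⟩

theorem eq_graft_of_shape {E : DecTree} {a : ℕ+} {i : Fin a} {T : PTree}
    (h : E.shape = PTree.node a (Function.update (fun _ => PTree.leaf) i T)) :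
    ∃ b E', E = graft b a i E' ∧ E'.shape = T := by
  obtain ⟨b, c, rfl, hc⟩ := eq_node_of_shape h
  refine ⟨b, c i, congrArg (node b a) (funext fun j => ?_), by simpa using hc i⟩
  rcases eq_or_ne j i with rfl | hj
  · simp
  · rw [Function.update_of_ne hj]
    exact eq_leaf_of_shape ((hc j).trans (Function.update_of_ne hj _ _))

section

variable {R : Type*} [CommRing R]

theorem eq_corolla_of_cor_ne_zero {b : Bool} {E : DecTree} (h : cor R b E ≠ 0) :
    ∃ n, E = corolla b n := eq_of_cor_ne_zero h

theorem lf_corolla (b : Bool) (n : ℕ+) : lf R (corolla b n) = 0 := rfl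

theorem der_graft (γ : DecTree → R) {a : ℕ+} (i : Fin a) {E : DecTree} (hE : lf R E = 0) :
    der γ (List.ofFn (Function.update (fun _ => leaf) i E)) = γ E := by
  rw [der_ofFn_update _ _ _ hE]
  simp

/-- If the derivation-like extension does not vanish, there is only one branch. -/
theorem eq_graft_of_der_ne_zero {γ : DecTree → R} {b : Bool} {n : ℕ+} {c : Fin n → DecTree}
    (h : der γ (List.ofFn c) ≠ 0) : ∃ i, node b n c = graft b n i (c i) ∧ γ (c i) ≠ 0 := by
  rw [der_ofFn] at h
  obtain ⟨i, _, hi⟩ := Finset.exists_ne_zero_of_sum_ne_zero h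
  refine ⟨i, congrArg (node b n) (funext fun j => ?_), left_ne_zero_of_mul hi⟩
  rcases eq_or_ne j i with rfl | hj
  · simp
  · rw [Function.update_of_ne hj]
    exact eq_leaf_of_lf_ne_zero fun h0 => right_ne_zero_of_mul hi
      (Finset.prod_eq_zero (Finset.mem_erase.2 ⟨hj, Finset.mem_univ j⟩) h0)

/-- The product of the indicator functions of the corollas `v` over the inputs of a root that
carries one tree. -/
theorem prod_cor_graft {a : ℕ+} (i : Fin a) (E : DecTree) :
    ∏ j, cor R false (Function.update (fun _ => leaf) i E j) =
      if a = 1 then cor R false E else 0 := by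
  split_ifs with ha
  · subst ha
    have : Subsingleton (Fin ((1 : ℕ+) : ℕ)) := inferInstanceAs (Subsingleton (Fin 1))
    rw [Fintype.prod_eq_single i fun j hj => absurd (Subsingleton.elim j i) hj,
      Function.update_self]
  · have : 1 < (a : ℕ) := by
      have h1 := a.pos
      have h2 : (a : ℕ) ≠ 1 := fun h => ha (PNat.eq h)
      omega
    have : Nontrivial (Fin (a : ℕ)) := Fin.nontrivial_iff_two_le.2 this
    obtain ⟨j, hj⟩ := exists_ne i
    refine Finset.prod_eq_zero (Finset.mem_univ j) ?_
    rw [Function.update_of_ne hj, cor_leaf]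

end

section

variable {k : Type*} [Field k]

/-- `E` has at most one vertex. -/
def IsSmall (E : DecTree) : Prop := E = leaf ∨ ∃ b n, E = corolla b n

theorem length_gens_flatten_le {l : List DecTree} (hl : ∀ E ∈ l, IsSmall E) :
    ((l.map gens).flatten).length ≤ l.length := by
  induction l with
  | nil => simp
  | cons E l ih =>
    have h := ih fun E hE => hl E (List.mem_cons_of_mem _ hE)
    rcases hl E List.mem_cons_self with rfl | ⟨b, n, rfl⟩
    · simpa [gens] using h.trans (Nat.le_succ _)
    · simpa [gens_corolla] using h

theorem prod_lv_of_isSmall (lam : k) {l : List DecTree} (hl : ∀ E ∈ l, IsSmall E) :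
    ((l.map (lv k)).map fun y => y.2 + lam * y.1).prod =
      lam ^ (l.length - ((l.map gens).flatten).length) *
        (((l.map gens).flatten).map (ind k false)).prod := by
  induction l with
  | nil => simp
  | cons E l ih =>
    have hl' := fun E hE => hl E (List.mem_cons_of_mem _ hE)
    have h := length_gens_flatten_le hl'
    rw [List.map_cons, List.map_cons, List.prod_cons, ih hl']
    rcases hl E List.mem_cons_self with rfl | ⟨b, n, rfl⟩
    · simp only [lv, lf_leaf, cor_leaf, List.map_cons, gens, List.flatten_cons, List.nil_append,
        List.length_cons, Nat.succ_sub h, pow_succ]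
      ring
    · simp only [lv, lf_corolla, List.map_cons, gens_corolla, List.flatten_cons,
        List.singleton_append, List.length_cons, Nat.add_sub_add_right, List.prod_cons, ind_gen]
      rw [corolla, cor_corolla]
      ring

theorem quo_of_isSmall (lam : k) {l : List DecTree} (hl : ∀ E ∈ l, IsSmall E) :
    quo lam (l.map (lv k)) = if ((l.map gens).flatten).length < l.length then
      lam ^ (l.length - ((l.map gens).flatten).length - 1) *
        (((l.map gens).flatten).map (ind k false)).prod else 0 := by
  induction l with
  | nil => simp [quo]
  | cons E l ih =>
    have hl' := fun E hE => hl E (List.mem_cons_of_mem _ hE)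
    have h := length_gens_flatten_le hl'
    rw [List.map_cons, quo, ih hl', prod_lv_of_isSmall lam hl']
    rcases hl E List.mem_cons_self with rfl | ⟨b, n, rfl⟩
    · rw [if_pos (show (((leaf :: l).map gens).flatten).length < (leaf :: l).length by
        simpa [gens] using Nat.lt_succ_of_le h)]
      simp only [lv, lf_leaf, cor_leaf, List.map_cons, gens, List.flatten_cons, List.nil_append,
        List.length_cons, Nat.succ_sub h, Nat.succ_sub_one]
      ring
    · simp only [lv, lf_corolla, List.map_cons, gens_corolla, List.flatten_cons,
        List.singleton_append, List.length_cons, Nat.add_sub_add_right, List.prod_cons, ind_gen,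
        Nat.add_lt_add_iff_right]
      rw [corolla, cor_corolla]
      split_ifs <;> ring

theorem isSmall_of_quo_ne_zero {lam : k} {l : List DecTree} (h : quo lam (l.map (lv k)) ≠ 0) :
    ∀ E ∈ l, IsSmall E := by
  intro E hE
  rcases ne_zero_of_quo_ne_zero h _ (List.mem_map_of_mem hE) with h1 | h1
  · exact Or.inl (eq_leaf_of_lf_ne_zero h1)
  · obtain ⟨n, rfl⟩ := eq_corolla_of_cor_ne_zero h1
    exact Or.inr ⟨false, n, rfl⟩

end

end DecTree


theorem _root_.PTree.leaves_graft (a : ℕ+) (i : Fin a) (T : PTree) :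
    (PTree.node a (Function.update (fun _ => PTree.leaf) i T)).leaves + 1 = a + T.leaves := by
  rw [leaves, ← Finset.add_sum_erase _ _ (Finset.mem_univ i), Function.update_self,
    Finset.sum_congr rfl (g := fun _ => 1), Finset.sum_const, Finset.card_erase_of_mem
      (Finset.mem_univ i), Finset.card_univ, Fintype.card_fin, smul_eq_mul, mul_one]
  · have := a.pos
    omega
  · intro j hj
    rw [Function.update_of_ne (Finset.ne_of_mem_erase hj), leaves]

theorem _root_.PTree.leaves_corolla (n : ℕ+) : (PTree.corolla n).leaves = n := by
  simp [PTree.corolla, leaves]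

namespace DecTree

theorem gens_two (b b' : Bool) (a j : ℕ+) (i : Fin a) :
    (graft b a i (corolla b' j)).gens = [gen b a, gen b' j] := by
  rw [gens_graft, gens_corolla]

theorem secondArity_eq {E : DecTree} {g h : Gen} {W : List Gen} (hE : E.gens = g :: h :: W) :
    secondArity E.shape = h.arity := by
  rw [secondArity, ← map_arity_gens, hE]
  rfl

theorem isTypeI_graft_corolla (b b' : Bool) (a j : ℕ+) (i : Fin a) :
    IsTypeI (graft b a i (corolla b' j)).shape := ⟨a, i, j, shape_graft _ _ _ _⟩

theorem eq_of_isTypeI {E : DecTree} (h : IsTypeI E.shape) :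
    ∃ b b' a j i, E = graft b a i (corolla b' j) := by
  obtain ⟨a, i, j, h⟩ := h
  obtain ⟨b, E', rfl, h'⟩ := eq_graft_of_shape h
  obtain ⟨b', rfl⟩ := eq_corolla_of_shape h'
  exact ⟨b, b', a, j, i, rfl⟩

/-- A root each input of which carries a corolla. -/
def level (b : Bool) (m : ℕ+) (β : Fin m → Bool) (r : Fin m → ℕ+) : DecTree :=
  node b m fun t => corolla (β t) (r t)

theorem eq_of_isTypeII {E : DecTree} (h : IsTypeII E.shape) :
    ∃ b m β r, 2 ≤ m ∧ E = level b m β r := by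
  obtain ⟨m, r, hm, h⟩ := h
  obtain ⟨b, c, rfl, hc⟩ := eq_node_of_shape h
  choose β hβ using fun t => eq_corolla_of_shape (hc t)
  exact ⟨b, m, β, r, hm, congrArg (node b m) (funext hβ)⟩

theorem eq_of_isTypeIII {E : DecTree} (h : IsTypeIII E.shape) :
    ∃ b b' a i p d, E = graft b a i (node b' p d) ∧ (∀ t, IsSmall (d t)) ∧
      (∃ t, d t ≠ leaf) ∧ ∃ t, d t = leaf := by
  classical
  obtain ⟨a, i, p, K, r, ⟨t, ht⟩, hK, h⟩ := h
  obtain ⟨b, E', rfl, h'⟩ := eq_graft_of_shape h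
  obtain ⟨b', d, rfl, hd⟩ := eq_node_of_shape h'
  refine ⟨b, b', a, i, p, d, rfl, fun t => ?_, ⟨t, fun h0 => ?_⟩, ?_⟩
  · have := hd t
    split_ifs at this
    · obtain ⟨β, hβ⟩ := eq_corolla_of_shape this
      exact Or.inr ⟨β, _, hβ⟩
    · exact Or.inl (eq_leaf_of_shape this)
  · have := hd t
    rw [if_pos ht, h0] at this
    exact PTree.noConfusion this
  · obtain ⟨t, ht⟩ : ∃ t, t ∉ K := by
      by_contra! h0
      rw [Finset.eq_univ_iff_forall.2 h0, Finset.card_univ, Fintype.card_fin] at hK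
      exact lt_irrefl _ hK
    have := hd t
    rw [if_neg ht] at this
    exact ⟨t, eq_leaf_of_shape this⟩

theorem isTypeIII_graft {b b' : Bool} {a p : ℕ+} {i : Fin a} {d : Fin p → DecTree}
    (hd : ∀ t, IsSmall (d t)) (h1 : ∃ t, d t ≠ leaf) (h2 : ∃ t, d t = leaf) :
    IsTypeIII (graft b a i (node b' p d)).shape := by
  classical
  obtain ⟨t1, h1⟩ := h1
  obtain ⟨t2, h2⟩ := h2
  have hr : ∀ t, ∃ n : ℕ+, d t ≠ leaf → (d t).shape = PTree.corolla n := by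
    intro t
    rcases hd t with h | ⟨β, n, h⟩
    · exact ⟨1, fun h' => absurd h h'⟩
    · exact ⟨n, fun _ => by rw [h, shape_corolla]⟩
  choose r hr using hr
  refine ⟨a, i, p, Finset.univ.filter fun t => d t ≠ leaf, r, ⟨t1, by simpa using h1⟩, ?_, ?_⟩
  · have : Finset.univ.filter (fun t => d t ≠ leaf) ⊂ Finset.univ :=
      Finset.filter_ssubset.2 ⟨t2, Finset.mem_univ _, by simpa using h2⟩
    simpa using Finset.card_lt_card this
  · rw [shape_graft, shape]
    congr 3
    funext t
    by_cases ht : d t = leaf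
    · simp [ht, shape]
    · simp [ht, hr t ht]

section

variable {k : Type*} [Field k]

theorem lc_ΔU (E : DecTree) : lc k E.gens (ΔU E.shape) = (-1) ^ nexp E.gens * wtU E := by
  by_cases hI : IsTypeI E.shape
  · rw [ΔU, if_pos hI, lc_allU (map_arity_gens E)]
    obtain ⟨b, b', a, j, i, rfl⟩ := eq_of_isTypeI hI
    rw [gens_two]
    cases b
    · simp [graft]
    · rw [graft, wtU_node_true, der_graft _ _ (lf_corolla _ _), corolla, cor_corolla]
      cases b' <;> simp [nexp, gen, Gen.pv, Gen.isU, ind]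
  · rw [ΔU, if_neg hI, map_zero]
    symm
    by_contra hne
    have hw := right_ne_zero_of_mul hne
    rcases E with _ | ⟨_ | _, n, c⟩
    · exact hw rfl
    · exact hw rfl
    · rw [wtU_node_true] at hw
      obtain ⟨i, h, hc⟩ := eq_graft_of_der_ne_zero (b := true) hw
      obtain ⟨j, hj⟩ := eq_corolla_of_cor_ne_zero hc
      rw [h, hj] at hI
      exact hI (isTypeI_graft_corolla _ _ _ _ _)

theorem quo_leaves (lam : k) (p : ℕ+) :
    quo lam ((List.ofFn fun _ : Fin p => leaf).map (lv k)) = lam ^ ((p : ℕ) - 1) := by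
  rw [quo_of_isSmall lam]
  · have : ((List.ofFn fun _ : Fin p => leaf).map gens).flatten = [] := by
      simp [gens]
    rw [this]
    simp
  · intro E hE
    obtain ⟨_, rfl⟩ := List.mem_ofFn.1 hE
    exact Or.inl rfl

theorem lc_ΔV_of_isTypeI (lam : k) {E : DecTree} (hI : IsTypeI E.shape) :
    lc k E.gens (ΔV lam E.shape) = (-1) ^ nexp E.gens * wtV lam E := by
  rw [ΔV, if_pos hI]
  obtain ⟨b, b', a, j, i, rfl⟩ := eq_of_isTypeI hI
  have har := map_arity_gens (graft b a i (corolla b' j))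
  have hl := leaves_graft a i (corolla b' j).shape
  rw [← shape_graft b, shape_corolla, leaves_corolla] at hl
  have hs := secondArity_eq (gens_two b b' a j i)
  rw [arity_gen] at hs
  rw [gens_two] at har ⊢
  have h0 := lc_uAt_zero (k := k) har
  have h1 := lc_uAt_one (k := k) har
  have hw : wtV lam (graft b a i (corolla b' j)) =
      if b then (if a = 1 then (if b' = false then 1 else 0) else 0)
      else -(if b' then lam ^ ((j : ℕ) - 1) else 0) := by
    cases b
    · rw [graft, wtV_node_false, der_graft _ _ (lf_corolla _ _)]
      cases b'
      · simp [corolla]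
      · rw [corolla, gw_node_true, quo_leaves]
        simp
    · rw [graft, wtV_node_true, prod_cor_graft, corolla, cor_corolla]
      simp
  have hj := j.pos
  rw [hs, hw]
  by_cases ha : a = 1
  · subst ha
    have : (graft b 1 i (corolla b' j)).shape.leaves = j := by
      simpa [add_comm] using hl
    rw [this, if_pos rfl, map_add, map_smul, h0, h1]
    cases b <;> cases b' <;> simp [nexp, gen, Gen.pv, Gen.isU, ind]
  · have : (j : ℕ) ≠ (graft b a i (corolla b' j)).shape.leaves := by
      intro h
      rw [← h] at hl
      exact ha (PNat.eq (by simpa using (by omega : (a : ℕ) = 1)))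
    rw [if_neg this, map_smul, h1]
    cases b <;> cases b' <;> simp [nexp, gen, Gen.pv, Gen.isU, ind, ha]

theorem lc_ΔV_of_isTypeII (lam : k) {E : DecTree} (hI : ¬ IsTypeI E.shape)
    (hII : IsTypeII E.shape) :
    lc k E.gens (ΔV lam E.shape) = (-1) ^ nexp E.gens * wtV lam E := by
  rw [ΔV, if_neg hI, if_pos hII]
  obtain ⟨b, m, β, r, hm, rfl⟩ := eq_of_isTypeII hII
  have hg : (level b m β r).gens = gen b m :: List.ofFn fun t => gen (β t) (r t) := by
    rw [level, gens]
    simp only [gens_corolla]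
    rw [flatten_ofFn_singleton]
  have hw : (level b m β r).shape.weight = m + 1 := by
    rw [← length_gens, hg]
    simp
  have har := map_arity_gens (level b m β r)
  rw [hg] at har ⊢
  dsimp only
  rw [map_smul, lc_uAt_zero har, hw, Nat.add_sub_cancel, smul_eq_mul, ind_gen]
  cases b
  · rw [level, wtV_node_false]
    have : der (gw lam) (List.ofFn fun t => corolla (β t) (r t)) = 0 := by
      by_contra hne
      obtain ⟨i, h, -⟩ := eq_graft_of_der_ne_zero (b := false) hne
      have : Nontrivial (Fin (m : ℕ)) := Fin.nontrivial_iff_two_le.2 hm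
      obtain ⟨j, hj⟩ := exists_ne i
      rw [graft, DecTree.node.injEq] at h
      have := congrFun (eq_of_heq h.2.2) j
      rw [Function.update_of_ne hj] at this
      exact DecTree.noConfusion this
    simp [this]
  · rw [level, wtV_node_true]
    have hp : ∏ t, cor k false (corolla (β t) (r t)) =
        ((List.ofFn fun t => gen (β t) (r t)).map (ind k false)).prod := by
      rw [List.map_ofFn, List.prod_ofFn]
      refine Finset.prod_congr rfl fun t _ => ?_
      rw [corolla, cor_corolla, Function.comp, ind_gen]
    rw [hp, prod_ind_false]
    by_cases h0 : cntU (List.ofFn fun t => gen (β t) (r t)) = 0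
    · rw [nexp, nexp_of_cntU h0]
      simp [gen, Gen.pv, Gen.isU]
    · simp [h0]

/-- Desuspension turns the sign `(-1)^{q(q-1)/2}` of the trees of type (III) into the sign `-1` of
`wtV`. -/
theorem nexp_typeIII (p : ℕ+) (r : ℕ+) {W : List Gen} (hW : cntU W = 0) :
    (-1 : k) ^ nexp (gen false r :: gen true p :: W) =
      -(-1) ^ ((W.length + 1) * (W.length + 1 - 1) / 2) := by
  rw [nexp, nexp, nexp_of_cntU hW, ← Finset.sum_range_id_mul_two, ← Finset.sum_range_id_mul_two,
    Nat.mul_div_cancel _ two_pos, Nat.mul_div_cancel _ two_pos, Finset.sum_range_succ,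
    List.length_cons]
  simp [gen, Gen.pv, Gen.isU, pow_add]
  ring

theorem lc_ΔV_of_isTypeIII (lam : k) {E : DecTree} (hI : ¬ IsTypeI E.shape)
    (hII : ¬ IsTypeII E.shape) (hIII : IsTypeIII E.shape) :
    lc k E.gens (ΔV lam E.shape) = (-1) ^ nexp E.gens * wtV lam E := by
  rw [ΔV, if_neg hI, if_neg hII, if_pos hIII]
  obtain ⟨b, b', a, i, p, d, rfl, hd, ⟨t1, h1⟩, t2, h2⟩ := eq_of_isTypeIII hIII
  set W := ((List.ofFn d).map gens).flatten with hWdef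
  have hg : (graft b a i (node b' p d)).gens = gen b a :: gen b' p :: W := by
    rw [gens_graft, gens, hWdef, List.map_ofFn]
    rfl
  have hw : (graft b a i (node b' p d)).shape.weight = W.length + 2 := by
    rw [← length_gens, hg]
    simp
  have hsm : ∀ E ∈ List.ofFn d, IsSmall E := by
    intro E hE
    obtain ⟨t, rfl⟩ := List.mem_ofFn.1 hE
    exact hd t
  have hs := secondArity_eq hg
  rw [arity_gen] at hs
  have hlt : W.length < p := by
    refine lt_of_le_of_ne
      ((length_gens_flatten_le hsm).trans_eq List.length_ofFn) fun he => ?_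
    have hsum : W.length = ∑ t, (gens (d t)).length := by
      simp [hWdef, List.length_flatten, List.map_ofFn, List.sum_ofFn]
    have hle : ∀ t ∈ Finset.univ, (gens (d t)).length ≤ 1 := by
      intro t _
      rcases hd t with h | ⟨_, _, h⟩
      · simp [h, gens]
      · simp [h, gens_corolla]
    have := Finset.sum_lt_sum hle ⟨t2, Finset.mem_univ _, by simp [h2, gens]⟩
    simp at this
    omega
  have har := map_arity_gens (graft b a i (node b' p d))
  rw [hg] at har ⊢
  dsimp only
  rw [map_smul, lc_uAt_one har, hw, hs, smul_eq_mul, ind_gen, ind_gen]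
  cases b
  · rw [graft, wtV_node_false, der_graft _ _ (lf_node _ _ _)]
    cases b'
    · simp
    · rw [gw_node_true, quo_of_isSmall lam hsm, ← hWdef, List.length_ofFn, if_pos hlt,
        prod_ind_false]
      by_cases h0 : cntU W = 0
      · rw [nexp_typeIII p a h0]
        have e : (p : ℕ) - (W.length + 2 - 1) = p - W.length - 1 := by omega
        rw [e]
        simp [h0]
      · simp [h0]
  · rw [graft, wtV_node_true, prod_cor_graft]
    have : cor k false (node b' p d) = 0 := by
      rw [cor_node]
      split_ifs
      · refine Finset.prod_eq_zero (Finset.mem_univ t1) ?_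
        by_contra h
        exact h1 (eq_leaf_of_lf_ne_zero h)
      · rfl
    simp [this]

theorem wtV_eq_zero (lam : k) {E : DecTree} (hI : ¬ IsTypeI E.shape)
    (hII : ¬ IsTypeII E.shape) (hIII : ¬ IsTypeIII E.shape) : wtV lam E = 0 := by
  by_contra! hw
  rcases E with _ | ⟨_ | _, n, c⟩
  · exact hw rfl
  · rw [wtV_node_false, neg_ne_zero] at hw
    obtain ⟨i, h, hc⟩ := eq_graft_of_der_ne_zero (b := false) hw
    rw [h] at hI hIII
    rcases hE : c i with _ | ⟨_ | _, p, d⟩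
    · exact hc (by rw [hE]; rfl)
    · exact hc (by rw [hE]; rfl)
    · rw [hE] at hc hI hIII
      rw [gw_node_true] at hc
      have hsm := isSmall_of_quo_ne_zero hc
      have hd : ∀ t, IsSmall (d t) := fun t => hsm _ (List.mem_ofFn.2 ⟨t, rfl⟩)
      by_cases h1 : ∃ t, d t ≠ leaf
      · by_cases h2 : ∃ t, d t = leaf
        · exact hIII (isTypeIII_graft hd h1 h2)
        · refine hc ?_
          rw [quo_of_isSmall lam hsm, if_neg]
          rw [List.length_flatten, List.map_map, List.map_ofFn, List.sum_ofFn, List.length_ofFn,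
            Finset.sum_congr rfl (g := fun _ => 1)]
          · simp
          · intro t _
            rcases hd t with h | ⟨_, _, h⟩
            · exact absurd ⟨t, h⟩ h2
            · simp [h, gens_corolla]
      · push Not at h1
        obtain rfl : d = fun _ => leaf := funext h1
        exact hI (isTypeI_graft_corolla false true n p i)
  · rw [wtV_node_true, Finset.prod_ne_zero_iff] at hw
    choose r hr using fun t => eq_corolla_of_cor_ne_zero (hw t (Finset.mem_univ t))
    obtain rfl : c = fun t => corolla false (r t) := funext hr
    by_cases hn : 2 ≤ n
    · exact hII ⟨n, r, hn, rfl⟩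
    · obtain rfl : n = 1 := le_antisymm (PNat.lt_add_one_iff.1 (not_le.1 hn)) one_le
      have : (node true 1 fun t => corolla false (r t)) =
          graft true 1 ⟨0, PNat.pos 1⟩ (corolla false (r ⟨0, PNat.pos 1⟩)) := by
        refine congrArg (node true 1) (funext fun t => ?_)
        obtain rfl : t = ⟨0, PNat.pos 1⟩ := Fin.ext (Nat.lt_one_iff.1 t.2)
        exact (Function.update_self (f := fun _ => leaf) _ _).symm
      rw [this] at hI
      exact hI (isTypeI_graft_corolla _ _ _ _ _)

theorem lc_ΔV (lam : k) (E : DecTree) :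
    lc k E.gens (ΔV lam E.shape) = (-1) ^ nexp E.gens * wtV lam E := by
  by_cases hI : IsTypeI E.shape
  · exact lc_ΔV_of_isTypeI lam hI
  · by_cases hII : IsTypeII E.shape
    · exact lc_ΔV_of_isTypeII lam hI hII
    · by_cases hIII : IsTypeIII E.shape
      · exact lc_ΔV_of_isTypeIII lam hI hII hIII
      · rw [wtV_eq_zero lam hI hII hIII, ΔV, if_neg hI, if_neg hII, if_neg hIII, map_zero,
          mul_zero]

/-- The coordinates of the operations are the weights, up to the sign of desuspension. -/
theorem lc_Δ (lam : k) (E : DecTree) (b : Bool) {n : ℕ+} (hn : (n : ℕ) = E.shape.leaves) :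
    lc k E.gens (Δ lam E.shape (Finsupp.single (gen b n) 1)) =
      (-1) ^ nexp E.gens * wt lam b E := by
  rw [Δ, Finsupp.linearCombination_single, one_smul, arity_gen, if_pos hn, wt]
  cases b
  · exact lc_ΔV lam E
  · exact lc_ΔU E

/-- Modulo two, `Δ_T` has the degree `ω(T)`: a decorated tree that occurs in `Δ_T(u_m)` has two
vertices decorated by `u`, and one that occurs in `Δ_T(v_m)` has one. -/
theorem pv_eq_of_wt_ne_zero (lam : k) (b : Bool) (m : ℕ+) {E : DecTree} (h : wt lam b E ≠ 0) :
    ((gen b m).pv : ZMod 2) = cntV E.gens + E.gens.length := by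
  have key : ((gen b m).pv : ZMod 2) = numU E := by
    have hder : ∀ {γ : DecTree → k}, UnaryRoot γ → ∀ {b} {n : ℕ+} {c : Fin n → DecTree},
        der γ (List.ofFn c) ≠ 0 → numU (node b n c) = (if b then 1 else 0) + 1 := by
      intro γ hγ b n c h
      rw [der_ofFn] at h
      obtain ⟨i, _, hi⟩ := Finset.exists_ne_zero_of_sum_ne_zero h
      rw [numU_node, Finset.sum_eq_single i]
      · rw [(hγ _ (left_ne_zero_of_mul hi)).2]
      · intro j _ hj
        exact numU_eq_zero_of_lf fun h0 => right_ne_zero_of_mul hi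
          (Finset.prod_eq_zero (Finset.mem_erase.2 ⟨hj, Finset.mem_univ j⟩) h0)
      · simp
    cases b
    · rw [wt, if_neg (by simp)] at h
      rcases E with _ | ⟨_ | _, n, c⟩
      · exact absurd rfl h
      · rw [wtV_node_false, neg_ne_zero] at h
        rw [hder (unaryRoot_gw lam) h]
        simp [gen, Gen.pv, Gen.isU]
      · rw [wtV_node_true, Finset.prod_ne_zero_iff] at h
        rw [numU_node, Finset.sum_eq_zero fun i hi => numU_eq_zero_of_cor (h i hi)]
        simp [gen, Gen.pv, Gen.isU]
    · rw [wt, if_pos rfl] at h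
      rcases E with _ | ⟨_ | _, n, c⟩
      · exact absurd rfl h
      · exact absurd rfl h
      · rw [wtU_node_true] at h
        rw [hder unaryRoot_cor h]
        rw [show (gen true m).pv = 0 from rfl]
        rfl
  rw [key, ← cntU_add_cntV, numU]
  push_cast
  have two : (2 : ZMod 2) = 0 := rfl
  linear_combination -(cntV E.gens : ZMod 2) * two

end

end DecTree


/-! ### The relations -/

theorem _root_.PTree.leaves_pos (T : PTree) : 0 < T.leaves := by
  induction T with
  | leaf => exact one_pos
  | node n c ih =>
    rw [leaves]
    exact Finset.sum_pos (fun i _ => ih i) ⟨⟨0, n.pos⟩, Finset.mem_univ _⟩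

theorem _root_.PTree.leaves_node (n : ℕ+) (c : Fin n → PTree) :
    (PTree.node n c).leaves = ∑ i, (c i).leaves := by rw [leaves]

theorem _root_.PTree.leaves_ofBranches {l : List PTree} (hl : l ≠ []) :
    (PTree.ofBranches l).leaves = (l.map leaves).sum := by
  obtain ⟨m, hm⟩ : ∃ m : ℕ+, l.length = m := ⟨⟨_, List.length_pos_iff.2 hl⟩, rfl⟩
  rw [PTree.ofBranches_eq hm, leaves_node, ← List.sum_ofFn]
  congr 1
  exact List.ext_getElem (by simp [hm]) fun i h1 h2 => by simp

theorem _root_.PTree.sum_leaves_branches (T : PTree) (r : RootSub T) :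
    ((RootSub.branches T r).map leaves).sum = T.leaves := by
  induction T with
  | leaf => exact Empty.elim r
  | node n c ih =>
    rw [RootSub.branches, leaves, List.map_flatten, List.sum_flatten, List.map_ofFn,
      List.map_ofFn, List.sum_ofFn]
    refine Finset.sum_congr rfl fun i _ => ?_
    rcases h : r i with _ | s
    · simp [h]
    · simpa [h] using ih i s

theorem _root_.PTree.leaves_quotient (T : PTree) (s : Sub T) :
    (Sub.quotient T s).leaves = T.leaves := by
  induction T with
  | leaf => exact Empty.elim s
  | node n c ih =>
    rcases s with r | ⟨i, s⟩
    · rw [Sub.quotient, leaves_ofBranches (RootSub.branches_ne_nil _ r), sum_leaves_branches]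
    · rw [Sub.quotient, leaves, leaves]
      refine Finset.sum_congr rfl fun j _ => ?_
      rcases eq_or_ne j i with rfl | hj
      · rw [Function.update_self, ih]
      · rw [Function.update_of_ne hj]

/-- A list whose image is a concatenation is a concatenation. -/
theorem exists_flatten_of_map {α β : Type*} (f : α → β) {n : ℕ} (L : Fin n → List β) (W : List α)
    (h : W.map f = (List.ofFn L).flatten) :
    ∃ Ws : Fin n → List α, W = (List.ofFn Ws).flatten ∧ ∀ i, (Ws i).map f = L i := by
  induction n generalizing W with
  | zero => exact ⟨fun _ => [], by simpa using h, fun i => i.elim0⟩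
  | succ n ih =>
    rw [List.ofFn_succ, List.flatten_cons, List.map_eq_append_iff] at h
    obtain ⟨W1, W2, rfl, h1, h2⟩ := h
    obtain ⟨Ws, rfl, hWs⟩ := ih _ W2 h2
    refine ⟨Fin.cons W1 Ws, by simp [List.ofFn_succ], Fin.cases (by simpa using h1) ?_⟩
    intro i
    simpa using hWs i

/-- Decorated trees of a given shape are the same as lists of generators of the right arities. -/
theorem DecTree.exists_of_arities (T : PTree) (W : List Gen)
    (hW : W.map Gen.arity = T.arities) : ∃ E : DecTree, E.shape = T ∧ E.gens = W := by
  induction T generalizing W with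
  | leaf =>
    obtain rfl : W = [] := by simpa [arities] using hW
    exact ⟨leaf, rfl, rfl⟩
  | node n c ih =>
    rcases W with _ | ⟨g, W⟩
    · simp [arities] at hW
    · rw [arities, List.map_cons, List.cons.injEq] at hW
      obtain ⟨hg, hW⟩ := hW
      obtain ⟨Ws, rfl, hWs⟩ := exists_flatten_of_map _ _ _ hW
      choose c' h1 h2 using fun i => ih i (Ws i) (hWs i)
      refine ⟨node g.isU n c', ?_, ?_⟩
      · rw [shape]
        exact congrArg _ (funext h1)
      · subst hg
        rw [gens, gen_isU_arity]
        simp only [h2]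

section

variable {k : Type*} [Field k]

variable (k) in
/-- The subspace `C^{⊗T}`, spanned by the basis tensors whose entries have the arities of the
vertices of `T`. -/
noncomputable def treeSpan (T : PTree) : Submodule k (⨂[k]^T.weight (Space k)) :=
  Submodule.span k {x | ∃ Y : List Gen, Y.map Gen.arity = T.arities ∧ x = tg k T.weight Y}

theorem tprod_mem_treeSpan (T : PTree) (y : Fin T.weight → Gen)
    (hy : ∀ i, (y i).arity = T.arity i) :
    PiTensorProduct.tprod k (fun i => (Finsupp.single (y i) 1 : Space k)) ∈ treeSpan k T := by
  refine Submodule.subset_span ⟨List.ofFn y, ?_, tprod_eq_tg y⟩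
  refine List.ext_getElem (by rw [List.length_map, List.length_ofFn]; rfl) fun i h1 h2 => ?_
  simp [hy, arity]

theorem uAt_mem_treeSpan (T : PTree) (m : ℕ) : uAt k T m ∈ treeSpan k T := by
  have : uAt k T m = PiTensorProduct.tprod k fun l : Fin T.weight =>
      (Finsupp.single (gen (decide (l.val = m)) (T.arity l)) 1 : Space k) := by
    rw [uAt]
    congr 1
    funext l
    by_cases h : l.val = m <;> simp [h, gen, u, v]
  rw [this]
  exact tprod_mem_treeSpan T _ fun i => by simp

theorem allU_mem_treeSpan (T : PTree) : allU k T ∈ treeSpan k T :=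
  tprod_mem_treeSpan T _ fun _ => rfl

theorem Δ_mem_treeSpan (lam : k) (T : PTree) (x : Space k) : Δ lam T x ∈ treeSpan k T := by
  rw [Δ, Finsupp.linearCombination_apply]
  refine Submodule.sum_mem _ fun g _ => Submodule.smul_mem _ _ ?_
  split_ifs
  · rcases g with n | n
    · change ΔU T ∈ _
      rw [ΔU]
      split_ifs
      · exact allU_mem_treeSpan T
      · exact Submodule.zero_mem _
    · change ΔV lam T ∈ _
      have h := fun c m => Submodule.smul_mem _ (c : k) (uAt_mem_treeSpan (k := k) T m)
      rw [ΔV]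
      dsimp only
      split_ifs
      · exact Submodule.add_mem _ (h _ _) (uAt_mem_treeSpan T 0)
      · exact h _ _
      · exact h _ _
      · exact h _ _
      · exact Submodule.zero_mem _
  · exact Submodule.zero_mem _

/-- Coordinates with the wrong arities vanish. -/
theorem map_arity_of_lc_ne_zero {T : PTree} {x : ⨂[k]^T.weight (Space k)}
    (hx : x ∈ treeSpan k T) {W : List Gen} (hW : W.length = T.weight) (h : lc k W x ≠ 0) :
    W.map Gen.arity = T.arities := by
  classical
  by_contra hne
  refine h ?_
  induction hx using Submodule.span_induction with
  | mem x hx =>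
    obtain ⟨Y, hY, rfl⟩ := hx
    rw [lc_tg hW (length_of_arities hY), if_neg]
    rintro rfl
    exact hne hY
  | zero => simp
  | add x y _ _ hx hy =>
    rw [map_add]
    by_cases h1 : lc k W x = 0
    · by_cases h2 : lc k W y = 0
      · rw [h1, h2, add_zero]
      · exact absurd (hy h2) h2
    · exact absurd (hx h1) h1
  | smul c x _ hx =>
    rw [map_smul]
    by_cases h1 : lc k W x = 0
    · rw [h1, smul_zero]
    · exact absurd (hx h1) h1

theorem tg_cast {n m : ℕ} (h : n = m) (Y : List Gen) :
    TensorPower.cast k (Space k) h (tg k n Y) = tg k m Y := by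
  subst h
  simp

namespace DecTree

/-- The coordinates of `(id ⊗ Δ_{T'} ⊗ id) ∘ Δ_{T/T'}`. -/
theorem lc_subComp (lam : k) (E : DecTree) (s : Sub E.shape) {m : ℕ+}
    (hm : (stree E s).shape.leaves = m) (x : Space k) {A M B : List Gen}
    (hA : A.length = Sub.pos E.shape s) (hM : M.length = (Sub.tree E.shape s).weight)
    (hB : B.length = Sub.after E.shape s) :
    lc k (A ++ (M ++ B)) ((collection k).subComp (Δ lam) E.shape s x) =
      (-1) ^ ((Sub.tree E.shape s).weight * cntV A) *
        (lc k (A ++ gen true m :: B) (Δ lam (Sub.quotient E.shape s) x) *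
            lc k M (Δ lam (Sub.tree E.shape s) (Finsupp.single (gen true m) 1)) +
          lc k (A ++ gen false m :: B) (Δ lam (Sub.quotient E.shape s) x) *
            lc k M (Δ lam (Sub.tree E.shape s) (Finsupp.single (gen false m) 1))) := by
  obtain ⟨pre, post, -, -, h3, -, h5, -⟩ := exists_split E s
  have hq : (Sub.quotient E.shape s).arities =
      pre.map Gen.arity ++ m :: (outs post).map Gen.arity := by
    rw [← shape_squot true, ← map_arity_gens, h5 true m hm]
    simp
  have hlen : pre.length + 1 + (outs post).length =
      Sub.pos E.shape s + 1 + Sub.after E.shape s := by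
    rw [← Sub.weight_quotient_eq, weight, hq]
    simp
    omega
  rw [GradedCollection.subComp, LinearMap.comp_apply, LinearMap.comp_apply, LinearMap.comp_apply,
    LinearEquiv.coe_coe, LinearEquiv.coe_coe, lc_cast, lc_insertMap hA hM hB m, lc_cast, lc_cast]
  have hx := Δ_mem_treeSpan lam (Sub.quotient E.shape s) x
  generalize Δ lam (Sub.quotient E.shape s) x = y at hx ⊢
  have := Submodule.mem_map_of_mem
    (f := (TensorPower.cast k (Space k) (Sub.weight_quotient_eq E.shape s)).toLinearMap) hx
  rw [treeSpan, Submodule.map_span] at this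
  refine Submodule.span_mono ?_ this
  rintro _ ⟨_, ⟨Y, hY, rfl⟩, rfl⟩
  rw [hq, List.map_eq_append_iff] at hY
  obtain ⟨A', Y', rfl, hA', hY'⟩ := hY
  rw [List.map_eq_cons_iff] at hY'
  obtain ⟨y, B', rfl, hy, hB'⟩ := hY'
  have hA'' := congrArg List.length hA'
  have hB'' := congrArg List.length hB'
  rw [List.length_map, List.length_map] at hA'' hB''
  refine ⟨A', y, B', by omega, by omega, hy, ?_⟩
  exact tg_cast _ _

/-- A term of the relations, in coordinates. -/
theorem lc_term (lam : k) (E : DecTree) (s : Sub E.shape) (b : Bool) {n : ℕ+}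
    (hn : (n : ℕ) = E.shape.leaves) :
    ((((Equiv.Perm.sign (Sub.perm E.shape s)⁻¹ : ℤˣ) : ℤ) : k) *
        (-1) ^ (Sub.pos E.shape s + (Sub.tree E.shape s).weight * Sub.after E.shape s)) *
      lc k E.gens ((collection k).permAction (Sub.perm E.shape s)⁻¹
        ((collection k).subComp (Δ lam) E.shape s (Finsupp.single (gen b n) 1))) =
    (-1) ^ nexp E.gens * ((-1) ^ sgnExp E s *
      (wt lam b (squot true E s) * wt lam true (stree E s) +
        wt lam b (squot false E s) * wt lam false (stree E s))) := by
  obtain ⟨pre, post, h1, h2, h3, h4, h5, h6⟩ := exists_split E s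
  obtain ⟨m, hm⟩ : ∃ m : ℕ+, (stree E s).shape.leaves = m := ⟨⟨_, leaves_pos _⟩, rfl⟩
  have hlen : (pre ++ post.map Prod.snd).length = E.shape.weight := by rw [← h1, length_gens]
  have hσ : Sub.perm E.shape s = Tuple.sort (sortKey E.shape.weight pre.length
      (List.replicate pre.length false ++ post.map Prod.fst)) := by
    rw [← h2, ← h3]
    rfl
  have hj : (Sub.tree E.shape s).weight = (ins post).length := by
    rw [← shape_stree, ← length_gens, h4]
  have ho : Sub.after E.shape s = (outs post).length := by
    have e1 := Sub.weight_quotient_eq E.shape s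
    rw [← shape_squot true, ← length_gens, h5 true m hm, h3] at e1
    simp only [List.length_append, List.length_cons] at e1
    omega
  have hV := ofFn_getD_sort pre post hlen
  rw [← hσ] at hV
  have hquot : ∀ b', lc k (pre ++ gen b' m :: outs post)
      (Δ lam (Sub.quotient E.shape s) (Finsupp.single (gen b n) 1)) =
      (-1) ^ nexp (pre ++ gen b' m :: outs post) * wt lam b (squot b' E s) := by
    intro b'
    rw [← shape_squot b', ← h5 b' m hm, lc_Δ]
    rw [shape_squot, leaves_quotient, hn]
  have htree : ∀ b', lc k (ins post)
      (Δ lam (Sub.tree E.shape s) (Finsupp.single (gen b' m) 1)) =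
      (-1) ^ nexp (ins post) * wt lam b' (stree E s) := by
    intro b'
    rw [← shape_stree, ← h4, lc_Δ]
    exact hm.symm
  have hsign : ∀ b', wt lam b' (stree E s) ≠ 0 → _ := fun b' h0 =>
    congrArg (Int.cast : ℤ → k) (total_sign pre post (gen b' m) hlen
      (by rw [← h4]; exact pv_eq_of_wt_ne_zero lam b' m h0) _ hσ)
  rw [lc_permAction, h1, hV, lc_subComp lam E s hm _ h3.symm hj.symm ho.symm, hquot, hquot, htree,
    htree, h6, hj, ho, h3]
  have hterm : ∀ b', ((((Equiv.Perm.sign (Sub.perm E.shape s)⁻¹ : ℤˣ) : ℤ) : k) *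
        (-1) ^ (pre.length + (ins post).length * (outs post).length)) *
      ((GradedCollection.koszulSign (Sub.perm E.shape s)⁻¹
        (par E.shape.weight (pre ++ (ins post ++ outs post))) : ℤ) : k) *
      (-1) ^ ((ins post).length * cntV pre) *
      (((-1) ^ nexp (pre ++ gen b' m :: outs post) * wt lam b (squot b' E s)) *
        ((-1) ^ nexp (ins post) * wt lam b' (stree E s))) =
      (-1) ^ nexp (pre ++ post.map Prod.snd) * (-1) ^ (cntU pre + inv post) *
        (wt lam b (squot b' E s) * wt lam b' (stree E s)) := by
    intro b'
    by_cases h0 : wt lam b' (stree E s) = 0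
    · simp [h0]
    · have := hsign b' h0
      rw [hV] at this
      push_cast at this
      rw [← this, pow_add _ (nexp (pre ++ gen b' m :: outs post))]
      ring
  linear_combination hterm true + hterm false

/-- Coordinates with the wrong arities do not occur in the relations. -/
theorem lc_term_eq_zero (lam : k) (E : DecTree) (s : Sub E.shape) (x : Space k) {W : List Gen}
    (hW : W.length = E.shape.weight) (hne : W.map Gen.arity ≠ E.shape.arities) :
    lc k W ((collection k).permAction (Sub.perm E.shape s)⁻¹
        ((collection k).subComp (Δ lam) E.shape s x)) = 0 := by
  obtain ⟨pre, post, h1, h2, h3, h4, h5, h6⟩ := exists_split E s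
  obtain ⟨m, hm⟩ : ∃ m : ℕ+, (stree E s).shape.leaves = m := ⟨⟨_, leaves_pos _⟩, rfl⟩
  have hlen : (pre ++ post.map Prod.snd).length = E.shape.weight := by rw [← h1, length_gens]
  have hσ : Sub.perm E.shape s = Tuple.sort (sortKey E.shape.weight pre.length
      (List.replicate pre.length false ++ post.map Prod.fst)) := by
    rw [← h2, ← h3]
    rfl
  have hj : (Sub.tree E.shape s).weight = (ins post).length := by
    rw [← shape_stree, ← length_gens, h4]
  have ho : Sub.after E.shape s = (outs post).length := by
    have e1 := Sub.weight_quotient_eq E.shape s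
    rw [← shape_squot true, ← length_gens, h5 true m hm, h3] at e1
    simp only [List.length_append, List.length_cons] at e1
    omega
  have hV := ofFn_getD_sort pre post hlen
  rw [← hσ] at hV
  rw [lc_permAction]
  set V := List.ofFn fun i => W.getD (Sub.perm E.shape s i) (Gen.u 1) with hVdef
  have hVlen : V.length = Sub.pos E.shape s + (Sub.tree E.shape s).weight +
      Sub.after E.shape s := by
    rw [Sub.weight_eq, hVdef, List.length_ofFn]
  -- The coordinate list is cut into the parts before, inside and after the subtree.
  obtain ⟨A, M, B, hAMB, hA, hM, hB⟩ : ∃ A M B, V = A ++ (M ++ B) ∧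
      A.length = Sub.pos E.shape s ∧ M.length = (Sub.tree E.shape s).weight ∧
      B.length = Sub.after E.shape s := by
    refine ⟨V.take (Sub.pos E.shape s), (V.drop (Sub.pos E.shape s)).take
      (Sub.tree E.shape s).weight, (V.drop (Sub.pos E.shape s)).drop (Sub.tree E.shape s).weight,
      by simp, ?_, ?_, ?_⟩ <;>
    simp only [List.length_take, List.length_drop] <;> omega
  rw [hAMB, lc_subComp lam E s hm x hA hM hB]
  have hzero : ∀ b', lc k (A ++ gen b' m :: B) (Δ lam (Sub.quotient E.shape s) x) *
      lc k M (Δ lam (Sub.tree E.shape s) (Finsupp.single (gen b' m) 1)) = 0 := by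
    intro b'
    by_contra h0
    have e1 := map_arity_of_lc_ne_zero (Δ_mem_treeSpan lam _ x)
      (by rw [Sub.weight_quotient_eq]; simp [hA, hB]; omega) (left_ne_zero_of_mul h0)
    have e2 := map_arity_of_lc_ne_zero (Δ_mem_treeSpan lam _ _) hM (right_ne_zero_of_mul h0)
    rw [← shape_squot b', ← map_arity_gens, h5 b' m hm, List.map_append, List.map_append] at e1
    rw [← shape_stree, ← map_arity_gens, h4] at e2
    obtain ⟨e3, e4⟩ := List.append_inj e1 (by simp [hA, h3])
    have e5 := (List.cons.inj e4).2
    have e6 : V.map Gen.arity = (List.ofFn fun i => (pre ++ post.map Prod.snd).getD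
        (Sub.perm E.shape s i) (Gen.u 1)).map Gen.arity := by
      rw [hV, hAMB]
      simp [e2, e3, e5]
    refine hne ?_
    rw [← map_arity_gens, h1]
    rw [hVdef, List.map_ofFn, List.map_ofFn] at e6
    have e7 := List.ofFn_injective e6
    refine ext_getD (n := E.shape.weight) 1 (by simp [hW]) (by rw [List.length_map, hlen])
      fun i => ?_
    have e8 := congrFun e7 ((Sub.perm E.shape s).symm i)
    simp only [Function.comp, Equiv.apply_symm_apply] at e8
    rw [List.getD_eq_getElem _ _ (by rw [hW]; exact i.2),
      List.getD_eq_getElem _ _ (by rw [hlen]; exact i.2)] at e8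
    rw [List.getD_eq_getElem _ _ (by rw [List.length_map, hW]; exact i.2),
      List.getD_eq_getElem _ _ (by rw [List.length_map, hlen]; exact i.2), List.getElem_map,
      List.getElem_map]
    exact e8
  rw [hzero, hzero, add_zero, mul_zero, mul_zero]

end DecTree

theorem Δ_single_of_ne (lam : k) {T : PTree} {g : Gen} (h : (g.arity : ℕ) ≠ T.leaves) :
    Δ lam T (Finsupp.single g 1) = 0 := by
  rw [Δ, Finsupp.linearCombination_single, one_smul, if_neg h]

theorem relation (lam : k) (T : PTree) :
    ∑ s : T.Sub,
      ((((Equiv.Perm.sign (PTree.Sub.perm T s)⁻¹ : ℤˣ) : ℤ) : k) *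
        (-1) ^ (PTree.Sub.pos T s + (PTree.Sub.tree T s).weight * PTree.Sub.after T s)) •
      ((collection k).permAction (PTree.Sub.perm T s)⁻¹ ∘ₗ
        (collection k).subComp (Δ lam) T s) = 0 := by
  refine Module.Basis.ext (Finsupp.basisSingleOne : Module.Basis Gen k (Space k)) fun g => ?_
  rw [Finsupp.coe_basisSingleOne, LinearMap.sum_apply, LinearMap.zero_apply]
  simp only [LinearMap.smul_apply, LinearMap.comp_apply]
  by_cases hg : (g.arity : ℕ) = T.leaves
  · refine tensor_ext fun W hW => ?_
    rw [map_sum, map_zero]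
    simp only [map_smul, smul_eq_mul]
    by_cases har : W.map Gen.arity = T.arities
    · obtain ⟨E, rfl, rfl⟩ := DecTree.exists_of_arities T W har
      rw [← gen_isU_arity g, Finset.sum_congr rfl fun s _ => DecTree.lc_term lam E s _ hg,
        ← Finset.mul_sum]
      cases g.isU
      · exact (congrArg _ (DecTree.sum_wtV lam E)).trans (mul_zero _)
      · exact (congrArg _ (DecTree.sum_wtU lam E)).trans (mul_zero _)
    · obtain ⟨E, rfl, -⟩ := DecTree.exists_of_arities T (T.arities.map Gen.u)
        (by simp [Function.comp_def, Gen.arity])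
      refine Finset.sum_eq_zero fun s _ => ?_
      rw [DecTree.lc_term_eq_zero lam E s _ hW har, mul_zero]
  · refine Finset.sum_eq_zero fun s _ => ?_
    rw [GradedCollection.subComp, LinearMap.comp_apply, LinearMap.comp_apply, LinearMap.comp_apply,
      Δ_single_of_ne lam (by rwa [PTree.leaves_quotient]), map_zero, map_zero, map_zero, map_zero,
      smul_zero]

end


/-! ### Degrees and finiteness -/

section

variable {k : Type*} [Field k]

theorem comp_le {n : ℕ+} {d : ℤ} {P : Submodule k (Space k)}
    (h : ∀ g : Gen, g.arity = n → g.degree = d → Finsupp.single g 1 ∈ P) :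
    (collection k).comp n d ≤ P := by
  change Finsupp.supported k k _ ≤ P
  rw [Finsupp.supported_eq_span_single, Submodule.span_le]
  rintro _ ⟨g, ⟨h1, h2⟩, rfl⟩
  exact h g h1 h2

theorem arityPart_le {n : ℕ+} {P : Submodule k (Space k)}
    (h : ∀ g : Gen, g.arity = n → Finsupp.single g 1 ∈ P) :
    (collection k).arityPart n ≤ P :=
  iSup_le fun _ => comp_le fun g h1 _ => h g h1

theorem Δ_u (lam : k) {T : PTree} {n : ℕ+} (h : (n : ℕ) = T.leaves) :
    Δ lam T (Finsupp.single (Gen.u n) 1) = ΔU T := by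
  rw [Δ, Finsupp.linearCombination_single, one_smul]
  exact if_pos h

theorem Δ_v (lam : k) {T : PTree} {n : ℕ+} (h : (n : ℕ) = T.leaves) :
    Δ lam T (Finsupp.single (Gen.v n) 1) = ΔV lam T := by
  rw [Δ, Finsupp.linearCombination_single, one_smul]
  exact if_pos h

/-- `Δ_T(v_n)` lies in any submodule that contains the relevant basis tensors. -/
theorem ΔV_mem (lam : k) (T : PTree) {P : Submodule k (⨂[k]^T.weight (Space k))}
    (h : ∀ m < 2, 2 ≤ T.weight → uAt k T m ∈ P) : ΔV lam T ∈ P := by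
  rw [ΔV]
  dsimp only
  split_ifs with hI _ hII hIII
  · obtain ⟨a, i, j, rfl⟩ := hI
    exact P.add_mem (P.smul_mem _ (h 1 one_lt_two (weight_twoVertex a i j).ge))
      (h 0 two_pos (weight_twoVertex a i j).ge)
  · obtain ⟨a, i, j, rfl⟩ := hI
    exact P.smul_mem _ (h 1 one_lt_two (weight_twoVertex a i j).ge)
  · obtain ⟨m, r, hm, rfl⟩ := hII
    refine P.smul_mem _ (h 0 two_pos ?_)
    rw [weight_node]
    simp only [weight_corolla]
    have := m.pos
    rw [Finset.sum_const, Finset.card_univ, Fintype.card_fin, smul_eq_mul]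
    omega
  · obtain ⟨a, i, p, K, r, -, -, rfl⟩ := hIII
    refine P.smul_mem _ (h 1 one_lt_two ?_)
    rw [weight_node, ← Finset.add_sum_erase _ _ (Finset.mem_univ i), Function.update_self,
      weight_node]
    omega
  · exact P.zero_mem

theorem ΔU_mem (T : PTree) {P : Submodule k (⨂[k]^T.weight (Space k))}
    (h : IsTypeI T → allU k T ∈ P) : ΔU T ∈ P := by
  rw [ΔU]
  split_ifs with hI
  · exact h hI
  · exact P.zero_mem

theorem allU_mem_treeTensor (T : PTree) : allU k T ∈ (collection k).treeTensor T 0 :=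
  Submodule.subset_span ⟨fun _ => 0, fun l => u k (T.arity l),
    fun l => single_mem_comp (Gen.u (T.arity l)), by simp, rfl⟩

theorem uAt_mem_treeTensor (T : PTree) {m : ℕ} (hm : m < T.weight) :
    uAt k T m ∈ (collection k).treeTensor T (T.weight - 1) := by
  refine Submodule.subset_span ⟨fun l => if l.val = m then 0 else 1,
    fun l => if l.val = m then u k (T.arity l) else v k (T.arity l), fun l => ?_, ?_, rfl⟩
  · beta_reduce
    split_ifs
    · exact single_mem_comp (Gen.u (T.arity l))
    · exact single_mem_comp (Gen.v (T.arity l))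
  · rw [← Finset.add_sum_erase _ _ (Finset.mem_univ (⟨m, hm⟩ : Fin T.weight)), if_pos rfl,
      Finset.sum_congr rfl (g := fun _ => (1 : ℤ))]
    · rw [Finset.sum_const, Finset.card_erase_of_mem (Finset.mem_univ _), Finset.card_univ,
        Fintype.card_fin]
      simp
      omega
    · intro l hl
      exact if_neg fun h => Finset.ne_of_mem_erase hl (Fin.ext h)

theorem Δ_mem_treeTensor (lam : k) (T : PTree) {n : ℕ+} (hn : (n : ℕ) = T.leaves) (d : ℤ)
    {c : Space k} (hc : c ∈ (collection k).comp n d) :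
    Δ lam T c ∈ (collection k).treeTensor T (d + (T.weight - 2)) := by
  refine comp_le (P := ((collection k).treeTensor T (d + (T.weight - 2))).comap (Δ lam T))
    (fun g h1 h2 => ?_) hc
  rw [Submodule.mem_comap]
  subst h1 h2
  rcases g with n | n
  · rw [Δ_u lam (n := n) hn]
    refine ΔU_mem T fun hI => ?_
    obtain ⟨a, i, j, rfl⟩ := hI
    have e : (Gen.u n).degree + (((twoVertex a i j).weight : ℤ) - 2) = 0 := by
      rw [weight_twoVertex]
      rfl
    rw [e]
    exact allU_mem_treeTensor _
  · rw [Δ_v lam (n := n) hn]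
    refine ΔV_mem lam T fun m hm hw => ?_
    have e : (Gen.v n).degree + ((T.weight : ℤ) - 2) = T.weight - 1 := by
      rw [Gen.degree]
      ring
    rw [e]
    exact uAt_mem_treeTensor T (by omega)

end

/-- The trees of height at most `h` with vertices of arity at most `N`. -/
def boundedTrees (N : ℕ) : ℕ → Set PTree
  | 0 => {PTree.leaf}
  | h + 1 => {PTree.leaf} ∪ ⋃ n ∈ {n : ℕ+ | (n : ℕ) ≤ N},
      PTree.node n '' Set.pi Set.univ fun _ => boundedTrees N h

theorem finite_boundedTrees (N h : ℕ) : (boundedTrees N h).Finite := by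
  induction h with
  | zero => exact Set.finite_singleton _
  | succ h ih =>
    refine (Set.finite_singleton _).union (Set.Finite.biUnion ?_ fun n _ =>
      (Set.Finite.pi fun _ => ih).image _)
    exact (Set.finite_Iic N).preimage PNat.coe_injective.injOn

theorem leaf_mem_boundedTrees (N h : ℕ) : PTree.leaf ∈ boundedTrees N h := by
  cases h with
  | zero => exact rfl
  | succ h => exact Or.inl rfl

theorem node_mem_boundedTrees {N h : ℕ} {n : ℕ+} {c : Fin n → PTree}
    (hl : (PTree.node n c).leaves ≤ N) (hc : ∀ i, (c i).leaves ≤ N → c i ∈ boundedTrees N h) :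
    PTree.node n c ∈ boundedTrees N (h + 1) := by
  rw [leaves_node] at hl
  refine Or.inr (Set.mem_biUnion (x := n) ?_ ⟨c, fun i _ => hc i ?_, rfl⟩)
  · refine le_trans ?_ hl
    calc (n : ℕ) = ∑ _i : Fin n, 1 := by simp
      _ ≤ ∑ i, (c i).leaves := Finset.sum_le_sum fun i _ => (c i).leaves_pos
  · exact (Finset.single_le_sum (f := fun i => (c i).leaves) (fun _ _ => Nat.zero_le _)
      (Finset.mem_univ i)).trans hl

theorem corolla_mem_boundedTrees {N h : ℕ} {n : ℕ+} (hl : (PTree.corolla n).leaves ≤ N) :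
    PTree.corolla n ∈ boundedTrees N (h + 1) :=
  node_mem_boundedTrees hl fun _ _ => leaf_mem_boundedTrees _ _

theorem graft_mem_boundedTrees {N h : ℕ} {n : ℕ+} {i : Fin n} {T : PTree}
    (hl : (PTree.node n (Function.update (fun _ => PTree.leaf) i T)).leaves ≤ N)
    (hT : T.leaves ≤ N → T ∈ boundedTrees N h) :
    PTree.node n (Function.update (fun _ => PTree.leaf) i T) ∈ boundedTrees N (h + 1) := by
  refine node_mem_boundedTrees hl fun j => ?_
  rcases eq_or_ne j i with rfl | hj
  · rwa [Function.update_self]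
  · rw [Function.update_of_ne hj]
    exact fun _ => leaf_mem_boundedTrees _ _

theorem mem_boundedTrees_of_type {T : PTree} (h : IsTypeI T ∨ IsTypeII T ∨ IsTypeIII T) :
    T ∈ boundedTrees T.leaves 3 := by
  obtain ⟨N, hN⟩ : ∃ N, N = T.leaves := ⟨_, rfl⟩
  rw [← hN]
  rcases h with ⟨a, i, j, rfl⟩ | ⟨m, r, -, rfl⟩ | ⟨a, i, p, K, r, -, -, rfl⟩
  · exact graft_mem_boundedTrees hN.ge fun h => corolla_mem_boundedTrees h
  · exact node_mem_boundedTrees hN.ge fun i h => corolla_mem_boundedTrees h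
  · refine graft_mem_boundedTrees hN.ge fun h => node_mem_boundedTrees h fun t h => ?_
    split_ifs at h ⊢
    · exact corolla_mem_boundedTrees h
    · exact leaf_mem_boundedTrees _ _

section

variable {k : Type*} [Field k]

theorem finite_Δ (lam : k) (c : Space k) : {T : PTree | T ≠ PTree.leaf ∧ Δ lam T c ≠ 0}.Finite := by
  refine (Set.Finite.biUnion c.support.finite_toSet fun g _ =>
    finite_boundedTrees g.arity 3).subset ?_
  rintro T ⟨-, hT⟩
  rw [Δ, Finsupp.linearCombination_apply] at hT
  obtain ⟨g, hg, hne⟩ := Finset.exists_ne_zero_of_sum_ne_zero hT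
  refine Set.mem_biUnion hg ?_
  have hne := right_ne_zero_of_smul hne
  split_ifs at hne with ha
  · rw [ha]
    apply mem_boundedTrees_of_type
    by_contra! h
    rcases g with n | n
    · exact hne (if_neg h.1)
    · refine hne ?_
      change ΔV lam T = 0
      rw [ΔV, if_neg h.1, if_neg h.2.1, if_neg h.2.2]
  · exact absurd rfl hne

theorem isHomotopyCooperad (lam : k) :
    GradedCollection.IsHomotopyCooperad (collection k) (Δ lam) where
  eq_zero T _ n hn _ hc := by
    refine arityPart_le (P := LinearMap.ker (Δ lam T)) (fun g hg => ?_) hc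
    subst hg
    exact Δ_single_of_ne lam hn
  mem_treeTensor T _ _ hn d _ hc := Δ_mem_treeTensor lam T hn d hc
  finite := finite_Δ lam
  relation T _ := relation lam T

/-! ### The counit and the coaugmentation -/

theorem counit_v (n : ℕ+) : counit k (v k n) = 0 :=
  Finsupp.single_eq_of_ne' (by simp)

theorem counit_u (n : ℕ+) : counit k (u k n) = if n = 1 then 1 else 0 := by
  split_ifs with h
  · subst h
    exact Finsupp.single_eq_same
  · exact Finsupp.single_eq_of_ne' fun h' => h (Gen.u.inj h')

theorem arities_twoVertex (a : ℕ+) (i : Fin a) (j : ℕ+) : (twoVertex a i j).arities = [a, j] := by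
  have h := DecTree.map_arity_gens (DecTree.graft true a i (DecTree.corolla true j))
  rw [DecTree.gens_two, DecTree.shape_graft] at h
  exact h.symm

theorem leaves_twoVertex (a : ℕ+) (i : Fin a) (j : ℕ+) :
    (twoVertex a i j).leaves + 1 = a + j := by
  have := leaves_graft a i (PTree.corolla j)
  rwa [leaves_corolla] at this

theorem uAt_eq_tg {T : PTree} {m : ℕ} {Y : List Gen} (hY : Y.map Gen.arity = T.arities)
    (h : Y.map Gen.isU = List.ofFn fun l : Fin T.weight => decide (l.val = m)) :
    uAt k T m = tg k T.weight Y := by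
  rw [uAt, tg]
  congr 1
  funext l
  have hl : l.val < Y.length := by rw [length_of_arities hY]; exact l.2
  have h1 := List.getElem_of_eq h (i := l.val) (by simpa using hl)
  rw [List.getElem_map, List.getElem_ofFn] at h1
  rw [← getD_arity hY l, List.getD_eq_getElem _ _ hl]
  rcases hg : Y[l.val] with n | n
  · rw [hg] at h1
    rw [if_pos (of_decide_eq_true h1.symm)]
    rfl
  · rw [hg] at h1
    rw [if_neg (of_decide_eq_false h1.symm)]
    rfl

theorem allU_eq_tg (T : PTree) : allU k T = tg k T.weight (T.arities.map Gen.u) := by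
  rw [allU, tg]
  congr 1
  funext l
  rw [List.getD_eq_getElem _ _ (by rw [List.length_map]; exact l.2)]
  simp [u, arity]

theorem ofFn_of_eq_two {α : Type*} {n : ℕ} (h : n = 2) (f : ℕ → α) :
    (List.ofFn fun l : Fin n => f l) = [f 0, f 1] := by
  subst h
  rfl

theorem uAt_zero_twoVertex (a : ℕ+) (i : Fin a) (j : ℕ+) :
    uAt k (twoVertex a i j) 0 = tg k _ [Gen.u a, Gen.v j] :=
  uAt_eq_tg (arities_twoVertex a i j).symm
    (ofFn_of_eq_two (weight_twoVertex a i j) fun l => decide (l = 0)).symm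

theorem uAt_one_twoVertex (a : ℕ+) (i : Fin a) (j : ℕ+) :
    uAt k (twoVertex a i j) 1 = tg k _ [Gen.v a, Gen.u j] :=
  uAt_eq_tg (arities_twoVertex a i j).symm
    (ofFn_of_eq_two (weight_twoVertex a i j) fun l => decide (l = 1)).symm

theorem ΔU_twoVertex (a : ℕ+) (i : Fin a) (j : ℕ+) :
    ΔU (k := k) (twoVertex a i j) = tg k _ [Gen.u a, Gen.u j] := by
  rw [ΔU, if_pos ⟨a, i, j, rfl⟩, allU_eq_tg, arities_twoVertex]
  rfl

theorem ΔV_twoVertex (lam : k) (a : ℕ+) (i : Fin a) (j : ℕ+) :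
    ΔV lam (twoVertex a i j) =
      lam ^ ((j : ℕ) - 1) • tg k _ [Gen.v a, Gen.u j] +
        if a = 1 then tg k _ [Gen.u a, Gen.v j] else 0 := by
  have h1 : secondArity (twoVertex a i j) = j := by
    rw [secondArity, arities_twoVertex]
    rfl
  have h2 := leaves_twoVertex a i j
  rw [ΔV, if_pos ⟨a, i, j, rfl⟩]
  dsimp only
  rw [h1, uAt_zero_twoVertex, uAt_one_twoVertex]
  by_cases ha : a = 1
  · subst ha
    have h3 : (twoVertex 1 i j).leaves = j := by simpa [add_comm] using h2
    rw [if_pos h3.symm, if_pos rfl, h3]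
  · rw [if_neg ha, add_zero, if_neg]
    intro h
    exact ha (PNat.eq (by rw [PNat.one_coe]; omega))

theorem pair_eq_mul (g h : Gen) :
    tg k 2 [g, h] = TensorPower.mulEquiv (n := 1) (m := 1) (tg k 1 [g] ⊗ₜ tg k 1 [h]) :=
  tg_append (n := 1) (m := 1) (A := [g]) (B := [h]) rfl

theorem subsingletonEquiv_tg (g : Gen) :
    (PiTensorProduct.subsingletonEquiv (0 : Fin 1) : (⨂[k]^1 (Space k)) ≃ₗ[k] Space k)
      (tg k 1 [g]) = Finsupp.single g 1 := by
  rw [tg, PiTensorProduct.subsingletonEquiv_apply_tprod]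
  rfl

theorem idTensor_tg (ε : Space k →ₗ[k] k) (g h : Gen) :
    GradedCollection.idTensor ε (tg k 2 [g, h]) =
      ε (Finsupp.single h 1) • Finsupp.single g 1 := by
  simp only [GradedCollection.idTensor, pair_eq_mul, LinearMap.comp_apply, LinearEquiv.coe_coe,
    LinearEquiv.symm_apply_apply, TensorProduct.map_tmul, subsingletonEquiv_tg,
    TensorProduct.rid_tmul]

theorem tensorId_tg (ε : Space k →ₗ[k] k) (g h : Gen) :
    GradedCollection.tensorId ε (tg k 2 [g, h]) =
      ε (Finsupp.single g 1) • Finsupp.single h 1 := by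
  simp only [GradedCollection.tensorId, pair_eq_mul, LinearMap.comp_apply, LinearEquiv.coe_coe,
    LinearEquiv.symm_apply_apply, TensorProduct.map_tmul, subsingletonEquiv_tg,
    TensorProduct.lid_tmul]

theorem right_counit (lam : k) (n : ℕ+) (i : Fin n) {c : Space k}
    (hc : c ∈ (collection k).arityPart n) :
    GradedCollection.idTensor (counit k) (TensorPower.cast k (Space k) (weight_twoVertex n i 1)
      (Δ lam (twoVertex n i 1) c)) = c := by
  have hl : (n : ℕ) = (twoVertex n i 1).leaves := by
    have := leaves_twoVertex n i 1
    rw [PNat.one_coe] at this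
    omega
  refine arityPart_le (P := LinearMap.eqLocus (GradedCollection.idTensor (counit k) ∘ₗ
    (TensorPower.cast k (Space k) (weight_twoVertex n i 1)).toLinearMap ∘ₗ
      Δ lam (twoVertex n i 1)) LinearMap.id) (fun g hg => ?_) hc
  rw [LinearMap.mem_eqLocus, LinearMap.comp_apply, LinearMap.comp_apply, LinearMap.id_apply,
    LinearEquiv.coe_coe]
  have hu : counit k (Finsupp.single (Gen.u 1) 1) = 1 := by
    simpa [u] using counit_u (k := k) 1
  rcases g with m | m
  · obtain rfl : m = n := hg
    rw [Δ_u lam hl, ΔU_twoVertex, tg_cast, idTensor_tg, hu, one_smul]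
  · obtain rfl : m = n := hg
    have hv : counit k (Finsupp.single (Gen.v 1) 1) = 0 := counit_v 1
    rw [Δ_v lam hl, ΔV_twoVertex, map_add, map_smul, tg_cast, map_add, map_smul, idTensor_tg, hu]
    split_ifs
    · rw [tg_cast, idTensor_tg, hv]
      simp
    · simp

theorem left_counit (lam : k) (n : ℕ+) {c : Space k} (hc : c ∈ (collection k).arityPart n) :
    GradedCollection.tensorId (counit k)
      (TensorPower.cast k (Space k) (weight_twoVertex 1 ⟨0, PNat.pos 1⟩ n)
        (Δ lam (twoVertex 1 ⟨0, PNat.pos 1⟩ n) c)) = c := by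
  have hl : (n : ℕ) = (twoVertex 1 ⟨0, PNat.pos 1⟩ n).leaves := by
    have := leaves_twoVertex 1 ⟨0, PNat.pos 1⟩ n
    have := PNat.one_coe
    omega
  refine arityPart_le (P := LinearMap.eqLocus (GradedCollection.tensorId (counit k) ∘ₗ
    (TensorPower.cast k (Space k) (weight_twoVertex 1 ⟨0, PNat.pos 1⟩ n)).toLinearMap ∘ₗ
      Δ lam (twoVertex 1 ⟨0, PNat.pos 1⟩ n)) LinearMap.id) (fun g hg => ?_) hc
  rw [LinearMap.mem_eqLocus, LinearMap.comp_apply, LinearMap.comp_apply, LinearMap.id_apply,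
    LinearEquiv.coe_coe]
  have hu : counit k (Finsupp.single (Gen.u 1) 1) = 1 := by
    simpa [u] using counit_u (k := k) 1
  have hv : counit k (Finsupp.single (Gen.v 1) 1) = 0 := counit_v 1
  rcases g with m | m
  · obtain rfl : m = n := hg
    rw [Δ_u lam hl, ΔU_twoVertex, tg_cast, tensorId_tg, hu, one_smul]
  · obtain rfl : m = n := hg
    rw [Δ_v lam hl, ΔV_twoVertex, if_pos rfl, map_add, map_smul, tg_cast, tg_cast, map_add,
      map_smul, tensorId_tg, tensorId_tg, hu, hv]
    simp

theorem unitΔ_twoVertex :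
    GradedCollection.unitΔ k (twoVertex 1 ⟨0, PNat.pos 1⟩ 1) =
      LinearMap.toSpanSingleton k _ (PiTensorProduct.tprod k fun _ => 1) := by
  rw [GradedCollection.unitΔ, if_pos rfl]

theorem unitΔ_of_ne {T : PTree} (hT : T ≠ twoVertex 1 ⟨0, PNat.pos 1⟩ 1) :
    GradedCollection.unitΔ k T = 0 := by
  rw [GradedCollection.unitΔ, if_neg hT]

theorem leaves_twoVertex_one : (twoVertex 1 ⟨0, PNat.pos 1⟩ 1).leaves = 1 := by
  have := leaves_twoVertex 1 ⟨0, PNat.pos 1⟩ 1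
  have := PNat.one_coe
  omega

theorem arity_twoVertex_one (l : Fin (twoVertex 1 ⟨0, PNat.pos 1⟩ 1).weight) :
    (twoVertex 1 ⟨0, PNat.pos 1⟩ 1).arity l = 1 := by
  have h : ∀ n ∈ (twoVertex 1 ⟨0, PNat.pos 1⟩ 1).arities, n = 1 := by
    rw [arities_twoVertex]
    simp
  exact h _ (List.get_mem _ _)

theorem twoVertex_eq_of_one {a j : ℕ+} (i : Fin a) (ha : a = 1) (hj : j = 1) :
    twoVertex a i j = twoVertex 1 ⟨0, PNat.pos 1⟩ 1 := by
  subst ha hj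
  congr 1
  exact Fin.ext (Nat.lt_one_iff.1 i.2)

theorem map_counit_ΔV (lam : k) (T : PTree) :
    PiTensorProduct.map (fun _ : Fin T.weight => counit k) (ΔV lam T) = 0 := by
  refine ΔV_mem lam T (P := LinearMap.ker (PiTensorProduct.map fun _ : Fin T.weight => counit k))
    fun m _ hw => ?_
  rw [LinearMap.mem_ker, uAt, PiTensorProduct.map_tprod]
  -- At least one of two vertices is decorated by `v`, on which the counit vanishes.
  obtain ⟨l, hl⟩ : ∃ l : Fin T.weight, l.val ≠ m := by
    rcases eq_or_ne m 0 with rfl | h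
    · exact ⟨⟨1, by omega⟩, one_ne_zero⟩
    · exact ⟨⟨0, by omega⟩, h.symm⟩
  refine MultilinearMap.map_coord_zero _ l ?_
  rw [if_neg hl, counit_v]

theorem map_counit_ΔU {T : PTree} (hT : T ≠ twoVertex 1 ⟨0, PNat.pos 1⟩ 1) :
    PiTensorProduct.map (fun _ : Fin T.weight => counit k) (ΔU T) = 0 := by
  refine ΔU_mem T (P := LinearMap.ker (PiTensorProduct.map fun _ : Fin T.weight => counit k))
    fun hI => ?_
  obtain ⟨a, i, j, rfl⟩ := hI
  have har : (twoVertex a i j).arity ⟨0, by rw [weight_twoVertex]; exact two_pos⟩ = a ∧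
      (twoVertex a i j).arity ⟨1, by rw [weight_twoVertex]; exact one_lt_two⟩ = j := by
    simp [arity, arities_twoVertex]
  rw [LinearMap.mem_ker, allU, PiTensorProduct.map_tprod]
  by_cases ha : a = 1
  · refine MultilinearMap.map_coord_zero _ ⟨1, by rw [weight_twoVertex]; exact one_lt_two⟩ ?_
    rw [har.2, counit_u, if_neg]
    exact fun hj => hT (twoVertex_eq_of_one i ha hj)
  · refine MultilinearMap.map_coord_zero _ ⟨0, by rw [weight_twoVertex]; exact two_pos⟩ ?_
    rw [har.1, counit_u, if_neg ha]

theorem isStrictMorphism_counit (lam : k) :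
    GradedCollection.IsStrictMorphism (collection k) (Δ lam) (GradedCollection.unit k)
      (GradedCollection.unitΔ k) (counit k) where
  map_comp n d c hc := by
    refine comp_le (P := ((GradedCollection.unit k).comp n d).comap (counit k))
      (fun g h1 h2 => ?_) hc
    rw [Submodule.mem_comap]
    rcases g with m | m
    · subst h1 h2
      change counit k (u k m) ∈ _
      rw [counit_u]
      split_ifs with h
      · subst h
        simp [GradedCollection.unit, Gen.arity, Gen.degree]
      · exact Submodule.zero_mem _
    · change counit k (v k m) ∈ _
      rw [counit_v]
      exact Submodule.zero_mem _
  comm T _ := by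
    refine Module.Basis.ext (Finsupp.basisSingleOne : Module.Basis Gen k (Space k)) fun g => ?_
    rw [Finsupp.coe_basisSingleOne, LinearMap.comp_apply, LinearMap.comp_apply]
    rcases g with n | n
    · change GradedCollection.unitΔ k T (counit k (u k n)) = _
      rw [counit_u]
      by_cases hT : T = twoVertex 1 ⟨0, PNat.pos 1⟩ 1
      · subst hT
        rw [unitΔ_twoVertex]
        split_ifs with hn
        · subst hn
          rw [Δ_u lam (by rw [leaves_twoVertex_one]; rfl), ΔU, if_pos ⟨1, _, 1, rfl⟩, allU,
            PiTensorProduct.map_tprod]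
          simp only [arity_twoVertex_one, counit_u, if_true]
          rw [LinearMap.toSpanSingleton_apply, one_smul]
        · rw [Δ_single_of_ne lam, map_zero, map_zero]
          rw [leaves_twoVertex_one]
          exact fun h => hn (PNat.eq h)
      · rw [unitΔ_of_ne hT, LinearMap.zero_apply]
        by_cases hn : (n : ℕ) = T.leaves
        · rw [Δ_u lam hn, map_counit_ΔU hT]
        · rw [Δ_single_of_ne lam (g := Gen.u n) hn, map_zero]
    · change GradedCollection.unitΔ k T (counit k (v k n)) = _
      rw [counit_v, map_zero]
      by_cases hn : (n : ℕ) = T.leaves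
      · rw [Δ_v lam hn, map_counit_ΔV]
      · rw [Δ_single_of_ne lam (g := Gen.v n) hn, map_zero]

theorem coaugmentation_one : coaugmentation k 1 = u k 1 := rfl

theorem isStrictMorphism_coaugmentation (lam : k) :
    GradedCollection.IsStrictMorphism (GradedCollection.unit k) (GradedCollection.unitΔ k)
      (collection k) (Δ lam) (coaugmentation k) where
  map_comp n d c hc := by
    change c ∈ (if (n, d) = ((1, 0) : ℕ+ × ℤ) then ⊤ else ⊥ : Submodule k k) at hc
    split_ifs at hc with h
    · obtain ⟨rfl, rfl⟩ := Prod.ext_iff.1 h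
      exact Finsupp.single_mem_supported k c ⟨rfl, rfl⟩
    · rw [(Submodule.mem_bot k).1 hc, map_zero]
      exact Submodule.zero_mem _
  comm T _ := by
    refine LinearMap.ext_ring ?_
    rw [LinearMap.comp_apply, LinearMap.comp_apply, coaugmentation_one]
    by_cases hT : T = twoVertex 1 ⟨0, PNat.pos 1⟩ 1
    · subst hT
      rw [unitΔ_twoVertex, u, Δ_u lam (by rw [leaves_twoVertex_one]; rfl), ΔU,
        if_pos ⟨1, _, 1, rfl⟩, allU, LinearMap.toSpanSingleton_apply, one_smul,
        PiTensorProduct.map_tprod]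
      simp only [arity_twoVertex_one, coaugmentation_one]
    · rw [unitΔ_of_ne hT, LinearMap.zero_apply, map_zero, u]
      by_cases hn : ((1 : ℕ+) : ℕ) = T.leaves
      · rw [Δ_u lam hn, ΔU, if_neg]
        rintro ⟨a, i, j, rfl⟩
        have h := leaves_twoVertex a i j
        rw [← hn, PNat.one_coe] at h
        have ha := a.pos
        have hj := j.pos
        exact hT (twoVertex_eq_of_one i (PNat.eq (by rw [PNat.one_coe]; omega))
          (PNat.eq (by rw [PNat.one_coe]; omega)))
      · exact Δ_single_of_ne lam hn

theorem counit_comp_coaugmentation : counit k ∘ₗ coaugmentation k = LinearMap.id := by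
  refine LinearMap.ext_ring ?_
  rw [LinearMap.comp_apply, coaugmentation_one, counit_u]
  rfl

end

end SRB

/-- The graded collection with components `k uₙ ⊕ k vₙ` and the operations `Δ_T` form a coaugmented
homotopy cooperad, with the natural projection onto `k u₁` as strict counit and the natural
embedding of `k u₁` as coaugmentation. -/
theorem mainTheorem2 (k : Type*) [Field k] [CharZero k] (lam : k) :
    GradedCollection.IsCoaugmentedHomotopyCooperad (SRB.collection k) (SRB.Δ lam)
      (SRB.counit k) (SRB.coaugmentation k) where
  homotopyCooperad := SRB.isHomotopyCooperad lam
  counit :=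
    { strict := SRB.isStrictMorphism_counit lam
      right_counit := fun n i _ hc => SRB.right_counit lam n i hc
      left_counit := fun n _ hc => SRB.left_counit lam n hc }
  coaugmentation := SRB.isStrictMorphism_coaugmentation lam
  counit_comp := SRB.counit_comp_coaugmentation
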